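/- **Setting.** All functions live on $\mathbb R^2$ with polar coordinates $(r,\theta)$; $B_s$ is the open disk of radius $s$ centred at $0$. Let $L\ge 1$ and $N\ge 0$ be integers, let $2=r_1>r_2>\dots>r_{L+1}=1$, let $\sigma_0=1$, $\sigma_1,\dots,\sigma_L>0$ and $\sigma_{L+1}=0$, and let $$\sigma=\sum_{j=0}^{L+1}\sigma_j\chi(A_j),\qquad A_0=\{r>r_1\},\quad A_j=\{r_{j+1}<r\le r_j\}\ (1\le j\le L),\quad A_{L+1}=\{r\le r_{L+1}\},$$ so that $\sigma$ is a disk of radius $2$ with $L$ coatings around an insulated core of radius $1$ (in particular one may take $L=N\ge1$). For a harmonic polynomial $H$ let $u$ be the weak ($H^1_{\rm loc}$ up to the boundary of the core) solution of $\nabla\cdot\sigma\nabla u=0$ outside the core, with $\partial u/\partial\nu=0$ on the boundary of the core and $u-H=O(|x|^{-1})$ as $|x|\to\infty$. The contracted generalized polarization tensors $M^{cc}_{mn},M^{cs}_{mn},M^{sc}_{mn},M^{ss}_{mn}$ $(m,n\ge1)$ of $\sigma$ are the coefficients in the expansions, for $|x|>2$, $$(u-H)(x)=-\sum_{m\ge1}\frac{\cos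 m\theta}{2\pi m r^m}M^{cc}_{mn}-\sum_{m\ge1}\frac{\sin m\theta}{2\pi m r^m}M^{sc}_{mn}\quad\text{if }H=r^n\cos n\theta,$$ $$(u-H)(x)=-\sum_{m\ge1}\frac{\cos m\theta}{2\pi m r^m}M^{cs}_{mn}-\sum_{m\ge1}\frac{\sin m\theta}{2\pi m r^m}M^{ss}_{mn}\quad\text{if }H=r^n\sin n\theta.$$ Assume that $\sigma$ is a GPT-vanishing structure of order $N$: $M^{cc}_{mn}=M^{cs}_{mn}=M^{sc}_{mn}=M^{ss}_{mn}=0$ for all $1\le m,n\le N$. For $0<\rho<1$ put $\Psi_{1/\rho}(x)=x/\rho$, let $F_\rho:B_2\to B_2$ be $$F_\rho(x)=\begin{cases}x,&\frac32\le|x|\le2,\\ \Bigl(\frac{3-3\rho}{3-2\rho}+\frac{1}{3-2\rho}|x|\Bigr)\frac{x}{|x|},&\rho\le|x|\le\frac32,\\ x/\rho,&|x|\le\rho,\end{cases}$$ and let $$(F_\rho)_*(\sigma\circ\Psi_{1/\rho})=\frac{(DF_\rho)\,(\sigma\circ\Psi_{1/\rho})\,(DF_\rho)^T}{|\det DF_\rho|}\circ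 F_\rho^{-1},$$ a matrix-valued conductivity. For a conductivity $A$ and $K=\overline{B_1}$ or $K=\emptyset$, the Dirichlet-to-Neumann map $\Lambda_{B_2,K}[A]:H^{1/2}(\partial B_2)\to H^{-1/2}(\partial B_2)$ sends $f$ to $A\nabla u\cdot\nu|_{\partial B_2}$, where $u\in H^1(B_2\setminus K)$ is the weak solution of $\nabla\cdot A\nabla u=0$ in $B_2\setminus K$, $A\nabla u\cdot\nu=0$ on $\partial K$, $u=f$ on $\partial B_2$. **Theorem.** There is a constant $C$, independent of $\rho$, such that for all $0<\rho<1$ the maps $\Lambda_{B_2,\overline{B_1}}\bigl[(F_\rho)_*(\sigma\circ\Psi_{1/\rho})\bigr]$ and $\Lambda_{B_2,\emptyset}[1]$ exist as bounded operators from $H^{1/2}(\partial B_2)$ to $H^{-1/2}(\partial B_2)$ and $$\Bigl\|\Lambda_{B_2,\overline{B_1}}\bigl[(F_\rho)_*(\sigma\circ\Psi_{1/\rho})\bigr]-\Lambda_{B_2,\emptyset}[1]\Bigr\|\le C\rho^{2N+2}$$ in the operator norm from $H^{1/2}(\partial B_2)$ to its dual $H^{-1/2}(\partial B_2)$. -/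

import Mathlib

open Set MeasureTheory
open scoped Real ENNReal ContDiff Matrix

namespace NearCloaking

noncomputable section

/-! ### The plane, polar coordinates, test functions -/

/-- The Euclidean plane. -/
abbrev Plane : Type := EuclideanSpace ℝ (Fin 2)

/-- The polar angle `θ` of `x = (r cos θ, r sin θ)`; the radius is `‖x‖`. -/
def angle (x : Plane) : ℝ := Complex.arg ⟨x 0, x 1⟩

/-- Test functions: smooth real functions with compact support in the plane. -/
structure IsTest (φ : Plane → ℝ) : Prop where
  smooth : ContDiff ℝ ∞ φ
  compact : HasCompactSupport φ

/-- The partial derivative `∂ᵢ φ`. -/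
def pd (i : Fin 2) (φ : Plane → ℝ) (x : Plane) : ℝ :=
  fderiv ℝ φ x (EuclideanSpace.single i 1)

section Weak

variable {E : Type*} [NormedAddCommGroup E] [NormedSpace ℝ E]

/-- `G` is the weak gradient of `u` in the open set `U`. It is used below only for `u` and `G`
that are square integrable on the bounded parts of `U`. -/
def HasWeakGradOn (U : Set Plane) (u : Plane → E) (G : Plane → Fin 2 → E) : Prop :=
  ∀ φ : Plane → ℝ, IsTest φ → tsupport φ ⊆ U → ∀ i : Fin 2,
    ∫ x in U, pd i φ x • u x = -∫ x in U, φ x • G x i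

/-- The form `∫_U (A ∇u) · ∇φ`, where `G = ∇u`. -/
def fluxForm (A : Plane → Matrix (Fin 2) (Fin 2) ℝ) (U : Set Plane)
    (G : Plane → Fin 2 → E) (φ : Plane → ℝ) : E :=
  ∫ x in U, ∑ i, ∑ j, (A x i j * pd i φ x) • G x j

end Weak

/-- A scalar (isotropic) conductivity as a matrix field. -/
def isotropic (s : Plane → ℝ) (x : Plane) : Matrix (Fin 2) (Fin 2) ℝ := s x • 1

/-! ### The multi-coated disk with insulated core -/

/-- The regions `A_0 = {r_1 < |x|}`, `A_j = {r_{j+1} < |x| ≤ r_j}` for `1 ≤ j ≤ L`, and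
`A_{L+1} = {|x| ≤ r_{L+1}}`. -/
def region (L : ℕ) (r : ℕ → ℝ) (j : ℕ) : Set Plane :=
  if j = 0 then {x | r 1 < ‖x‖}
  else if j = L + 1 then {x | ‖x‖ ≤ r (L + 1)}
  else {x | r (j + 1) < ‖x‖ ∧ ‖x‖ ≤ r j}

/-- The conductivity distribution `∑_{j=0}^{L+1} σ_j χ(A_j)`. -/
def layered (L : ℕ) (r σ : ℕ → ℝ) (x : Plane) : ℝ :=
  ∑ j ∈ Finset.range (L + 2), (region L r j).indicator (fun _ => σ j) x

/-- Radii `2 = r_1 > r_2 > ⋯ > r_{L+1} = 1` and conductivities: `σ_0 = 1` in the background,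
`σ_1, …, σ_L > 0` in the `L` coatings, `σ_{L+1} = 0` in the insulated core. -/
structure IsCoatedDisk (L : ℕ) (r σ : ℕ → ℝ) : Prop where
  outer : r 1 = 2
  inner : r (L + 1) = 1
  decreasing : ∀ j, 1 ≤ j → j ≤ L → r (j + 1) < r j
  background : σ 0 = 1
  coating : ∀ j, 1 ≤ j → j ≤ L → 0 < σ j
  core : σ (L + 1) = 0

/-! ### Contracted generalized polarization tensors -/

/-- The exterior of the insulated core. -/
def exterior : Set Plane := {x | 1 < ‖x‖}

/-- `u` solves `∇ · s∇u = 0` in the plane, `u - H = O(|x|⁻¹)` at infinity, where the conductivity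
`s` vanishes in the unit disk. Thus `u` is an `H¹_loc` function outside the core (up to its
boundary), and as the test functions do not have to vanish on the core, the equation contains the
homogeneous Neumann condition on the boundary of the core. -/
def IsTransmissionSolution (s H u : Plane → ℝ) : Prop :=
  (∃ G : Plane → Fin 2 → ℝ,
    (∀ R : ℝ, MemLp u 2 (volume.restrict (exterior ∩ Metric.ball 0 R)) ∧
      MemLp G 2 (volume.restrict (exterior ∩ Metric.ball 0 R))) ∧
    HasWeakGradOn exterior u G ∧
    ∀ φ, IsTest φ → fluxForm (isotropic s) exterior G φ = 0) ∧
  ∃ C R : ℝ, ∀ᵐ x : Plane, R < ‖x‖ → |u x - H x| ≤ C * ‖x‖⁻¹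

/-- The harmonic polynomial `rⁿ cos nθ`. -/
def harmCos (n : ℕ) (x : Plane) : ℝ := ‖x‖ ^ n * Real.cos (n * angle x)

/-- The harmonic polynomial `rⁿ sin nθ`. -/
def harmSin (n : ℕ) (x : Plane) : ℝ := ‖x‖ ^ n * Real.sin (n * angle x)

/-- The multipolar expansion
`w(x) = -∑_{m ≥ 1} (cos mθ / (2π m r^m)) c_m - ∑_{m ≥ 1} (sin mθ / (2π m r^m)) d_m`
in the region `|x| > 2`. -/
def HasMultipoleExpansion (w : Plane → ℝ) (c d : ℕ → ℝ) : Prop :=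
  ∀ᵐ x : Plane, 2 < ‖x‖ → HasSum (fun k : ℕ =>
    -(Real.cos ((k + 1 : ℕ) * angle x) / (2 * π * (k + 1 : ℕ) * ‖x‖ ^ (k + 1)) * c (k + 1))
    - (Real.sin ((k + 1 : ℕ) * angle x) / (2 * π * (k + 1 : ℕ) * ‖x‖ ^ (k + 1)) * d (k + 1)))
    (w x)

/-- `Mcc`, `Mcs`, `Msc`, `Mss` are the contracted generalized polarization tensors of the
conductivity distribution `s` (with indices `m, n ≥ 1`): the coefficients of the multipolar
expansions of `u - H`, for `H = rⁿ cos nθ` and for `H = rⁿ sin nθ`. -/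
structure IsContractedGPT (s : Plane → ℝ) (Mcc Mcs Msc Mss : ℕ → ℕ → ℝ) : Prop where
  cos_expansion : ∀ n, 1 ≤ n → ∀ u, IsTransmissionSolution s (harmCos n) u →
    HasMultipoleExpansion (fun x => u x - harmCos n x) (fun m => Mcc m n) (fun m => Msc m n)
  sin_expansion : ∀ n, 1 ≤ n → ∀ u, IsTransmissionSolution s (harmSin n) u →
    HasMultipoleExpansion (fun x => u x - harmSin n x) (fun m => Mcs m n) (fun m => Mss m n)

/-- `s` is a GPT-vanishing structure of order `N`. -/
def IsGPTVanishing (N : ℕ) (s : Plane → ℝ) : Prop :=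
  ∃ Mcc Mcs Msc Mss : ℕ → ℕ → ℝ, IsContractedGPT s Mcc Mcs Msc Mss ∧
    ∀ m n, 1 ≤ m → m ≤ N → 1 ≤ n → n ≤ N →
      Mcc m n = 0 ∧ Mcs m n = 0 ∧ Msc m n = 0 ∧ Mss m n = 0

/-! ### The blow-up transformation and the push-forward -/

/-- The radial map `F_ρ`: it is the identity for `|x| ≥ 3/2`, it maps `ρ ≤ |x| ≤ 3/2` onto
`1 ≤ |x| ≤ 3/2`, and it is `x / ρ` for `|x| ≤ ρ`. For `0 < ρ < 1` it is a bijection of the plane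
and of the disk of radius 2. -/
def blowUp (ρ : ℝ) (x : Plane) : Plane :=
  if ‖x‖ ≤ ρ then ρ⁻¹ • x
  else if ‖x‖ ≤ 3 / 2 then
    (((3 - 3 * ρ) / (3 - 2 * ρ) + 1 / (3 - 2 * ρ) * ‖x‖) * ‖x‖⁻¹) • x
  else x

/-- The Jacobian matrix `(∂_j F_i)`. -/
def jacobian (F : Plane → Plane) (x : Plane) : Matrix (Fin 2) (Fin 2) ℝ :=
  Matrix.of fun i j => fderiv ℝ F x (EuclideanSpace.single j 1) i

/-- The push-forward `F_* s = (DF s DFᵀ / |det DF|) ∘ F⁻¹` of a scalar conductivity. -/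
def pushForward (F : Plane → Plane) (s : Plane → ℝ) (y : Plane) : Matrix (Fin 2) (Fin 2) ℝ :=
  let x := Function.invFun F y
  |(jacobian F x).det|⁻¹ • (jacobian F x * isotropic s x * (jacobian F x)ᵀ)

/-- `Ψ_t(x) = t x`. -/
def dilation (t : ℝ) (x : Plane) : Plane := t • x

/-! ### The Sobolev space of order 1/2 on the circle of radius 2 -/

/-- Functions on the circle of radius 2 are functions of the angle `θ ∈ ℝ / 2πℤ`. -/
abbrev Angle : Type := AddCircle (2 * π)

instance factTwoPiPos : Fact (0 < 2 * π) := ⟨Real.two_pi_pos⟩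

/-- The outer unit normal at the angle `θ`. -/
def normal (θ : Angle) : Plane := !₂[Real.Angle.cos θ, Real.Angle.sin θ]

/-- The point of the circle of radius 2 at the angle `θ`. -/
def bdryPoint (θ : Angle) : Plane := (2 : ℝ) • normal θ

/-- Square integrable functions on the circle. -/
abbrev L2Circle : Type := Lp ℂ 2 (AddCircle.haarAddCircle : Measure Angle)

/-- The sequence `(1 + k²)^{1/4} f_k`, where `f_k` are the Fourier coefficients of `f`. -/
def weightedCoeff (f : L2Circle) (k : ℤ) : ℂ :=
  (((1 + (k : ℝ) ^ 2) ^ (1 / 4 : ℝ) : ℝ) : ℂ) * fourierCoeff f k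

theorem weightedCoeff_add (f g : L2Circle) :
    weightedCoeff (f + g) = weightedCoeff f + weightedCoeff g := by
  funext k
  simp only [weightedCoeff, Pi.add_apply, ← fourierBasis_repr, map_add, lp.coeFn_add, mul_add]

theorem weightedCoeff_smul (c : ℂ) (f : L2Circle) :
    weightedCoeff (c • f) = c • weightedCoeff f := by
  funext k
  simp only [weightedCoeff, Pi.smul_apply, ← fourierBasis_repr, map_smul, lp.coeFn_smul,
    smul_eq_mul]
  ring

/-- The functions `f` in `L²` with `∑_k (1 + k²)^{1/2} |f_k|² < ∞`. -/
def sobolevHalf : Submodule ℂ L2Circle where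
  carrier := {f | Memℓp (weightedCoeff f) 2}
  zero_mem' := by
    have h : weightedCoeff 0 = 0 := by
      simpa using weightedCoeff_smul 0 0
    simp only [mem_ofPred_eq, h]
    exact zero_memℓp
  add_mem' := by
    intro f g hf hg
    simp only [mem_ofPred_eq, weightedCoeff_add] at *
    exact hf.add hg
  smul_mem' := by
    intro c f hf
    simp only [mem_ofPred_eq, weightedCoeff_smul] at *
    exact hf.const_smul c

/-- The Sobolev space `H^{1/2}` of the circle of radius 2. It is a type of its own because it does
not carry the norm of `L²`. -/
def HHalf : Type := sobolevHalf

instance : AddCommGroup HHalf := inferInstanceAs (AddCommGroup sobolevHalf)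

instance : Module ℂ HHalf := inferInstanceAs (Module ℂ sobolevHalf)

/-- An element of `H^{1/2}` as a function of the angle. -/
def HHalf.toFun (f : HHalf) : Angle → ℂ := ((Subtype.val f : L2Circle) : Angle → ℂ)

/-- The embedding `f ↦ ((1 + k²)^{1/4} f_k)_k` of `H^{1/2}` into `ℓ²`. -/
def HHalf.toSeq : HHalf →ₗ[ℂ] lp (fun _ : ℤ => ℂ) 2 where
  toFun f := ⟨weightedCoeff (Subtype.val f), f.property⟩
  map_add' f g := Subtype.ext (weightedCoeff_add (Subtype.val f) (Subtype.val g))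
  map_smul' c f := Subtype.ext (weightedCoeff_smul c (Subtype.val f))

theorem HHalf.toSeq_injective : Function.Injective HHalf.toSeq := by
  intro f g h
  apply Subtype.ext
  apply fourierBasis.repr.injective
  ext k
  have hk : weightedCoeff (Subtype.val f) k = weightedCoeff (Subtype.val g) k :=
    congrFun (congrArg Subtype.val h) k
  have hw : (((1 + (k : ℝ) ^ 2) ^ (1 / 4 : ℝ) : ℝ) : ℂ) ≠ 0 := by
    exact_mod_cast (by positivity : ((1 + (k : ℝ) ^ 2) ^ (1 / 4 : ℝ) : ℝ) ≠ 0)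
  simpa only [fourierBasis_repr] using mul_left_cancel₀ hw hk

instance : NormedAddCommGroup HHalf :=
  NormedAddCommGroup.induced HHalf (lp (fun _ : ℤ => ℂ) 2) HHalf.toSeq HHalf.toSeq_injective

instance : NormedSpace ℂ HHalf := NormedSpace.induced ℂ HHalf (lp (fun _ : ℤ => ℂ) 2) HHalf.toSeq

/-- The norm of `H^{1/2}`: `‖f‖² = ∑_k (1 + k²)^{1/2} |f_k|²`. -/
theorem HHalf.norm_sq (f : HHalf) :
    ‖f‖ ^ 2 = ∑' k : ℤ, (1 + (k : ℝ) ^ 2) ^ (1 / 2 : ℝ) * ‖fourierCoeff f.toFun k‖ ^ 2 := by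
  have h := lp.norm_rpow_eq_tsum (p := 2) (by norm_num) (HHalf.toSeq f)
  have h2 : ‖f‖ = ‖HHalf.toSeq f‖ := rfl
  simp only [ENNReal.toReal_ofNat, Real.rpow_ofNat] at h
  rw [h2, h]
  refine tsum_congr fun k => ?_
  change ‖weightedCoeff (Subtype.val f) k‖ ^ 2 = _
  rw [weightedCoeff, norm_mul, mul_pow, Complex.norm_real, Real.norm_of_nonneg (by positivity),
    ← Real.rpow_natCast, ← Real.rpow_mul (by positivity)]
  norm_num [HHalf.toFun]

/-- The space `H^{-1/2}` of the circle of radius 2, with the dual norm. -/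
abbrev HMinusHalf : Type := StrongDual ℂ HHalf

/-! ### The Dirichlet-to-Neumann map -/

/-- `f` is the trace on the circle of radius 2 of the function `u` with weak gradient `G` in
`B_2 \ K`: the Gauss–Green formula holds with all test functions that vanish near the closed
set `K`, where `ds = 2 dθ`. -/
def HasTrace (K : Set Plane) (u : Plane → ℂ) (G : Plane → Fin 2 → ℂ) (f : Angle → ℂ) : Prop :=
  ∀ φ : Plane → ℝ, IsTest φ → tsupport φ ⊆ Kᶜ → ∀ i : Fin 2,
    ∫ x in Metric.ball 0 2 \ K, (pd i φ x • u x + φ x • G x i) =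
      ∫ θ : Angle, (2 * (φ (bdryPoint θ) * normal θ i)) • f θ

/-- `u ∈ H¹(B_2 \ K)`, with gradient `G`, is the weak solution of `∇ · A∇u = 0` in `B_2 \ K`,
with zero flux through the boundary of `K` (the test functions do not have to vanish on `K`)
and `u = f` on the circle of radius 2. -/
structure IsDirichletSolution (A : Plane → Matrix (Fin 2) (Fin 2) ℝ) (K : Set Plane) (f : HHalf)
    (u : Plane → ℂ) (G : Plane → Fin 2 → ℂ) : Prop where
  memLp_fun : MemLp u 2 (volume.restrict (Metric.ball 0 2 \ K))
  memLp_grad : MemLp G 2 (volume.restrict (Metric.ball 0 2 \ K))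
  grad : HasWeakGradOn (Metric.ball 0 2 \ K) u G
  trace : HasTrace K u G f.toFun
  equation : ∀ φ, IsTest φ → tsupport φ ⊆ Metric.ball 0 2 →
    fluxForm A (Metric.ball 0 2 \ K) G φ = 0

/-- `Λ` is the Dirichlet-to-Neumann map of `B_2` with conductivity `A` and insulated core `K`:
`Λ f` is the conormal derivative `A∇u · ν` on the circle of radius 2 of the solution `u` with
boundary value `f`. As an element of `H^{-1/2}` it is given by
`⟨A∇u · ν, φ|_{∂B_2}⟩ = ∫_{B_2 \ K} A∇u · ∇φ`, for all test functions `φ` (their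
restrictions span a dense subspace of `H^{1/2}`). The solution `u` is unique if `A` is bounded and
uniformly elliptic in `B_2 \ K`, as are all the conductivities considered here; so there is at
most one such `Λ`. -/
def IsDtN (A : Plane → Matrix (Fin 2) (Fin 2) ℝ) (K : Set Plane)
    (Λ : HHalf →L[ℂ] HMinusHalf) : Prop :=
  ∀ f : HHalf, ∃ u G, IsDirichletSolution A K f u G ∧
    ∀ φ, IsTest φ → ∀ g : HHalf,
      g.toFun =ᵐ[AddCircle.haarAddCircle] (fun θ => (φ (bdryPoint θ) : ℂ)) →
      Λ f g = fluxForm A (Metric.ball 0 2 \ K) G φ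

end

end NearCloaking

namespace NearCloaking

noncomputable section

open Filter Topology

/-! All data are rotation invariant, so both Dirichlet-to-Neumann maps are Fourier multipliers on
the circle. A symbol bounded by `M * √(1 + k²)` defines an operator of norm at most `2πM` from
`H^{1/2}` to `H^{-1/2}`, so it suffices to bound the difference of the symbols by a constant times
`ρ ^ (2N + 2) * |k|`.

In the variable `τ = log |x|` the mode of frequency `n = |k|` of the coated disk solves `V' = P /
C`, `P' = n² C V` with `P 0 = 0` (`IsLogMode`). Pushing forward by a radial map only reparametrises
`τ` (`IsLogMode.isRadialMode`, `pushForward_blowUp`). Hence the cloak has the symbol `P / V` at `τ =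
log (2/ρ)`, as for the coated disk inside the disk of radius `2/ρ`, while the homogeneous disk has
the symbol `n`. Beyond `τ = log 2` the conductivity is `1`; if `v`, `p` are the values of `V`, `P`
at `log 2`, then at `log (2/ρ)` one has `P - nV = (p - nv) ρ^n` and `V ≥ v ρ^{-n} / 2`. This gives
`|P/V - n| ≤ 2 (|nv - p| / v) ρ^{2n}` (`abs_layer_ratio_sub_le`).

Two facts control `|nv - p| / v`. With `S` a bound for the conductivities, `0 ≤ p ≤ nSv` propagates
through the layers (`layer_bounds`), so the quotient is at most `n(1 + S)`, and it is `0` for `n =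
0`. For `1 ≤ n ≤ N` the same mode, suitably scaled, is the transmission solution for `H = rⁿ cos
nθ`, and its `r^{-n}` coefficient is a positive multiple of `v - p/n`; vanishing of the tensors
forces `p = nv` (`IsCoatedDisk.flux_eq_of_isGPTVanishing`). Only `n ≥ N + 1` is left, where `ρ^{2n}
≤ ρ^{2N+2}`.

The remaining work identifies the multipliers with the weakly defined Dirichlet-to-Neumann maps.
Each weak identity is checked on a single mode by integration by parts in polar coordinates, then
summed over `k` in `L²`, where the modes are orthogonal and their energies are controlled by their
boundary fluxes (`isDtN_of_isRadialMode`, `isDtN_of_flux_le`). -/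

/-! ### Polar coordinates -/

/-- The point with polar coordinates `(r, θ)`. -/
def polarPt (r θ : ℝ) : Plane := !₂[r * Real.cos θ, r * Real.sin θ]

/-- The open annulus `a < |x| < b`. -/
def annulus (a b : ℝ) : Set Plane := {x | a < ‖x‖ ∧ ‖x‖ < b}

/-- The components of the radial unit vector at the angle `θ`. -/
def radDir (i : Fin 2) (θ : ℝ) : ℝ := ![Real.cos θ, Real.sin θ] i

/-- The components of the tangential unit vector at the angle `θ`. -/
def tanDir (i : Fin 2) (θ : ℝ) : ℝ := ![-Real.sin θ, Real.cos θ] i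

/-- The components of the radial unit vector field. -/
def radField (i : Fin 2) (x : Plane) : ℝ := x i / ‖x‖

/-- The components of the tangential unit vector field. -/
def tanField (i : Fin 2) (x : Plane) : ℝ := ![-x 1, x 0] i / ‖x‖

/-- The function `e^{ikθ}` on the plane. -/
def expAngle (k : ℤ) (x : Plane) : ℂ := Complex.exp (k * angle x * Complex.I)

/-- The rectangle of polar coordinates of the annulus `a < |x| < b`. -/
def polarRect (a b : ℝ) : Set (ℝ × ℝ) := Ioo a b ×ˢ Ioo (-π) π

theorem norm_polarPt {r : ℝ} (hr : 0 ≤ r) (θ : ℝ) : ‖polarPt r θ‖ = r := by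
  have : ‖polarPt r θ 0‖ ^ 2 + ‖polarPt r θ 1‖ ^ 2 = r ^ 2 := by
    simp only [Real.norm_eq_abs, sq_abs]
    change (r * Real.cos θ) ^ 2 + (r * Real.sin θ) ^ 2 = r ^ 2
    linear_combination r ^ 2 * Real.sin_sq_add_cos_sq θ
  rw [EuclideanSpace.norm_eq, Fin.sum_univ_two, this, Real.sqrt_sq hr]

theorem angle_polarPt {r : ℝ} (hr : 0 < r) {θ : ℝ} (hθ : θ ∈ Ioc (-π) π) :
    angle (polarPt r θ) = θ := by
  refine Eq.trans ?_ (Complex.arg_mul_cos_add_sin_mul_I hr hθ)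
  rw [angle]
  congr 1
  apply Complex.ext <;> simp [polarPt, Complex.cos_ofReal_re, Complex.sin_ofReal_re]

theorem radField_polarPt {r : ℝ} (hr : 0 < r) (i : Fin 2) (θ : ℝ) :
    radField i (polarPt r θ) = radDir i θ := by
  rw [radField, norm_polarPt hr.le]
  fin_cases i <;> simp [polarPt, radDir, hr.ne']

theorem tanField_polarPt {r : ℝ} (hr : 0 < r) (i : Fin 2) (θ : ℝ) :
    tanField i (polarPt r θ) = tanDir i θ := by
  rw [tanField, norm_polarPt hr.le]
  fin_cases i
  · simp [polarPt, tanDir, neg_div, hr.ne']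
  · simp [polarPt, tanDir, hr.ne']

theorem expAngle_polarPt {r : ℝ} (hr : 0 < r) (k : ℤ) {θ : ℝ} (hθ : θ ∈ Ioo (-π) π) :
    expAngle k (polarPt r θ) = Complex.exp (k * θ * Complex.I) := by
  rw [expAngle, angle_polarPt hr ⟨hθ.1, hθ.2.le⟩]

theorem continuous_polarPt : Continuous fun z : ℝ × ℝ => polarPt z.1 z.2 := by
  unfold polarPt
  fun_prop

theorem measurableSet_annulus (a b : ℝ) : MeasurableSet (annulus a b) :=
  (measurableSet_lt measurable_const measurable_norm).inter
    (measurableSet_lt measurable_norm measurable_const)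

theorem measurableSet_polarRect (a b : ℝ) : MeasurableSet (polarRect a b) :=
  measurableSet_Ioo.prod measurableSet_Ioo

/-- Cartesian coordinates as a measurable equivalence. -/
def planeEquiv : ℝ × ℝ ≃ᵐ Plane :=
  MeasurableEquiv.finTwoArrow.symm.trans (MeasurableEquiv.toLp 2 (Fin 2 → ℝ))

theorem measurePreserving_planeEquiv : MeasurePreserving planeEquiv :=
  ((volume_preserving_finTwoArrow ℝ).symm).trans
    ((EuclideanSpace.volume_preserving_symm_measurableEquiv_toLp (Fin 2)).symm)

theorem planeEquiv_polarCoord_symm (z : ℝ × ℝ) :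
    planeEquiv (polarCoord.symm z) = polarPt z.1 z.2 := by
  ext i
  fin_cases i <;> rfl

theorem integral_annulus_eq {E : Type*} [NormedAddCommGroup E] [NormedSpace ℝ E] {a b : ℝ}
    (ha : 0 ≤ a) (f : Plane → E) :
    ∫ x in annulus a b, f x = ∫ z in polarRect a b, z.1 • f (polarPt z.1 z.2) := by
  rw [← integral_indicator (measurableSet_annulus a b),
    ← measurePreserving_planeEquiv.integral_comp planeEquiv.measurableEmbedding,
    ← integral_comp_polarCoord_symm, ← integral_indicator (measurableSet_polarRect a b),
    ← integral_indicator polarCoord.open_target.measurableSet]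
  congr 1 with z
  simp only [planeEquiv_polarCoord_symm, indicator, smul_ite, smul_zero]
  by_cases hz : z ∈ polarCoord.target
  · have hz' : 0 < z.1 ∧ z.2 ∈ Ioo (-π) π := hz
    have hiff : planeEquiv (polarCoord.symm z) ∈ annulus a b ↔ z ∈ polarRect a b := by
      rw [planeEquiv_polarCoord_symm]
      simp only [annulus, polarRect, mem_ofPred_eq, norm_polarPt hz'.1.le, mem_prod, hz'.2,
        and_true, mem_Ioo]
    by_cases h : z ∈ polarRect a b
    · simp only [hz, h, hiff.2 h, if_true]
    · simp only [hz, h, mt hiff.1 h, if_true, if_false]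
  · have hz' : z ∉ polarRect a b := fun h => hz ⟨ha.trans_lt h.1.1, h.2⟩
    simp only [hz, hz', if_false]

/-! ### Test functions and their derivatives in polar coordinates. -/

theorem IsTest.differentiable {φ : Plane → ℝ} (hφ : IsTest φ) : Differentiable ℝ φ :=
  hφ.smooth.differentiable (by simp)

theorem IsTest.continuous_pd {φ : Plane → ℝ} (hφ : IsTest φ) (i : Fin 2) :
    Continuous (pd i φ) :=
  (hφ.smooth.continuous_fderiv (by simp)).clm_apply continuous_const

theorem fderiv_eq_sum_pd (φ : Plane → ℝ) (x v : Plane) :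
    fderiv ℝ φ x v = ∑ i, v i * pd i φ x := by
  conv_lhs => rw [← (EuclideanSpace.basisFun (Fin 2) ℝ).sum_repr v]
  simp [pd]

/-- The radial derivative in polar coordinates. -/
def radDeriv (φ : Plane → ℝ) (r θ : ℝ) : ℝ := ∑ i, radDir i θ * pd i φ (polarPt r θ)

/-- The tangential derivative `r⁻¹ ∂_θ` in polar coordinates. -/
def tanDeriv (φ : Plane → ℝ) (r θ : ℝ) : ℝ := ∑ i, tanDir i θ * pd i φ (polarPt r θ)

theorem continuous_radDir (i : Fin 2) : Continuous (radDir i) := by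
  fin_cases i
  · exact Real.continuous_cos
  · exact Real.continuous_sin

theorem continuous_tanDir (i : Fin 2) : Continuous (tanDir i) := by
  fin_cases i
  · exact Real.continuous_sin.neg
  · exact Real.continuous_cos

theorem IsTest.continuous_radDeriv {φ : Plane → ℝ} (hφ : IsTest φ) :
    Continuous fun z : ℝ × ℝ => radDeriv φ z.1 z.2 :=
  continuous_finsetSum _ fun i _ => ((continuous_radDir i).comp continuous_snd).mul
    ((hφ.continuous_pd i).comp continuous_polarPt)

theorem IsTest.continuous_tanDeriv {φ : Plane → ℝ} (hφ : IsTest φ) :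
    Continuous fun z : ℝ × ℝ => tanDeriv φ z.1 z.2 :=
  continuous_finsetSum _ fun i _ => ((continuous_tanDir i).comp continuous_snd).mul
    ((hφ.continuous_pd i).comp continuous_polarPt)

theorem pd_polarPt (φ : Plane → ℝ) (i : Fin 2) (r θ : ℝ) :
    pd i φ (polarPt r θ) = radDir i θ * radDeriv φ r θ + tanDir i θ * tanDeriv φ r θ := by
  have h := Real.sin_sq_add_cos_sq θ
  fin_cases i
  · simp [radDeriv, tanDeriv, radDir, tanDir]
    linear_combination (-pd 0 φ (polarPt r θ)) * h
  · simp [radDeriv, tanDeriv, radDir, tanDir]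
    linear_combination (-pd 1 φ (polarPt r θ)) * h

theorem IsTest.hasDerivAt_radial {φ : Plane → ℝ} (hφ : IsTest φ) (r θ : ℝ) :
    HasDerivAt (fun s => φ (polarPt s θ)) (radDeriv φ r θ) r := by
  have h1 : HasDerivAt (fun s => polarPt s θ) (polarPt 1 θ) r := by
    have : (fun s => polarPt s θ) = fun s => s • polarPt 1 θ := by
      ext s i; fin_cases i <;> simp [polarPt]
    rw [this]
    simpa using (hasDerivAt_id r).smul_const (polarPt 1 θ)
  have h2 := (hφ.differentiable (polarPt r θ)).hasFDerivAt.comp_hasDerivAt r h1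
  rw [fderiv_eq_sum_pd] at h2
  refine h2.congr_deriv ?_
  simp [radDeriv, radDir, polarPt]

theorem IsTest.hasDerivAt_angular {φ : Plane → ℝ} (hφ : IsTest φ) (r θ : ℝ) :
    HasDerivAt (fun t => φ (polarPt r t)) (r * tanDeriv φ r θ) θ := by
  have h1 : HasDerivAt (fun t => polarPt r t) (r • !₂[-Real.sin θ, Real.cos θ]) θ := by
    have : (fun t => polarPt r t) = fun t => Real.cos t • !₂[r, 0] + Real.sin t • !₂[0, r] := by
      ext s i; fin_cases i <;> simp [polarPt, mul_comm]
    rw [this]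
    refine (((Real.hasDerivAt_cos θ).smul_const !₂[r, 0]).add
      ((Real.hasDerivAt_sin θ).smul_const !₂[0, r])).congr_deriv ?_
    ext i; fin_cases i <;> simp [mul_comm]
  have h2 := (hφ.differentiable (polarPt r θ)).hasFDerivAt.comp_hasDerivAt θ h1
  rw [fderiv_eq_sum_pd] at h2
  refine h2.congr_deriv ?_
  simp [tanDeriv, tanDir]
  ring

/-! ### Integration by parts over rectangles of polar coordinates. -/

theorem integral_polarRect_eq {a b : ℝ} {F : ℝ × ℝ → ℂ}
    (hF : IntegrableOn F (polarRect a b)) :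
    ∫ z in polarRect a b, F z = ∫ r in Ioo a b, ∫ θ in Ioo (-π) π, F (r, θ) :=
  setIntegral_prod F hF

theorem integral_polarRect_eq_symm {a b : ℝ} {F : ℝ × ℝ → ℂ}
    (hF : IntegrableOn F (polarRect a b)) :
    ∫ z in polarRect a b, F z = ∫ θ in Ioo (-π) π, ∫ r in Ioo a b, F (r, θ) := by
  rw [IntegrableOn, polarRect, Measure.volume_eq_prod, ← Measure.prod_restrict] at *
  exact integral_prod_symm F hF

instance isFiniteMeasure_polarRect (a b : ℝ) :
    IsFiniteMeasure (volume.restrict (polarRect a b)) := by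
  refine ⟨?_⟩
  rw [Measure.restrict_apply_univ, polarRect, Measure.volume_eq_prod, Measure.prod_prod]
  exact ENNReal.mul_lt_top (by simp) (by simp)

theorem memLp_top_polarRect_of_continuous {a b : ℝ} {F : ℝ × ℝ → ℂ} (hF : Continuous F) :
    MemLp F ∞ (volume.restrict (polarRect a b)) := by
  obtain ⟨C, hC⟩ := (isCompact_Icc (a := a) (b := b)).prod (isCompact_Icc (a := -π) (b := π))
    |>.exists_bound_of_continuousOn hF.continuousOn
  refine memLp_top_of_bound hF.aestronglyMeasurable C ?_
  refine (ae_restrict_iff' (measurableSet_polarRect a b)).2 (.of_forall fun z hz => hC z ?_)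
  exact ⟨Ioo_subset_Icc_self hz.1, Ioo_subset_Icc_self hz.2⟩

theorem memLp_top_polarRect_radial {a b C : ℝ} {g : ℝ → ℝ} (hg : Measurable g)
    (hC : ∀ s ∈ Ioo a b, |g s| ≤ C) :
    MemLp (fun z : ℝ × ℝ => (g z.1 : ℂ)) ∞ (volume.restrict (polarRect a b)) := by
  refine memLp_top_of_bound
    (Complex.measurable_ofReal.comp (hg.comp measurable_fst)).aestronglyMeasurable C ?_
  refine (ae_restrict_iff' (measurableSet_polarRect a b)).2 (.of_forall fun z hz => ?_)
  simpa using hC z.1 hz.1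

theorem IsTest.continuous_polar {φ : Plane → ℝ} (hφ : IsTest φ) :
    Continuous fun z : ℝ × ℝ => φ (polarPt z.1 z.2) :=
  hφ.differentiable.continuous.comp continuous_polarPt

/-- The profiles have corners at the layer interfaces and at the radius `3/2`; these form the set
`S`. The fundamental theorem of calculus survives countably many exceptional points because the
product stays continuous and its derivative is integrable. -/
theorem integral_deriv_mul_off_countable {a b C : ℝ} (hab : a ≤ b)
    {P dP Φ dΦ: ℝ → ℝ} (hP : Continuous P) (hdP : Measurable dP) (hC : ∀ s ∈ Ioo a b, |dP s| ≤ C)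
    {S : Set ℝ} (hS : S.Countable) (hd : ∀ s ∈ Ioo a b \ S, HasDerivAt P (dP s) s) 
    (h1 : Continuous Φ) (h2 : Continuous dΦ) (h3 : ∀ s, HasDerivAt Φ (dΦ s) s):
    ∫ s in Ioo a b, (dP s * Φ s + P s * dΦ s) =
      P b * Φ b - P a * Φ a := by
  have hdint : IntegrableOn dP (Ioo a b) :=
    Measure.integrableOn_of_bounded (M := C) (by simp) hdP.aestronglyMeasurable
      ((ae_restrict_iff' measurableSet_Ioo).2 (.of_forall hC))
  have hii : IntervalIntegrable (fun s => dP s * Φ s + P s * dΦ s)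
      volume a b := by
    refine IntervalIntegrable.add ?_ ((hP.mul h2).intervalIntegrable a b)
    refine IntervalIntegrable.mul_continuousOn ?_ h1.continuousOn
    rwa [intervalIntegrable_iff_integrableOn_Ioo_of_le hab]
  have key := integral_eq_of_hasDerivAt_off_countable_of_le
    (fun s => P s * Φ s) (fun s => dP s * Φ s + P s * dΦ s)
    hab hS (hP.mul h1).continuousOn
    (fun s hs => (hd s hs).mul (h3 s)) hii
  rwa [intervalIntegral.integral_of_le hab, integral_Ioc_eq_integral_Ioo] at key

/-- Integration by parts along a ray. -/
theorem integral_ray_parts {φ : Plane → ℝ} (hφ : IsTest φ) {a b C : ℝ} (hab : a ≤ b)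
    {P dP : ℝ → ℝ} (hP : Continuous P) (hdP : Measurable dP) (hC : ∀ s ∈ Ioo a b, |dP s| ≤ C)
    {S : Set ℝ} (hS : S.Countable) (hd : ∀ s ∈ Ioo a b \ S, HasDerivAt P (dP s) s) (θ : ℝ) :
    ∫ s in Ioo a b, (dP s * φ (polarPt s θ) + P s * radDeriv φ s θ) =
      P b * φ (polarPt b θ) - P a * φ (polarPt a θ) := by
  have h0 : Continuous fun s : ℝ => (s, θ) := by fun_prop
  have h1 := hφ.continuous_polar.comp h0
  have h2 := hφ.continuous_radDeriv.comp h0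
  exact integral_deriv_mul_off_countable hab hP hdP hC hS hd h1 h2
    fun s => hφ.hasDerivAt_radial s θ

theorem integrableOn_radial_parts {φ : Plane → ℝ} (hφ : IsTest φ) {a b C : ℝ}
    {P dP : ℝ → ℝ} (hP : Continuous P) (hdP : Measurable dP) (hC : ∀ s ∈ Ioo a b, |dP s| ≤ C)
    {E : ℝ → ℂ} (hE : Continuous E) :
    IntegrableOn (fun z : ℝ × ℝ => (dP z.1 * φ (polarPt z.1 z.2) +
      P z.1 * radDeriv φ z.1 z.2 : ℂ) * E z.2) (polarRect a b) := by
  have h2 : Continuous (fun z : ℝ × ℝ => (φ (polarPt z.1 z.2) : ℂ) * E z.2) :=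
    (Complex.continuous_ofReal.comp hφ.continuous_polar).mul (hE.comp continuous_snd)
  have h3 : Continuous (fun z : ℝ × ℝ => (P z.1 * radDeriv φ z.1 z.2 : ℂ) * E z.2) :=
    ((Complex.continuous_ofReal.comp (hP.comp continuous_fst)).mul
      (Complex.continuous_ofReal.comp hφ.continuous_radDeriv)).mul (hE.comp continuous_snd)
  have h4 := (memLp_top_polarRect_of_continuous (a := a) (b := b) h2).mul' (r := ∞)
    (memLp_top_polarRect_radial hdP hC)
  have h5 := (memLp_top_polarRect_of_continuous (a := a) (b := b) h3).integrable le_top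
  refine ((h4.integrable le_top).add h5).congr (.of_forall fun z => ?_)
  simp only [Pi.add_apply]
  ring

/-- Integration by parts in the radial variable. -/
theorem integral_radial_parts {φ : Plane → ℝ} (hφ : IsTest φ) {a b C : ℝ} (hab : a ≤ b)
    {P dP : ℝ → ℝ} (hP : Continuous P) (hdP : Measurable dP) (hC : ∀ s ∈ Ioo a b, |dP s| ≤ C)
    {S : Set ℝ} (hS : S.Countable) (hd : ∀ s ∈ Ioo a b \ S, HasDerivAt P (dP s) s)
    {E : ℝ → ℂ} (hE : Continuous E) :
    ∫ z in polarRect a b, (dP z.1 * φ (polarPt z.1 z.2) + P z.1 * radDeriv φ z.1 z.2 : ℂ) * E z.2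
      = ∫ θ in Ioo (-π) π, (P b * φ (polarPt b θ) - P a * φ (polarPt a θ) : ℂ) * E θ := by
  rw [integral_polarRect_eq_symm (integrableOn_radial_parts hφ hP hdP hC hE)]
  refine setIntegral_congr_fun measurableSet_Ioo fun θ _ => ?_
  refine (integral_mul_const (E θ) _).trans ?_
  congr 1
  have h := congrArg (fun t : ℝ => (t : ℂ)) (integral_ray_parts hφ hab hP hdP hC hS hd θ)
  rw [← integral_complex_ofReal] at h
  push_cast at h
  exact h

/-- Integration by parts in the angular variable. -/
theorem integral_angular_parts {φ : Plane → ℝ} (hφ : IsTest φ) {a b C : ℝ}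
    {Q : ℝ → ℝ} (hQ : Measurable Q) (hC : ∀ s ∈ Ioo a b, |Q s| ≤ C)
    {E dE : ℝ → ℂ} (hdE : Continuous dE) (hd : ∀ θ, HasDerivAt E (dE θ) θ)
    (hper : E π = E (-π)) :
    IntegrableOn (fun z : ℝ × ℝ => (Q z.1 : ℂ) * (dE z.2 * φ (polarPt z.1 z.2) +
      E z.2 * (z.1 * tanDeriv φ z.1 z.2))) (polarRect a b) ∧
    ∫ z in polarRect a b, (Q z.1 : ℂ) * (dE z.2 * φ (polarPt z.1 z.2) +
      E z.2 * (z.1 * tanDeriv φ z.1 z.2)) = 0 := by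
  have hE : Continuous E := continuous_iff_continuousAt.2 fun θ => (hd θ).continuousAt
  have hφc : Continuous fun z : ℝ × ℝ => φ (polarPt z.1 z.2) :=
    hφ.differentiable.continuous.comp continuous_polarPt
  have hcont : Continuous fun z : ℝ × ℝ => dE z.2 * φ (polarPt z.1 z.2) +
      E z.2 * (z.1 * tanDeriv φ z.1 z.2) :=
    ((hdE.comp continuous_snd).mul (Complex.continuous_ofReal.comp hφc)).add
      ((hE.comp continuous_snd).mul ((Complex.continuous_ofReal.comp continuous_fst).mul
        (Complex.continuous_ofReal.comp hφ.continuous_tanDeriv)))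
  have hint : IntegrableOn (fun z : ℝ × ℝ => (Q z.1 : ℂ) * (dE z.2 * φ (polarPt z.1 z.2) +
      E z.2 * (z.1 * tanDeriv φ z.1 z.2))) (polarRect a b) :=
    ((memLp_top_polarRect_of_continuous hcont).mul' (r := ∞)
      (memLp_top_polarRect_radial hQ hC)).integrable le_top
  refine ⟨hint, ?_⟩
  rw [integral_polarRect_eq hint]
  refine (setIntegral_congr_fun (g := fun _ => (0 : ℂ)) measurableSet_Ioo fun r _ => ?_).trans
    (by simp)
  simp only
  rw [integral_const_mul]
  have hππ : (-π : ℝ) ≤ π := by linarith [Real.pi_pos]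
  have key := intervalIntegral.integral_eq_sub_of_hasDerivAt (a := -π) (b := π)
    (f := fun θ => E θ * (φ (polarPt r θ) : ℂ))
    (f' := fun θ => dE θ * φ (polarPt r θ) + E θ * (r * tanDeriv φ r θ)) (fun θ _ => ?_)
    ((hcont.comp (by fun_prop : Continuous fun t : ℝ => (r, t))).intervalIntegrable _ _)
  · rw [intervalIntegral.integral_of_le hππ, integral_Ioc_eq_integral_Ioo] at key
    rw [key]
    -- Both factors take the same value at `π` and `-π`, so there is no boundary term.
    simp [polarPt, hper]
  · have := (hφ.hasDerivAt_angular r θ).ofReal_comp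
    push_cast at this
    exact (hd θ).mul this

/-! ### Separated solutions -/

/-- Measurable radial coefficients, bounded and bounded away from zero in `a < s < b`. -/
structure IsCoefficient (a b : ℝ) (c α : ℝ → ℝ) : Prop where
  measurable_left : Measurable c
  measurable_right : Measurable α
  bounds : ∃ m M : ℝ, 0 < m ∧ ∀ s ∈ Ioo a b, (m ≤ c s ∧ c s ≤ M) ∧ (m ≤ α s ∧ α s ≤ M)

/-- `w` is the radial part and `p` the radial flux of a separated solution of angular frequency
`κ`, for the conductivity with radial part `c / α` and tangential part `c α`. -/
structure IsRadialMode (a b κ : ℝ) (c α w p dw : ℝ → ℝ) : Prop where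
  continuous_fun : Continuous w
  continuous_flux : Continuous p
  measurable_deriv : Measurable dw
  bound : ∃ M : ℝ, ∀ s ∈ Ioo a b, |dw s| ≤ M ∧ |κ * w s / s| ≤ M
  hasDerivAt : ∃ S : Set ℝ, S.Countable ∧ ∀ s ∈ Ioo a b \ S,
    HasDerivAt w (dw s) s ∧ HasDerivAt p (κ ^ 2 * (c s * α s * w s / s)) s
  flux_eq : ∀ s ∈ Ioo a b, c s * (α s)⁻¹ * (s * dw s) = p s
  flux_inner : p a = 0

/-- The conductivity with radial part `c / α` and tangential part `c α`. -/
def polarTensor (c α : ℝ → ℝ) (x : Plane) : Matrix (Fin 2) (Fin 2) ℝ :=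
  Matrix.of fun i j => c ‖x‖ * ((α ‖x‖)⁻¹ * (radField i x * radField j x) +
    α ‖x‖ * (tanField i x * tanField j x))

/-- The function `g(r) e^{ikθ}`. -/
def modeFun (k : ℤ) (g : ℝ → ℝ) (x : Plane) : ℂ := g ‖x‖ * expAngle k x

/-- The vector field with given radial and tangential components. -/
def polarVector (R T : Plane → ℂ) (x : Plane) (i : Fin 2) : ℂ :=
  radField i x * R x + tanField i x * T x

/-- The tangential component of the gradient of `w(r) e^{ikθ}`. -/
def modeTan (k : ℤ) (w : ℝ → ℝ) (x : Plane) : ℂ :=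
  Complex.I * modeFun k (fun s => k * w s / s) x

theorem hasDerivAt_exp_int_mul (k : ℤ) (θ : ℝ) :
    HasDerivAt (fun t : ℝ => Complex.exp (k * t * Complex.I))
      (k * Complex.I * Complex.exp (k * θ * Complex.I)) θ := by
  have h : HasDerivAt (fun t : ℝ => (k * t * Complex.I : ℂ)) (k * Complex.I) θ := by
    simpa using ((Complex.ofRealCLM.hasDerivAt (x := θ)).const_mul (k : ℂ)).mul_const Complex.I
  simpa [mul_comm] using h.cexp

theorem exp_int_mul_pi (k : ℤ) :
    Complex.exp (k * (π : ℝ) * Complex.I) = Complex.exp (k * (-π : ℝ) * Complex.I) := by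
  rw [Complex.exp_eq_exp_iff_exists_int]
  exact ⟨k, by push_cast; ring⟩

theorem continuous_exp_int_mul (k : ℤ) :
    Continuous fun t : ℝ => Complex.exp (k * t * Complex.I) := by
  fun_prop

theorem hasDerivAt_tanDir (i : Fin 2) (θ : ℝ) : HasDerivAt (tanDir i) (-radDir i θ) θ := by
  fin_cases i
  · exact (Real.hasDerivAt_sin θ).neg
  · exact Real.hasDerivAt_cos θ

theorem tanDir_pi (i : Fin 2) : tanDir i π = tanDir i (-π) := by
  fin_cases i <;> simp [tanDir]

theorem exists_bound_of_continuous {g : ℝ → ℝ} (hg : Continuous g) (a b : ℝ) :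
    ∃ C, ∀ s ∈ Ioo a b, |g s| ≤ C := by
  obtain ⟨C, hC⟩ := (isCompact_Icc (a := a) (b := b)).exists_bound_of_continuousOn hg.continuousOn
  exact ⟨C, fun s hs => hC s (Ioo_subset_Icc_self hs)⟩

/-- Common core of the two identities for a single mode: their integrands in polar coordinates are
an exact radial derivative plus an exact angular one. The latter integrates to zero by periodicity,
and only the two boundary circles remain. -/
theorem integrableOn_and_integral_parts {φ : Plane → ℝ} (hφ : IsTest φ) {a b C D : ℝ} (hab : a ≤ b)
    {P dP Q : ℝ → ℝ} (hP : Continuous P) (hdP : Measurable dP) (hC : ∀ s ∈ Ioo a b, |dP s| ≤ C)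
    {S : Set ℝ} (hS : S.Countable) (hd : ∀ s ∈ Ioo a b \ S, HasDerivAt P (dP s) s)
    (hQ : Measurable Q) (hD : ∀ s ∈ Ioo a b, |Q s| ≤ D)
    {E F dF : ℝ → ℂ} (hE : Continuous E) (hdF : Continuous dF)
    (hF : ∀ θ, HasDerivAt F (dF θ) θ) (hper : F π = F (-π)) :
    ∫ z in polarRect a b,
      ((dP z.1 * φ (polarPt z.1 z.2) + P z.1 * radDeriv φ z.1 z.2 : ℂ) * E z.2 +
        (Q z.1 : ℂ) * (dF z.2 * φ (polarPt z.1 z.2) + F z.2 * (z.1 * tanDeriv φ z.1 z.2)))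
      = ∫ θ in Ioo (-π) π, (P b * φ (polarPt b θ) - P a * φ (polarPt a θ) : ℂ) * E θ := by
  obtain ⟨h1, h2⟩ := integral_angular_parts hφ hQ hD hdF hF hper
  rw [integral_add (integrableOn_radial_parts hφ hP hdP hC hE) h1, h2, add_zero]
  exact integral_radial_parts hφ hab hP hdP hC hS hd hE

theorem radField_sq_add (x : Plane) (hx : x ≠ 0) : radField 0 x ^ 2 + radField 1 x ^ 2 = 1 := by
  have h := EuclideanSpace.norm_sq_eq x
  simp only [Fin.sum_univ_two, Real.norm_eq_abs, sq_abs] at h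
  rw [radField, radField, div_pow, div_pow, ← add_div, ← h]
  exact div_self (pow_ne_zero 2 (norm_ne_zero_iff.2 hx))

theorem tanField_zero (x : Plane) : tanField 0 x = -radField 1 x := by
  simp [tanField, radField, neg_div]

theorem tanField_one (x : Plane) : tanField 1 x = radField 0 x := by
  simp [tanField, radField]

/-- The form of a polar tensor in terms of radial and tangential components. -/
theorem sum_polarTensor_mul (c α : ℝ → ℝ) (R T : Plane → ℂ) (q : Fin 2 → ℝ) {x : Plane}
    (hx : x ≠ 0) :
    ∑ i, ∑ j, (polarTensor c α x i j * q i : ℂ) * polarVector R T x j =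
      (c ‖x‖ * (α ‖x‖)⁻¹ * ∑ i, radField i x * q i : ℝ) * R x +
      (c ‖x‖ * α ‖x‖ * ∑ i, tanField i x * q i : ℝ) * T x := by
  have h : (radField 0 x : ℂ) ^ 2 + (radField 1 x : ℂ) ^ 2 = 1 := by
    exact_mod_cast radField_sq_add x hx
  simp only [polarTensor, polarVector, Matrix.of_apply, Fin.sum_univ_two, tanField_zero,
    tanField_one]
  push_cast
  linear_combination (c ‖x‖ * (α ‖x‖ : ℂ)⁻¹ * (radField 0 x * q 0 + radField 1 x * q 1) * R x +
    c ‖x‖ * α ‖x‖ * (-radField 1 x * q 0 + radField 0 x * q 1) * T x : ℂ) * h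

theorem sum_radDir_mul_pd (φ : Plane → ℝ) {r : ℝ} (hr : 0 < r) (θ : ℝ) :
    ∑ i, radField i (polarPt r θ) * pd i φ (polarPt r θ) = radDeriv φ r θ := by
  simp only [radField_polarPt hr, radDeriv]

theorem sum_tanDir_mul_pd (φ : Plane → ℝ) {r : ℝ} (hr : 0 < r) (θ : ℝ) :
    ∑ i, tanField i (polarPt r θ) * pd i φ (polarPt r θ) = tanDeriv φ r θ := by
  simp only [tanField_polarPt hr, tanDeriv]

theorem polarPt_ne_zero {r : ℝ} (hr : 0 < r) (θ : ℝ) : polarPt r θ ≠ 0 := by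
  rw [← norm_ne_zero_iff, norm_polarPt hr.le]
  exact hr.ne'

section Mode

variable {a b : ℝ} {k : ℤ} {c α w p dw : ℝ → ℝ}

/-- With the factor `s` of polar area, the integrand is the radial derivative of `s w φ` times
`radDir i` plus the angular derivative of `w φ` times `tanDir i`, each with the factor `e^{ikθ}`.
The term from differentiating `s` cancels against the one from `∂_θ tanDir = -radDir`. -/
theorem IsRadialMode.integral_green (h : IsRadialMode a b k c α w p dw) (ha : 0 ≤ a)
    (hab : a ≤ b) {φ : Plane → ℝ} (hφ : IsTest φ) (i : Fin 2) :
    ∫ x in annulus a b, (pd i φ x * modeFun k w x +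
        φ x * polarVector (modeFun k dw) (modeTan k w) x i) =
      ∫ θ in Ioo (-π) π, ((b * w b : ℝ) * φ (polarPt b θ) - (a * w a : ℝ) * φ (polarPt a θ) : ℂ) *
        (radDir i θ * Complex.exp (k * θ * Complex.I)) := by
  obtain ⟨S, hS, hd⟩ := h.hasDerivAt
  obtain ⟨M, hM⟩ := h.bound
  obtain ⟨W, hW⟩ := exists_bound_of_continuous h.continuous_fun a b
  have hdP : ∀ s ∈ Ioo a b, |w s + s * dw s| ≤ W + b * M := by
    intro s hs
    have hs0 : 0 ≤ s := ha.trans hs.1.le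
    refine (abs_add_le _ _).trans (add_le_add (hW s hs) ?_)
    rw [abs_mul, abs_of_nonneg hs0]
    exact mul_le_mul hs.2.le (hM s hs).1 (abs_nonneg _) (hs0.trans hs.2.le)
  have hF : ∀ θ, HasDerivAt (fun t : ℝ => (tanDir i t : ℂ) * Complex.exp (k * t * Complex.I))
      (-radDir i θ * Complex.exp (k * θ * Complex.I) +
        tanDir i θ * (k * Complex.I * Complex.exp (k * θ * Complex.I))) θ := by
    intro θ
    have h1 := (hasDerivAt_tanDir i θ).ofReal_comp
    rw [Complex.ofReal_neg] at h1
    exact h1.mul (hasDerivAt_exp_int_mul k θ)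
  have hrc : Continuous fun t => (radDir i t : ℂ) :=
    Complex.continuous_ofReal.comp (continuous_radDir i)
  have htc : Continuous fun t => (tanDir i t : ℂ) :=
    Complex.continuous_ofReal.comp (continuous_tanDir i)
  have hec := continuous_exp_int_mul k
  rw [integral_annulus_eq ha]
  refine Eq.trans ?_ (integrableOn_and_integral_parts hφ hab (P := fun s => s * w s)
    (dP := fun s => w s + s * dw s)
    (E := fun θ => radDir i θ * Complex.exp (k * θ * Complex.I))
    (F := fun θ => tanDir i θ * Complex.exp (k * θ * Complex.I))
    (dF := fun θ => -radDir i θ * Complex.exp (k * θ * Complex.I) +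
        tanDir i θ * (k * Complex.I * Complex.exp (k * θ * Complex.I))) (continuous_id.mul h.continuous_fun)
    (h.continuous_fun.measurable.add (measurable_id.mul h.measurable_deriv)) hdP hS
    (fun s hs => ((hasDerivAt_id s).mul (hd s hs).1).congr_deriv (by simp))
    h.continuous_fun.measurable hW (hrc.mul hec)
    ((hrc.neg.mul hec).add (htc.mul (continuous_const.mul hec))) hF
    (by simp only [tanDir_pi, exp_int_mul_pi]))
  refine setIntegral_congr_fun (measurableSet_polarRect a b) fun z hz => ?_
  have hz0 : 0 < z.1 := ha.trans_lt hz.1.1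
  have hz0' : (z.1 : ℂ) ≠ 0 := Complex.ofReal_ne_zero.2 hz0.ne'
  simp only [polarVector, modeFun, modeTan, norm_polarPt hz0.le, expAngle_polarPt hz0 k hz.2,
    radField_polarPt hz0, tanField_polarPt hz0, pd_polarPt, Complex.real_smul]
  push_cast
  field_simp
  ring

/-- The terms without derivatives of `φ` cancel: `p' = k² c α w / s` from the radial part against
`(ik)² c α w / s` from the angular part. The inner circle drops out because `p a = 0`, which is the
Neumann condition. -/
theorem IsRadialMode.integral_flux (h : IsRadialMode a b k c α w p dw) (hc : IsCoefficient a b c α)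
    (ha : 0 ≤ a) (hab : a ≤ b) {φ : Plane → ℝ} (hφ : IsTest φ) :
    ∫ x in annulus a b, ∑ i, ∑ j, (polarTensor c α x i j * pd i φ x : ℂ) *
        polarVector (modeFun k dw) (modeTan k w) x j =
      ∫ θ in Ioo (-π) π, (p b * φ (polarPt b θ) : ℂ) * Complex.exp (k * θ * Complex.I) := by
  obtain ⟨S, hS, hd⟩ := h.hasDerivAt
  obtain ⟨M, hM⟩ := h.bound
  obtain ⟨m, K, hm, hK⟩ := hc.bounds
  have hcα : ∀ s ∈ Ioo a b, |c s * α s| ≤ K * K := by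
    intro s hs
    obtain ⟨⟨h1, h2⟩, h3, h4⟩ := hK s hs
    rw [abs_of_nonneg (mul_nonneg (hm.le.trans h1) (hm.le.trans h3))]
    exact mul_le_mul h2 h4 (hm.le.trans h3) (hm.le.trans (h1.trans h2))
  have hQ : ∀ s ∈ Ioo a b, |c s * α s * (k * w s / s)| ≤ K * K * M := by
    intro s hs
    rw [abs_mul]
    exact mul_le_mul (hcα s hs) (hM s hs).2 (abs_nonneg _) ((abs_nonneg _).trans (hcα s hs))
  have hdP : ∀ s ∈ Ioo a b, |(k : ℝ) ^ 2 * (c s * α s * w s / s)| ≤ |(k : ℝ)| * (K * K * M) := by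
    intro s hs
    have : (k : ℝ) ^ 2 * (c s * α s * w s / s) = k * (c s * α s * (k * w s / s)) := by ring
    rw [this, abs_mul]
    exact mul_le_mul_of_nonneg_left (hQ s hs) (abs_nonneg _)
  have hF : ∀ θ : ℝ, HasDerivAt (fun t : ℝ => Complex.I * Complex.exp (k * t * Complex.I))
      (Complex.I * (k * Complex.I * Complex.exp (k * θ * Complex.I))) θ :=
    fun θ => (hasDerivAt_exp_int_mul k θ).const_mul _
  have hec := continuous_exp_int_mul k
  have hmw := h.continuous_fun.measurable
  rw [integral_annulus_eq ha]
  refine Eq.trans ?_ ((integrableOn_and_integral_parts hφ hab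
    (dP := fun s => (k : ℝ) ^ 2 * (c s * α s * w s / s))
    (Q := fun s => c s * α s * (k * w s / s))
    (E := fun θ => Complex.exp (k * θ * Complex.I))
    (F := fun θ => Complex.I * Complex.exp (k * θ * Complex.I))
    (dF := fun θ => Complex.I * (k * Complex.I * Complex.exp (k * θ * Complex.I)))
    h.continuous_flux
    (((hc.measurable_left.mul hc.measurable_right).mul hmw |>.div measurable_id).const_mul _)
    hdP hS (fun s hs => (hd s hs).2)
    ((hc.measurable_left.mul hc.measurable_right).mul ((hmw.const_mul _).div measurable_id))
    hQ hec (continuous_const.mul (continuous_const.mul hec)) hF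
    (by simp only [exp_int_mul_pi])).trans ?_)
  · refine setIntegral_congr_fun (measurableSet_polarRect a b) fun z hz => ?_
    have hz0 : 0 < z.1 := ha.trans_lt hz.1.1
    have hz0' : (z.1 : ℂ) ≠ 0 := Complex.ofReal_ne_zero.2 hz0.ne'
    have hα0 : (α z.1 : ℂ) ≠ 0 :=
      Complex.ofReal_ne_zero.2 (hm.trans_le (hK z.1 hz.1).2.1).ne'
    simp only [← h.flux_eq z.1 hz.1]
    rw [sum_polarTensor_mul c α _ _ (fun i => pd i φ (polarPt z.1 z.2)) (polarPt_ne_zero hz0 _),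
      sum_radDir_mul_pd φ hz0, sum_tanDir_mul_pd φ hz0]
    simp only [modeFun, modeTan, norm_polarPt hz0.le, expAngle_polarPt hz0 k hz.2,
      Complex.real_smul]
    push_cast
    field_simp
    linear_combination (-(k : ℂ) ^ 2 * c z.1 * φ (polarPt z.1 z.2) * α z.1 ^ 2 * w z.1) * Complex.I_sq
  · simp only [h.flux_inner, Complex.ofReal_zero, zero_mul, sub_zero]

end Mode

/-! ### Series of separated functions in `L²` -/

instance isFiniteMeasure_annulus (a b : ℝ) : IsFiniteMeasure (volume.restrict (annulus a b)) := by
  refine ⟨?_⟩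
  rw [Measure.restrict_apply_univ]
  refine (measure_mono fun x hx => ?_).trans_lt (measure_ball_lt_top (x := (0 : Plane)) (r := b))
  simpa using hx.2

theorem measurable_angle : Measurable angle := by
  have h : Measurable fun x : Plane => (⟨x 0, x 1⟩ : ℂ) := by
    have : (fun x : Plane => (⟨x 0, x 1⟩ : ℂ)) = fun x => (x 0 : ℂ) + (x 1 : ℂ) * Complex.I := by
      ext x; exact Complex.mk_eq_add_mul_I _ _
    rw [this]
    fun_prop
  exact Complex.measurable_arg.comp h

theorem measurable_expAngle (k : ℤ) : Measurable (expAngle k) := by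
  have h := measurable_angle
  unfold expAngle
  fun_prop

theorem norm_expAngle (k : ℤ) (x : Plane) : ‖expAngle k x‖ = 1 := by
  have := Complex.norm_exp_ofReal_mul_I (k * angle x)
  push_cast at this
  exact this

theorem star_expAngle_mul (k l : ℤ) (x : Plane) :
    expAngle l x * (starRingEnd ℂ) (expAngle k x) = expAngle (l - k) x := by
  rw [expAngle, expAngle, expAngle, ← Complex.exp_conj, ← Complex.exp_add]
  congr 1
  simp
  ring

theorem measurable_modeFun (k : ℤ) {g : ℝ → ℝ} (hg : Measurable g) :
    Measurable (modeFun k g) :=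
  (Complex.measurable_ofReal.comp (hg.comp measurable_norm)).mul (measurable_expAngle k)

theorem norm_modeFun (k : ℤ) (g : ℝ → ℝ) (x : Plane) : ‖modeFun k g x‖ = |g ‖x‖| := by
  rw [modeFun, norm_mul, norm_expAngle, mul_one, Complex.norm_real, Real.norm_eq_abs]

theorem memLp_modeFun (k : ℤ) {a b C : ℝ} {g : ℝ → ℝ} (hg : Measurable g)
    (hC : ∀ s ∈ Ioo a b, |g s| ≤ C) (q : ℝ≥0∞) :
    MemLp (modeFun k g) q (volume.restrict (annulus a b)) := by
  refine MemLp.of_bound (measurable_modeFun k hg).aestronglyMeasurable C ?_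
  refine (ae_restrict_iff' (measurableSet_annulus a b)).2 (.of_forall fun x hx => ?_)
  rw [norm_modeFun]
  exact hC _ hx

theorem integral_exp_int_mul (k : ℤ) :
    ∫ θ in Ioo (-π) π, Complex.exp (k * θ * Complex.I) = if k = 0 then (2 * π : ℂ) else 0 := by
  have hππ : (-π : ℝ) ≤ π := by linarith [Real.pi_pos]
  split_ifs with hk
  · simp only [hk, Int.cast_zero, zero_mul, Complex.exp_zero, integral_const,
      MeasurableSet.univ, measureReal_restrict_apply, univ_inter, Real.volume_real_Ioo_of_le hππ,
      Complex.real_smul]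
    push_cast
    ring
  · have hk' : (k : ℂ) * Complex.I ≠ 0 :=
      mul_ne_zero (Int.cast_ne_zero.2 hk) Complex.I_ne_zero
    have key := intervalIntegral.integral_eq_sub_of_hasDerivAt (a := -π) (b := π)
      (fun θ _ => hasDerivAt_exp_int_mul k θ)
      ((continuous_const.mul (continuous_exp_int_mul k)).intervalIntegrable _ _)
    rw [intervalIntegral.integral_const_mul, intervalIntegral.integral_of_le hππ,
      integral_Ioc_eq_integral_Ioo, exp_int_mul_pi, sub_self] at key
    exact (mul_eq_zero.1 key).resolve_left hk'

theorem integral_modeFun (k : ℤ) {a b : ℝ} (ha : 0 ≤ a) (g : ℝ → ℝ) :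
    ∫ x in annulus a b, modeFun k g x =
      (∫ s in Ioo a b, s * g s : ℝ) * if k = 0 then (2 * π : ℂ) else 0 := by
  rw [integral_annulus_eq ha, ← integral_exp_int_mul, ← integral_complex_ofReal,
    ← setIntegral_prod_mul]
  refine setIntegral_congr_fun (measurableSet_polarRect a b) fun z hz => ?_
  have hz0 : 0 < z.1 := ha.trans_lt hz.1.1
  simp only [modeFun, norm_polarPt hz0.le, expAngle_polarPt hz0 k hz.2, Complex.real_smul]
  push_cast
  ring

/-- The function `g(r) e^{ikθ}` as an element of `L²`. -/
def modeLp {a b C : ℝ} (k : ℤ) {g : ℝ → ℝ} (hg : Measurable g) (hC : ∀ s ∈ Ioo a b, |g s| ≤ C) :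
    Lp ℂ 2 (volume.restrict (annulus a b)) :=
  (memLp_modeFun k hg hC 2).toLp

theorem inner_modeLp {a b C D : ℝ} (ha : 0 ≤ a) (k l : ℤ) {g h : ℝ → ℝ} (hg : Measurable g)
    (hC : ∀ s ∈ Ioo a b, |g s| ≤ C) (hh : Measurable h) (hD : ∀ s ∈ Ioo a b, |h s| ≤ D) :
    inner ℂ (modeLp k hg hC) (modeLp l hh hD) =
      (∫ s in Ioo a b, s * (g s * h s) : ℝ) * if l - k = 0 then (2 * π : ℂ) else 0 := by
  rw [L2.inner_def, ← integral_modeFun _ ha]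
  refine integral_congr_ae ?_
  filter_upwards [(memLp_modeFun k hg hC 2).coeFn_toLp, (memLp_modeFun l hh hD 2).coeFn_toLp]
    with x h1 h2
  rw [modeLp, modeLp, h1, h2, RCLike.inner_apply, modeFun, modeFun, modeFun, ← star_expAngle_mul,
    map_mul, Complex.conj_ofReal]
  push_cast
  ring

theorem norm_modeLp_sq {a b C : ℝ} (ha : 0 ≤ a) (k : ℤ) {g : ℝ → ℝ} (hg : Measurable g)
    (hC : ∀ s ∈ Ioo a b, |g s| ≤ C) :
    ‖modeLp k hg hC‖ ^ 2 = 2 * π * ∫ s in Ioo a b, s * g s ^ 2 := by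
  have h := inner_modeLp ha k k hg hC hg hC
  rw [inner_self_eq_norm_sq_to_K, sub_self, if_pos rfl] at h
  have h' : ((‖modeLp k hg hC‖ ^ 2 : ℝ) : ℂ) = ((2 * π * ∫ s in Ioo a b, s * g s ^ 2 : ℝ) : ℂ) := by
    simp only [pow_two (g _)]
    push_cast at h ⊢
    rw [mul_comm]
    exact h
  exact_mod_cast h'

/-- Pythagoras, applied to the lines spanned by the vectors; working with lines allows some `v i` to
vanish. -/
theorem summable_of_pairwise_orthogonal {ι H : Type*} [NormedAddCommGroup H]
    [InnerProductSpace ℂ H] [CompleteSpace H] {v : ι → H}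
    (hv : Pairwise fun i j => inner ℂ (v i) (v j) = 0) (hs : Summable fun i => ‖v i‖ ^ 2) :
    Summable v := by
  have ho : OrthogonalFamily ℂ (fun i => (Submodule.span ℂ {v i} : Submodule ℂ H))
      fun i => (Submodule.span ℂ {v i}).subtypeₗᵢ := by
    refine OrthogonalFamily.of_pairwise fun i j hij => ?_
    rw [Function.onFun, Submodule.isOrtho_span]
    rintro x rfl y rfl
    exact hv hij
  exact (ho.summable_iff_norm_sq_summable
    fun i => ⟨v i, Submodule.mem_span_singleton_self (v i)⟩).2 hs

/-- Convergence of series of separated functions in `L²`, tested against bounded functions. -/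
theorem exists_mode_series {a b : ℝ} (ha : 0 ≤ a) (f : ℤ → ℂ) {g : ℤ → ℝ → ℝ}
    (hg : ∀ k, Measurable (g k)) (hC : ∀ k, ∃ C, ∀ s ∈ Ioo a b, |g k s| ≤ C)
    (hs : Summable fun k => ‖f k‖ ^ 2 * ∫ s in Ioo a b, s * g k s ^ 2) :
    ∃ u : Plane → ℂ, MemLp u 2 (volume.restrict (annulus a b)) ∧
      ∀ B : Plane → ℂ, MemLp B ∞ (volume.restrict (annulus a b)) →
        HasSum (fun k => f k * ∫ x in annulus a b, B x * modeFun k (g k) x)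
          (∫ x in annulus a b, B x * u x) := by
  choose C hC using hC
  have hsum : Summable fun k => f k • modeLp k (hg k) (hC k) := by
    refine summable_of_pairwise_orthogonal (fun k l hkl => ?_) ?_
    · simp only [inner_smul_left, inner_smul_right, inner_modeLp ha,
        if_neg (sub_ne_zero.2 hkl.symm), mul_zero]
    · refine (hs.mul_left (2 * π)).congr fun k => ?_
      rw [norm_smul, mul_pow, norm_modeLp_sq ha]
      ring
  obtain ⟨u, hu⟩ := hsum
  refine ⟨u, Lp.memLp u, fun B hB => ?_⟩
  -- Integration against `B` is the inner product with the conjugate of `B`, which is in `L²`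
  -- because the annulus has finite measure. It is therefore a continuous functional and passes
  -- through the sum.
  have hB2 : MemLp (fun x => (starRingEnd ℂ) (B x)) 2 (volume.restrict (annulus a b)) :=
    (hB.mono_exponent le_top).star
  have key : ∀ v : Lp ℂ 2 (volume.restrict (annulus a b)),
      innerSL ℂ hB2.toLp v = ∫ x in annulus a b, B x * v x := by
    intro v
    rw [innerSL_apply_apply, L2.inner_def]
    refine integral_congr_ae ?_
    filter_upwards [hB2.coeFn_toLp] with x hx
    rw [hx, RCLike.inner_apply, RingHomCompTriple.comp_apply, RingHom.id_apply, mul_comm]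
  have h := hu.mapL (innerSL ℂ hB2.toLp)
  rw [key] at h
  refine h.congr_fun fun k => ?_
  rw [map_smul, key, smul_eq_mul]
  congr 1
  refine integral_congr_ae ?_
  filter_upwards [(memLp_modeFun k (hg k) (hC k) 2).coeFn_toLp] with x hx
  rw [modeLp, hx]

/-! ### Fourier multipliers from `H^{1/2}` to `H^{-1/2}` -/

/-- The Fourier coefficients of an element of `H^{1/2}`. -/
def HHalf.coeff (f : HHalf) (k : ℤ) : ℂ := fourierCoeff f.toFun k

theorem HHalf.norm_toSeq_apply (f : HHalf) (k : ℤ) :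
    ‖HHalf.toSeq f k‖ = (1 + (k : ℝ) ^ 2) ^ (1 / 4 : ℝ) * ‖f.coeff k‖ := by
  change ‖weightedCoeff (Subtype.val f) k‖ = _
  rw [weightedCoeff, norm_mul, Complex.norm_real, Real.norm_of_nonneg (by positivity)]
  rfl

theorem sqrt_weight_mul (k : ℤ) :
    (1 + (k : ℝ) ^ 2) ^ (1 / 4 : ℝ) * (1 + (k : ℝ) ^ 2) ^ (1 / 4 : ℝ) = √(1 + (k : ℝ) ^ 2) := by
  rw [← Real.rpow_add (by positivity), Real.sqrt_eq_rpow]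
  norm_num

theorem HHalf.coeff_add (f g : HHalf) (k : ℤ) : (f + g).coeff k = f.coeff k + g.coeff k := by
  change fourierCoeff ((Subtype.val f + Subtype.val g : L2Circle) : Angle → ℂ) k =
    fourierCoeff ((Subtype.val f : L2Circle) : Angle → ℂ) k +
    fourierCoeff ((Subtype.val g : L2Circle) : Angle → ℂ) k
  simp only [← fourierBasis_repr, map_add, lp.coeFn_add, Pi.add_apply]

theorem HHalf.coeff_smul (c : ℂ) (f : HHalf) (k : ℤ) : (c • f).coeff k = c * f.coeff k := by
  change fourierCoeff ((c • Subtype.val f : L2Circle) : Angle → ℂ) k =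
    c * fourierCoeff ((Subtype.val f : L2Circle) : Angle → ℂ) k
  simp only [← fourierBasis_repr, map_smul, lp.coeFn_smul, Pi.smul_apply, smul_eq_mul]

theorem HHalf.summable_norm_toSeq (f : HHalf) :
    Summable fun k => ‖HHalf.toSeq f k‖ ^ (2 : ℝ) := by
  simpa using (lp.memℓp (HHalf.toSeq f)).summable (by norm_num)

theorem HHalf.summable_weight (f : HHalf) :
    Summable fun k : ℤ => √(1 + (k : ℝ) ^ 2) * ‖f.coeff k‖ ^ 2 := by
  refine f.summable_norm_toSeq.congr fun k => ?_
  rw [HHalf.norm_toSeq_apply, ← sqrt_weight_mul, Real.rpow_two]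
  ring

theorem HHalf.norm_eq_tsum (f : HHalf) :
    ‖f‖ = (∑' k, ‖HHalf.toSeq f k‖ ^ (2 : ℝ)) ^ (1 / 2 : ℝ) := by
  have h : ‖f‖ = ‖HHalf.toSeq f‖ := rfl
  rw [h, lp.norm_eq_tsum_rpow (by norm_num)]
  simp

/-- Cauchy–Schwarz in `ℓ²`, after the weight is split evenly between the two factors. The index `-k`
appears because the boundary pairing is bilinear; reflecting the index does not change the norm. -/
theorem HHalf.summable_and_tsum_le (f g : HHalf) :
    (Summable fun k : ℤ => √(1 + (k : ℝ) ^ 2) * (‖f.coeff k‖ * ‖g.coeff (-k)‖)) ∧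
    ∑' k : ℤ, √(1 + (k : ℝ) ^ 2) * (‖f.coeff k‖ * ‖g.coeff (-k)‖) ≤ ‖f‖ * ‖g‖ := by
  have hpq : (2 : ℝ).HolderConjugate 2 := Real.HolderConjugate.two_two
  have hg := (Equiv.neg ℤ).summable_iff.2 g.summable_norm_toSeq
  have he : ∀ k : ℤ, √(1 + (k : ℝ) ^ 2) * (‖f.coeff k‖ * ‖g.coeff (-k)‖) =
      ‖HHalf.toSeq f k‖ * ‖HHalf.toSeq g (-k)‖ := by
    intro k
    rw [HHalf.norm_toSeq_apply, HHalf.norm_toSeq_apply, ← sqrt_weight_mul]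
    push_cast
    rw [neg_sq]
    ring
  have h := Real.summable_and_inner_le_Lp_mul_Lq_tsum_of_nonneg hpq (f := fun k => ‖HHalf.toSeq f k‖)
    (g := fun k => ‖HHalf.toSeq g (-k)‖) (fun _ => norm_nonneg _) (fun _ => norm_nonneg _)
    f.summable_norm_toSeq hg
  simp only [he]
  refine ⟨h.1, h.2.trans_eq ?_⟩
  rw [f.norm_eq_tsum, g.norm_eq_tsum]
  congr 2
  exact (Equiv.neg ℤ).tsum_eq fun k => ‖HHalf.toSeq g k‖ ^ (2 : ℝ)

/-- `Λ` is the Fourier multiplier with symbol `l`. -/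
def IsMultiplier (l : ℤ → ℝ) (Λ : HHalf →L[ℂ] HMinusHalf) : Prop :=
  ∀ f g : HHalf, HasSum (fun k => f.coeff k * (2 * π * l k * g.coeff (-k))) (Λ f g)

/-- A symbol of first order costs one derivative, and `f` and `g` carry half a derivative each. -/
theorem multiplier_bound {l : ℤ → ℝ} {M : ℝ} (hl : ∀ k : ℤ, |l k| ≤ M * √(1 + (k : ℝ) ^ 2))
    (f g : HHalf) :
    (Summable fun k => f.coeff k * (2 * π * l k * g.coeff (-k) : ℂ)) ∧
    ‖∑' k, f.coeff k * (2 * π * l k * g.coeff (-k) : ℂ)‖ ≤ 2 * π * M * ‖f‖ * ‖g‖ := by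
  obtain ⟨h1, h2⟩ := f.summable_and_tsum_le g
  -- At `k = 0` the weight is `1`, so the hypothesis reads `|l 0| ≤ M`.
  have hM : 0 ≤ M := by
    have := (abs_nonneg _).trans (hl 0)
    simpa using this
  have hb : ∀ k, ‖f.coeff k * (2 * π * l k * g.coeff (-k) : ℂ)‖ ≤
      2 * π * M * (√(1 + (k : ℝ) ^ 2) * (‖f.coeff k‖ * ‖g.coeff (-k)‖)) := by
    intro k
    simp only [norm_mul, Complex.norm_real, Real.norm_eq_abs, abs_of_pos Real.pi_pos,
      Complex.norm_ofNat]
    have h3 := mul_le_mul_of_nonneg_right (hl k)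
      (by positivity : 0 ≤ 2 * π * (‖f.coeff k‖ * ‖g.coeff (-k)‖))
    linarith
  have hs := h1.mul_left (2 * π * M)
  refine ⟨.of_norm_bounded hs hb, (tsum_of_norm_bounded hs.hasSum hb).trans ?_⟩
  rw [tsum_mul_left, mul_assoc (2 * π * M)]
  exact mul_le_mul_of_nonneg_left h2 (by positivity)

theorem exists_isMultiplier {l : ℤ → ℝ} {M : ℝ}
    (hl : ∀ k : ℤ, |l k| ≤ M * √(1 + (k : ℝ) ^ 2)) : ∃ Λ, IsMultiplier l Λ := by
  have hs := fun f g => (multiplier_bound hl f g).1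
  refine ⟨LinearMap.mkContinuous₂ (LinearMap.mk₂ ℂ
    (fun f g : HHalf => ∑' k, f.coeff k * (2 * π * l k * g.coeff (-k) : ℂ))
    (fun f f' g => ?_) (fun c f g => ?_) (fun f g g' => ?_) (fun c f g => ?_)) (2 * π * M)
    (fun f g => (multiplier_bound hl f g).2), fun f g => (hs f g).hasSum⟩
  · simp only [HHalf.coeff_add, add_mul]
    exact (hs f g).tsum_add (hs f' g)
  · simp only [HHalf.coeff_smul, mul_assoc, smul_eq_mul, tsum_mul_left]
  · simp only [HHalf.coeff_add, mul_add]
    exact (hs f g).tsum_add (hs f g')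
  · rw [smul_eq_mul, ← tsum_mul_left]
    refine tsum_congr fun k => ?_
    rw [HHalf.coeff_smul]
    ring

theorem norm_sub_le_of_isMultiplier {l l' : ℤ → ℝ} {Λ Λ' : HHalf →L[ℂ] HMinusHalf}
    (h : IsMultiplier l Λ) (h' : IsMultiplier l' Λ') {M : ℝ} (hM : 0 ≤ M)
    (hl : ∀ k : ℤ, |l k - l' k| ≤ M * √(1 + (k : ℝ) ^ 2)) : ‖Λ - Λ'‖ ≤ 2 * π * M := by
  refine ContinuousLinearMap.opNorm_le_bound₂ _ (by positivity) fun f g => ?_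
  have h1 : HasSum (fun k => f.coeff k * (2 * π * (l k - l' k : ℝ) * g.coeff (-k)))
      ((Λ - Λ') f g) := by
    refine ((h f g).sub (h' f g)).congr_fun fun k => ?_
    push_cast
    ring
  rw [← h1.tsum_eq]
  exact (multiplier_bound hl f g).2

/-! ### Boundary values -/

theorem bdryPoint_coe (θ : ℝ) : bdryPoint (θ : Angle) = polarPt 2 θ := by
  ext i
  fin_cases i
  · exact congrArg (2 * ·) (Real.Angle.cos_coe θ)
  · exact congrArg (2 * ·) (Real.Angle.sin_coe θ)

theorem normal_coe (θ : ℝ) (i : Fin 2) : normal (θ : Angle) i = radDir i θ := by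
  fin_cases i
  · exact Real.Angle.cos_coe θ
  · exact Real.Angle.sin_coe θ

theorem continuous_normal (i : Fin 2) : Continuous fun θ : Angle => normal θ i := by
  fin_cases i
  · exact Real.Angle.continuous_cos
  · exact Real.Angle.continuous_sin

theorem continuous_bdryPoint : Continuous bdryPoint := by
  have : Continuous normal := by
    refine (PiLp.continuous_toLp 2 _).comp (continuous_pi fun i => ?_)
    fin_cases i
    · exact Real.Angle.continuous_cos
    · exact Real.Angle.continuous_sin
  exact this.const_smul (2 : ℝ)

theorem fourier_coe (k : ℤ) (θ : ℝ) :
    fourier k (θ : Angle) = Complex.exp (k * θ * Complex.I) := by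
  rw [fourier_coe_apply]
  congr 1
  have : (π : ℂ) ≠ 0 := Complex.ofReal_ne_zero.2 Real.pi_ne_zero
  push_cast
  field_simp

theorem integral_angle_eq (F : Angle → ℂ) :
    ∫ θ, F θ = ∫ θ in Ioo (-π) π, F (θ : ℝ) := by
  rw [← AddCircle.integral_preimage (2 * π) (-π), integral_Ioc_eq_integral_Ioo]
  ring_nf

theorem integral_volume_angle (F : Angle → ℂ) :
    ∫ θ, F θ = 2 * π * ∫ θ, F θ ∂AddCircle.haarAddCircle := by
  rw [AddCircle.volume_eq_smul_haarAddCircle, integral_smul_measure,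
    ENNReal.toReal_ofReal Real.two_pi_pos.le, Complex.real_smul]
  push_cast
  rfl

/-- Fourier coefficients of boundary values of functions on the plane. -/
theorem HHalf.two_pi_mul_coeff_neg {φ : Plane → ℝ} {g : HHalf}
    (hg : g.toFun =ᵐ[AddCircle.haarAddCircle] fun θ => (φ (bdryPoint θ) : ℂ)) (k : ℤ) :
    2 * π * g.coeff (-k) =
      ∫ θ in Ioo (-π) π, (φ (polarPt 2 θ) : ℂ) * Complex.exp (k * θ * Complex.I) := by
  have h : g.coeff (-k) = ∫ θ : Angle, fourier k θ * (φ (bdryPoint θ) : ℂ)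
      ∂AddCircle.haarAddCircle := by
    rw [HHalf.coeff, fourierCoeff, neg_neg]
    refine integral_congr_ae ?_
    filter_upwards [hg] with θ hθ
    rw [hθ, smul_eq_mul]
  rw [h, ← integral_volume_angle, integral_angle_eq]
  simp only [fourier_coe, bdryPoint_coe, mul_comm]

/-- Fourier expansion of the integral against a continuous function. -/
theorem HHalf.hasSum_integral (f : HHalf) {ψ : Angle → ℝ} (hψ : Continuous ψ) :
    HasSum (fun k => f.coeff k *
        ∫ θ in Ioo (-π) π, (ψ (θ : ℝ) : ℂ) * Complex.exp (k * θ * Complex.I))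
      (∫ θ, ψ θ • f.toFun θ) := by
  obtain ⟨C, hC⟩ := isCompact_univ.exists_bound_of_continuousOn hψ.continuousOn
  have hB : MemLp (fun θ => (ψ θ : ℂ)) 2 (AddCircle.haarAddCircle : Measure Angle) :=
    MemLp.of_bound (Complex.continuous_ofReal.comp hψ).aestronglyMeasurable C
      (.of_forall fun θ => by simpa using hC θ (mem_univ θ))
  have key : ∀ v : L2Circle, 2 * π * innerSL ℂ hB.toLp v = ∫ θ, (ψ θ : ℂ) * v θ := by
    intro v
    rw [integral_volume_angle, innerSL_apply_apply, L2.inner_def]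
    congr 1
    refine integral_congr_ae ?_
    filter_upwards [hB.coeFn_toLp] with x hx
    rw [hx, RCLike.inner_apply, Complex.conj_ofReal, mul_comm]
  have h := ((hasSum_fourier_series_L2 (Subtype.val f : L2Circle)).mapL
    (innerSL ℂ hB.toLp)).mul_left (2 * π : ℂ)
  rw [key] at h
  refine (h.congr_fun fun k => ?_)
  rw [map_smul, smul_eq_mul, mul_left_comm, key, integral_volume_angle]
  congr 1
  rw [← integral_congr_ae (f := fun θ => (ψ θ : ℂ) * fourier k θ), ← integral_volume_angle,
    integral_angle_eq]
  · simp only [fourier_coe]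
  · filter_upwards [coeFn_fourierLp 2 k] with x hx
    rw [hx]

/-! ### The Dirichlet-to-Neumann map of a radial conductivity -/

theorem memLp_top_annulus_of_continuous {a b : ℝ} {B : Plane → ℝ} (hB : Continuous B) :
    MemLp (fun x => (B x : ℂ)) ∞ (volume.restrict (annulus a b)) := by
  obtain ⟨C, hC⟩ := (isCompact_closedBall (0 : Plane) b).exists_bound_of_continuousOn
    hB.continuousOn
  refine memLp_top_of_bound (Complex.continuous_ofReal.comp hB).aestronglyMeasurable C ?_
  refine (ae_restrict_iff' (measurableSet_annulus a b)).2 (.of_forall fun x hx => ?_)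
  simpa using hC x (by simpa using hx.2.le)

theorem measurable_radField (i : Fin 2) : Measurable (radField i) := by
  unfold radField
  fun_prop

theorem measurable_tanField (i : Fin 2) : Measurable (tanField i) := by
  fin_cases i
  · exact (funext tanField_zero : tanField 0 = fun x => -radField 1 x) ▸
      (measurable_radField 1).neg
  · exact (funext tanField_one : tanField 1 = radField 0) ▸ measurable_radField 0

theorem abs_radField_le (i : Fin 2) (x : Plane) : |radField i x| ≤ 1 := by
  rw [radField, abs_div, abs_norm]
  exact div_le_one_of_le₀ (PiLp.norm_apply_le x i) (norm_nonneg x)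

theorem abs_tanField_le (i : Fin 2) (x : Plane) : |tanField i x| ≤ 1 := by
  fin_cases i
  · exact (congrArg abs (tanField_zero x)).trans_le
      ((abs_neg _).trans_le (abs_radField_le 1 x))
  · exact (congrArg abs (tanField_one x)).trans_le (abs_radField_le 0 x)

theorem memLp_top_radField (i : Fin 2) (μ : Measure Plane) :
    MemLp (fun x => (radField i x : ℂ)) ∞ μ :=
  memLp_top_of_bound (Complex.measurable_ofReal.comp (measurable_radField i)).aestronglyMeasurable
    1 (.of_forall fun x => by simpa using abs_radField_le i x)

theorem memLp_top_tanField (i : Fin 2) (μ : Measure Plane) :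
    MemLp (fun x => (tanField i x : ℂ)) ∞ μ :=
  memLp_top_of_bound (Complex.measurable_ofReal.comp (measurable_tanField i)).aestronglyMeasurable
    1 (.of_forall fun x => by simpa using abs_tanField_le i x)

theorem memLp_top_radial {a b C : ℝ} {g : ℝ → ℝ} (hg : Measurable g)
    (hC : ∀ s ∈ Ioo a b, |g s| ≤ C) :
    MemLp (fun x : Plane => (g ‖x‖ : ℂ)) ∞ (volume.restrict (annulus a b)) := by
  refine memLp_top_of_bound
    (Complex.measurable_ofReal.comp (hg.comp measurable_norm)).aestronglyMeasurable C ?_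
  refine (ae_restrict_iff' (measurableSet_annulus a b)).2 (.of_forall fun x hx => ?_)
  simpa using hC _ hx

theorem integral_add_three {μ : Measure Plane} [IsFiniteMeasure μ] {B₁ B₂ B₃ u R T : Plane → ℂ}
    (h₁ : MemLp B₁ ∞ μ) (h₂ : MemLp B₂ ∞ μ) (h₃ : MemLp B₃ ∞ μ)
    (hu : MemLp u 2 μ) (hR : MemLp R 2 μ) (hT : MemLp T 2 μ) :
    ∫ x, (B₁ x * u x + B₂ x * R x + B₃ x * T x) ∂μ =
      ∫ x, B₁ x * u x ∂μ + ∫ x, B₂ x * R x ∂μ + ∫ x, B₃ x * T x ∂μ := by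
  have i1 := (hu.mul' (r := 2) h₁).integrable one_le_two
  have i2 := (hR.mul' (r := 2) h₂).integrable one_le_two
  have i3 := (hT.mul' (r := 2) h₃).integrable one_le_two
  rw [← integral_add i1 i2]
  exact integral_add (i1.add i2) i3

section Series

variable {a : ℝ} {c α : ℝ → ℝ} {w p dw : ℤ → ℝ → ℝ}

/-- Mode energies growing like `|k|` are exactly what the `H^{1/2}` norm of the boundary value can
sum. -/
theorem summable_mul_integral {f : HHalf} {M : ℝ} {I : ℤ → ℝ} (h0 : ∀ k, 0 ≤ I k)
    (hI : ∀ k : ℤ, I k ≤ M * √(1 + (k : ℝ) ^ 2)) : Summable fun k => ‖f.coeff k‖ ^ 2 * I k := by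
  refine .of_nonneg_of_le (fun k => mul_nonneg (sq_nonneg _) (h0 k)) (fun k => ?_)
    (f.summable_weight.mul_left M)
  calc ‖f.coeff k‖ ^ 2 * I k ≤ ‖f.coeff k‖ ^ 2 * (M * √(1 + (k : ℝ) ^ 2)) :=
        mul_le_mul_of_nonneg_left (hI k) (sq_nonneg _)
    _ = _ := by ring

/-- The solution with given boundary values as a series of separated solutions. -/
theorem exists_solution_series (ha : 0 ≤ a)
    (hm : ∀ k : ℤ, IsRadialMode a 2 k c α (w k) (p k) (dw k)) {M : ℝ}
    (hE : ∀ k : ℤ, ∫ s in Ioo a 2, s * w k s ^ 2 ≤ M * √(1 + (k : ℝ) ^ 2) ∧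
      ∫ s in Ioo a 2, s * dw k s ^ 2 ≤ M * √(1 + (k : ℝ) ^ 2) ∧
      ∫ s in Ioo a 2, s * (k * w k s / s) ^ 2 ≤ M * √(1 + (k : ℝ) ^ 2)) (f : HHalf) :
    ∃ u R T : Plane → ℂ, MemLp u 2 (volume.restrict (annulus a 2)) ∧
      MemLp R 2 (volume.restrict (annulus a 2)) ∧ MemLp T 2 (volume.restrict (annulus a 2)) ∧
      ∀ B₁ B₂ B₃ : Plane → ℂ, MemLp B₁ ∞ (volume.restrict (annulus a 2)) →
        MemLp B₂ ∞ (volume.restrict (annulus a 2)) → MemLp B₃ ∞ (volume.restrict (annulus a 2)) →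
        HasSum (fun k => f.coeff k * ∫ x in annulus a 2, (B₁ x * modeFun k (w k) x +
            B₂ x * modeFun k (dw k) x + B₃ x * modeTan k (w k) x))
          (∫ x in annulus a 2, (B₁ x * u x + B₂ x * R x + B₃ x * T x)) := by
  have hnn : ∀ g : ℝ → ℝ, 0 ≤ ∫ s in Ioo a 2, s * g s ^ 2 := fun g =>
    setIntegral_nonneg measurableSet_Ioo fun s hs => mul_nonneg (ha.trans hs.1.le) (sq_nonneg _)
  have hw : ∀ k, Measurable (w k) := fun k => (hm k).continuous_fun.measurable
  have ht : ∀ k : ℤ, Measurable fun s => (k : ℝ) * w k s / s := fun k =>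
    ((hw k).const_mul _).div measurable_id
  have bw : ∀ k, ∃ C, ∀ s ∈ Ioo a 2, |w k s| ≤ C := fun k =>
    exists_bound_of_continuous (hm k).continuous_fun a 2
  have bd : ∀ k, ∃ C, ∀ s ∈ Ioo a 2, |dw k s| ≤ C := fun k =>
    (hm k).bound.imp fun M h s hs => (h s hs).1
  have bt : ∀ k : ℤ, ∃ C, ∀ s ∈ Ioo a 2, |(k : ℝ) * w k s / s| ≤ C := fun k =>
    (hm k).bound.imp fun M h s hs => (h s hs).2
  obtain ⟨u, hu, hu'⟩ := exists_mode_series ha f.coeff hw bw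
    (summable_mul_integral (fun k => hnn _) fun k => (hE k).1)
  obtain ⟨R, hR, hR'⟩ := exists_mode_series ha f.coeff (fun k => (hm k).measurable_deriv) bd
    (summable_mul_integral (fun k => hnn _) fun k => (hE k).2.1)
  -- The profiles in `exists_mode_series` are real, so the factor `I` of `modeTan` is put into the
  -- coefficients.
  obtain ⟨T, hT, hT'⟩ := exists_mode_series ha (fun k => f.coeff k * Complex.I) ht bt (by
    simpa only [norm_mul, Complex.norm_I, mul_one] using
      summable_mul_integral (f := f) (fun k => hnn _) fun k => (hE k).2.2)
  refine ⟨u, R, T, hu, hR, hT, fun B₁ B₂ B₃ h₁ h₂ h₃ => ?_⟩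
  rw [integral_add_three h₁ h₂ h₃ hu hR hT]
  refine (((hu' B₁ h₁).add (hR' B₂ h₂)).add (hT' B₃ h₃)).congr_fun fun k => ?_
  obtain ⟨C₁, c₁⟩ := bw k
  obtain ⟨C₂, c₂⟩ := bd k
  obtain ⟨C₃, c₃⟩ := bt k
  have hkT : MemLp (modeTan k (w k)) 2 (volume.restrict (annulus a 2)) :=
    (memLp_modeFun k (ht k) c₃ 2).const_mul Complex.I
  rw [integral_add_three h₁ h₂ h₃ (memLp_modeFun k (hw k) c₁ 2)
    (memLp_modeFun k (hm k).measurable_deriv c₂ 2) hkT, mul_add, mul_add, mul_assoc (f.coeff k)]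
  congr 2
  rw [← integral_const_mul]
  congr 1 with x
  simp only [modeTan]
  ring

theorem MemLp.polarVector {μ : Measure Plane} {R T : Plane → ℂ} (hR : MemLp R 2 μ)
    (hT : MemLp T 2 μ) : MemLp (polarVector R T) 2 μ :=
  memLp_pi_iff.2 fun i => (hR.mul' (r := 2) (memLp_top_radField i μ)).add
    (hT.mul' (r := 2) (memLp_top_tanField i μ))

theorem IsTest.apply_eq_zero {φ : Plane → ℝ} {U : Set Plane} (h : tsupport φ ⊆ U) {x : Plane}
    (hx : x ∉ U) : φ x = 0 :=
  image_eq_zero_of_notMem_tsupport fun hx' => hx (h hx')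

/-- The flux form of a polar tensor. -/
theorem fluxForm_polarTensor {b : ℝ} (ha : 0 ≤ a) {A : Plane → Matrix (Fin 2) (Fin 2) ℝ}
    (hA : ∀ᵐ x : Plane, x ∈ annulus a b → A x = polarTensor c α x) {D : Set Plane}
    (hD : D =ᵐ[volume] annulus a b) (R T : Plane → ℂ) (φ : Plane → ℝ) :
    fluxForm A D (polarVector R T) φ =
      ∫ x in annulus a b, ((0 : ℂ) * 0 +
        (c ‖x‖ * (α ‖x‖)⁻¹ * ∑ i, radField i x * pd i φ x : ℝ) * R x +
        (c ‖x‖ * α ‖x‖ * ∑ i, tanField i x * pd i φ x : ℝ) * T x) := by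
  rw [fluxForm, Measure.restrict_congr_set hD]
  refine integral_congr_ae ?_
  rw [EventuallyEq, ae_restrict_iff' (measurableSet_annulus a b)]
  filter_upwards [hA] with x hx hx'
  have hx0 : x ≠ 0 := norm_pos_iff.1 (ha.trans_lt hx'.1)
  rw [hx hx', zero_mul, zero_add,
    ← sum_polarTensor_mul c α R T (fun i => pd i φ x) hx0]
  simp only [Complex.real_smul, Complex.ofReal_mul]

theorem IsCoefficient.memLp_top {b : ℝ} (hc : IsCoefficient a b c α) {φ : Plane → ℝ}
    (hφ : IsTest φ) :
    MemLp (fun x : Plane => ((c ‖x‖ * (α ‖x‖)⁻¹ * ∑ i, radField i x * pd i φ x : ℝ) : ℂ)) ∞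
      (volume.restrict (annulus a b)) ∧
    MemLp (fun x : Plane => ((c ‖x‖ * α ‖x‖ * ∑ i, tanField i x * pd i φ x : ℝ) : ℂ)) ∞
      (volume.restrict (annulus a b)) := by
  obtain ⟨m, M, hm, hM⟩ := hc.bounds
  have h1 : ∀ s ∈ Ioo a b, |c s * (α s)⁻¹| ≤ M * m⁻¹ := by
    intro s hs
    obtain ⟨⟨h1, h2⟩, h3, h4⟩ := hM s hs
    have hα := hm.trans_le h3
    rw [abs_of_nonneg (mul_nonneg (hm.le.trans h1) (inv_nonneg.2 hα.le))]
    exact mul_le_mul h2 (inv_anti₀ hm h3) (inv_nonneg.2 hα.le) (hm.le.trans (h1.trans h2))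
  have h2 : ∀ s ∈ Ioo a b, |c s * α s| ≤ M * M := by
    intro s hs
    obtain ⟨⟨h1, h2⟩, h3, h4⟩ := hM s hs
    rw [abs_of_nonneg (mul_nonneg (hm.le.trans h1) (hm.le.trans h3))]
    exact mul_le_mul h2 h4 (hm.le.trans h3) (hm.le.trans (h1.trans h2))
  have hp : ∀ i, MemLp (fun x => (pd i φ x : ℂ)) ∞ (volume.restrict (annulus a b)) := fun i =>
    memLp_top_annulus_of_continuous (hφ.continuous_pd i)
  constructor
  · have h3 := memLp_top_radial (hc.measurable_left.mul hc.measurable_right.inv) h1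
    have h4 := (((hp 0).mul' (r := ∞) (memLp_top_radField 0 _)).add
      ((hp 1).mul' (r := ∞) (memLp_top_radField 1 _))).mul' (r := ∞) h3
    simpa [Fin.sum_univ_two] using h4
  · have h3 := memLp_top_radial (hc.measurable_left.mul hc.measurable_right) h2
    have h4 := (((hp 0).mul' (r := ∞) (memLp_top_tanField 0 _)).add
      ((hp 1).mul' (r := ∞) (memLp_top_tanField 1 _))).mul' (r := ∞) h3
    simpa [Fin.sum_univ_two] using h4

/-- The Dirichlet-to-Neumann map of a radial conductivity is a Fourier multiplier. -/
theorem isDtN_of_isRadialMode (ha : 0 ≤ a) (ha2 : a ≤ 2) {K : Set Plane}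
    {A : Plane → Matrix (Fin 2) (Fin 2) ℝ} (hc : IsCoefficient a 2 c α)
    (hD : (Metric.ball 0 2 \ K : Set Plane) =ᵐ[volume] annulus a 2)
    (hA : ∀ᵐ x : Plane, x ∈ annulus a 2 → A x = polarTensor c α x)
    (hK : a = 0 ∨ ∀ θ, polarPt a θ ∈ K)
    (hm : ∀ k : ℤ, IsRadialMode a 2 k c α (w k) (p k) (dw k)) (hw : ∀ k, w k 2 = 1) {M : ℝ}
    (hE : ∀ k : ℤ, ∫ s in Ioo a 2, s * w k s ^ 2 ≤ M * √(1 + (k : ℝ) ^ 2) ∧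
      ∫ s in Ioo a 2, s * dw k s ^ 2 ≤ M * √(1 + (k : ℝ) ^ 2) ∧
      ∫ s in Ioo a 2, s * (k * w k s / s) ^ 2 ≤ M * √(1 + (k : ℝ) ^ 2))
    {Λ : HHalf →L[ℂ] HMinusHalf} (hΛ : IsMultiplier (fun k => p k 2) Λ) : IsDtN A K Λ := by
  intro f
  obtain ⟨u, R, T, hu, hR, hT, hsum⟩ := exists_solution_series ha hm hE f
  have hmeas := Measure.restrict_congr_set (μ := volume) hD
  have htrace : HasTrace K u (polarVector R T) f.toFun := by
    intro φ hφ hsupp i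
    rw [hmeas]
    have hb1 := memLp_top_annulus_of_continuous (a := a) (b := 2) (hφ.continuous_pd i)
    have hb0 := memLp_top_annulus_of_continuous (a := a) (b := 2) hφ.differentiable.continuous
    have h1 := hsum _ _ _ hb1 ((memLp_top_radField i _).mul' (r := ∞) hb0)
      ((memLp_top_tanField i _).mul' (r := ∞) hb0)
    have hψ : Continuous fun θ : Angle => 2 * (φ (bdryPoint θ) * normal θ i) :=
      continuous_const.mul ((hφ.differentiable.continuous.comp continuous_bdryPoint).mul
        (continuous_normal i))
    have h2 := f.hasSum_integral hψ
    have h3 : ∫ x in annulus a 2, (pd i φ x • u x + φ x • polarVector R T x i) =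
        ∫ x in annulus a 2, ((pd i φ x : ℂ) * u x + φ x * radField i x * R x +
          φ x * tanField i x * T x) := by
      congr 1 with x
      simp only [Complex.real_smul, polarVector]
      ring
    rw [h3]
    -- Both sides of the trace identity are sums of series in `k`; by uniqueness of the sum it is
    -- enough to compare them mode by mode.
    refine h1.unique (h2.congr_fun fun k => ?_)
    congr 1
    have h4 := (hm k).integral_green ha ha2 hφ i
    -- The inner circle contributes nothing: either it shrinks to the origin and the factor `a` is
    -- zero, or it lies in `K`, where the test function vanishes.
    have h5 : ∀ θ, ((a * w k a : ℝ) * φ (polarPt a θ) : ℂ) = 0 := by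
      intro θ
      rcases hK with h | h
      · simp [h]
      · simp [IsTest.apply_eq_zero hsupp (fun h' => h' (h θ))]
    refine Eq.trans ?_ (h4.trans ?_)
    · congr 1 with x
      simp only [polarVector]
      ring
    · congr 1 with θ
      rw [h5, bdryPoint_coe, normal_coe, hw]
      push_cast
      ring
  have hflux : ∀ φ : Plane → ℝ, IsTest φ → HasSum (fun k => f.coeff k *
      (p k 2 * ∫ θ in Ioo (-π) π, (φ (polarPt 2 θ) : ℂ) * Complex.exp (k * θ * Complex.I)))
      (fluxForm A (Metric.ball 0 2 \ K) (polarVector R T) φ) := by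
    intro φ hφ
    obtain ⟨hb2, hb3⟩ := hc.memLp_top hφ
    rw [fluxForm_polarTensor ha hA hD]
    -- The flux form involves only the gradient, so the coefficient of `u` is zero; this matches the
    -- `0 * 0` in `fluxForm_polarTensor`.
    have h1 := hsum _ _ _ (MemLp.zero' : MemLp (fun _ : Plane => (0 : ℂ)) _ _) hb2 hb3
    simp only [zero_mul] at h1 ⊢
    refine h1.congr_fun fun k => ?_
    congr 1
    rw [← integral_const_mul]
    simp only [← mul_assoc]
    rw [← (hm k).integral_flux hc ha ha2 hφ]
    refine setIntegral_congr_fun (measurableSet_annulus a 2) fun x hx => ?_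
    have hx0 : x ≠ 0 := norm_pos_iff.1 (ha.trans_lt hx.1)
    simp only [sum_polarTensor_mul c α _ _ (fun i => pd i φ x) hx0, zero_add]
  refine ⟨u, polarVector R T, ⟨?_, ?_, ?_, htrace, ?_⟩, ?_⟩
  · rwa [hmeas]
  · rw [hmeas]
    exact MemLp.polarVector hR hT
  · intro φ hφ hsupp i
    -- The weak gradient identity is the trace identity for a test function that vanishes on the
    -- outer circle.
    have h := htrace φ hφ (fun x hx => (hsupp hx).2) i
    have hG := (memLp_pi_iff.1 (MemLp.polarVector hR hT)) i
    rw [hmeas] at h ⊢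
    have hb1 := memLp_top_annulus_of_continuous (a := a) (b := 2) (hφ.continuous_pd i)
    have hb0 := memLp_top_annulus_of_continuous (a := a) (b := 2) hφ.differentiable.continuous
    have h0 : ∀ θ : Angle, φ (bdryPoint θ) = 0 := by
      intro θ
      induction θ using QuotientAddGroup.induction_on with
      | H θ =>
        refine IsTest.apply_eq_zero hsupp fun hx => ?_
        have := mem_ball_zero_iff.1 hx.1
        erw [bdryPoint_coe, norm_polarPt zero_le_two] at this
        exact lt_irrefl _ this
    simp only [h0, zero_mul, mul_zero, zero_smul, integral_zero] at h
    rw [integral_add] at h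
    · exact eq_neg_of_add_eq_zero_left h
    · simpa only [Complex.real_smul] using (hu.mul' (r := 2) hb1).integrable one_le_two
    · simpa only [Complex.real_smul] using (hG.mul' (r := 2) hb0).integrable one_le_two
  · intro φ hφ hsupp
    refine (hflux φ hφ).unique (hasSum_zero.congr_fun fun k => ?_)
    have h0 : ∀ θ, φ (polarPt 2 θ) = 0 := fun θ =>
      IsTest.apply_eq_zero hsupp (by simp [norm_polarPt zero_le_two])
    simp [h0]
  · intro φ hφ g hg
    refine (hΛ f g).unique ((hflux φ hφ).congr_fun fun k => ?_)
    rw [← HHalf.two_pi_mul_coeff_neg hg]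
    ring

end Series

/-! ### Energy bounds -/

section Energy

variable {a b κ : ℝ} {c α w p dw : ℝ → ℝ}

/-- The energy identity of a separated solution. -/
theorem IsRadialMode.integral_energy (h : IsRadialMode a b κ c α w p dw)
    (hc : IsCoefficient a b c α) (hab : a ≤ b) :
    IntegrableOn (fun s => dw s * p s + w s * (κ ^ 2 * (c s * α s * w s / s))) (Ioo a b) ∧
    ∫ s in Ioo a b, (dw s * p s + w s * (κ ^ 2 * (c s * α s * w s / s))) = w b * p b := by
  obtain ⟨S, hS, hd⟩ := h.hasDerivAt
  obtain ⟨M, hM⟩ := h.bound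
  obtain ⟨m, K, hm, hK⟩ := hc.bounds
  obtain ⟨W, hW⟩ := exists_bound_of_continuous h.continuous_fun a b
  obtain ⟨Q, hQ⟩ := exists_bound_of_continuous h.continuous_flux a b
  have hmw := h.continuous_fun.measurable
  have hint : IntegrableOn (fun s => dw s * p s + w s * (κ ^ 2 * (c s * α s * w s / s)))
      (Ioo a b) := by
    refine Measure.integrableOn_of_bounded (M := M * Q + W * (|κ| * (K * K * M))) (by simp)
      ((h.measurable_deriv.mul h.continuous_flux.measurable).add (hmw.mul
        (((hc.measurable_left.mul hc.measurable_right).mul hmw |>.div measurable_id).const_mul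
          _))).aestronglyMeasurable
      ((ae_restrict_iff' measurableSet_Ioo).2 (.of_forall fun s hs => ?_))
    obtain ⟨⟨h1, h2⟩, h3, h4⟩ := hK s hs
    have hK0 : 0 ≤ K := hm.le.trans (h1.trans h2)
    have hM0 : 0 ≤ M := (abs_nonneg _).trans (hM s hs).1
    have e : κ ^ 2 * (c s * α s * w s / s) = κ * (c s * α s * (κ * w s / s)) := by ring
    rw [Real.norm_eq_abs, e]
    refine (abs_add_le _ _).trans (add_le_add ?_ ?_)
    · rw [abs_mul]
      exact mul_le_mul (hM s hs).1 (hQ s hs) (abs_nonneg _) hM0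
    · rw [abs_mul, abs_mul κ, abs_mul, abs_mul (c s), abs_of_nonneg (hm.le.trans h1),
        abs_of_nonneg (hm.le.trans h3)]
      have hcα : c s * α s ≤ K * K := mul_le_mul h2 h4 (hm.le.trans h3) hK0
      have hW0 : 0 ≤ W := (abs_nonneg _).trans (hW s hs)
      have hc0 : 0 ≤ c s := hm.le.trans h1
      have hα0 : 0 ≤ α s := hm.le.trans h3
      refine mul_le_mul (hW s hs) ?_ (by positivity) hW0
      refine mul_le_mul_of_nonneg_left ?_ (abs_nonneg κ)
      exact mul_le_mul hcα (hM s hs).2 (abs_nonneg _) (mul_nonneg hK0 hK0)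
  refine ⟨hint, ?_⟩
  have key := integral_eq_of_hasDerivAt_off_countable_of_le (fun s => w s * p s)
    (fun s => dw s * p s + w s * (κ ^ 2 * (c s * α s * w s / s))) hab hS
    (h.continuous_fun.mul h.continuous_flux).continuousOn
    (fun s hs => (hd s hs).1.mul (hd s hs).2)
    (by rwa [intervalIntegrable_iff_integrableOn_Ioo_of_le hab])
  rw [intervalIntegral.integral_of_le hab, integral_Ioc_eq_integral_Ioo] at key
  rw [key, h.flux_inner, mul_zero, sub_zero]

/-- The energy of a separated solution is controlled by its flux. -/
theorem IsRadialMode.energy_le (h : IsRadialMode a b κ c α w p dw)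
    (hc : IsCoefficient a b c α) (ha : 0 ≤ a) (hab : a ≤ b) {m K : ℝ} (hm : 0 < m)
    (hK : ∀ s ∈ Ioo a b, (m ≤ c s ∧ c s ≤ K) ∧ (m ≤ α s ∧ α s ≤ K)) :
    ∫ s in Ioo a b, s * dw s ^ 2 ≤ (K / m + m⁻¹ ^ 2) * (w b * p b) ∧
    ∫ s in Ioo a b, s * (κ * w s / s) ^ 2 ≤ (K / m + m⁻¹ ^ 2) * (w b * p b) := by
  obtain ⟨hint, he⟩ := h.integral_energy hc hab
  have hkey : ∀ s ∈ Ioo a b, 0 ≤ s * dw s ^ 2 ∧ 0 ≤ s * (κ * w s / s) ^ 2 ∧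
      s * dw s ^ 2 + s * (κ * w s / s) ^ 2 ≤ (K / m + m⁻¹ ^ 2) *
        (dw s * p s + w s * (κ ^ 2 * (c s * α s * w s / s))) := by
    intro s hs
    have hs0 : 0 < s := ha.trans_lt hs.1
    obtain ⟨⟨h1, h2⟩, h3, h4⟩ := hK s hs
    have hc0 := hm.trans_le h1
    have hα0 := hm.trans_le h3
    have hK0 := hc0.trans_le h2
    have e1 : dw s * p s = c s * (α s)⁻¹ * (s * dw s ^ 2) := by rw [← h.flux_eq s hs]; ring
    have e2 : w s * (κ ^ 2 * (c s * α s * w s / s)) = c s * α s * (s * (κ * w s / s) ^ 2) := by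
      field_simp
    have p1 : 0 ≤ s * dw s ^ 2 := by positivity
    have p2 : 0 ≤ s * (κ * w s / s) ^ 2 := by positivity
    refine ⟨p1, p2, ?_⟩
    rw [e1, e2]
    generalize s * dw s ^ 2 = x at *
    generalize s * (κ * w s / s) ^ 2 = y at *
    -- The radial conductivity `c / α` is at least `m / K` and the tangential one `c α` at least `m
    -- ^ 2`; the two terms of the constant are the inverses of these bounds.
    have q1 : 1 ≤ K / m * (c s * (α s)⁻¹) := by
      have : m * K⁻¹ ≤ c s * (α s)⁻¹ :=
        mul_le_mul h1 (inv_anti₀ hα0 h4) (inv_nonneg.2 hK0.le) hc0.le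
      calc 1 = K / m * (m * K⁻¹) := by field_simp
        _ ≤ _ := mul_le_mul_of_nonneg_left this (by positivity)
    have q2 : 1 ≤ m⁻¹ ^ 2 * (c s * α s) := by
      have : m * m ≤ c s * α s := mul_le_mul h1 h3 hm.le hc0.le
      calc 1 = m⁻¹ ^ 2 * (m * m) := by field_simp
        _ ≤ _ := mul_le_mul_of_nonneg_left this (by positivity)
    have r1 : 0 ≤ K / m * (c s * α s * y) := by positivity
    have r2 : 0 ≤ m⁻¹ ^ 2 * (c s * (α s)⁻¹ * x) := by positivity
    nlinarith [mul_le_mul_of_nonneg_right q1 p1, mul_le_mul_of_nonneg_right q2 p2]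
  rw [← he, ← integral_const_mul]
  constructor
  · refine integral_mono_of_nonneg ?_ (hint.const_mul _) ?_ <;>
      refine (ae_restrict_iff' measurableSet_Ioo).2 (.of_forall fun s hs => ?_)
    · exact (hkey s hs).1
    · have := hkey s hs
      simp only
      linarith [this.2.1, this.2.2]
  · refine integral_mono_of_nonneg ?_ (hint.const_mul _) ?_ <;>
      refine (ae_restrict_iff' measurableSet_Ioo).2 (.of_forall fun s hs => ?_)
    · exact (hkey s hs).2.1
    · have := hkey s hs
      simp only
      linarith [this.1, this.2.2]

end Energy

theorem abs_le_sqrt_one_add_sq (k : ℝ) : |k| ≤ √(1 + k ^ 2) :=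
  Real.abs_le_sqrt (by linarith)

theorem one_le_sqrt_one_add_sq (k : ℝ) : 1 ≤ √(1 + k ^ 2) :=
  Real.one_le_sqrt.2 (by nlinarith [sq_nonneg k])

theorem setIntegral_id_le {a : ℝ} (ha2 : a ≤ 2) : ∫ s in Ioo a 2, s ≤ 2 := by
  rw [← integral_Ioc_eq_integral_Ioo, ← intervalIntegral.integral_of_le ha2, integral_id]
  nlinarith

/-- The Dirichlet-to-Neumann map of a radial conductivity, when the fluxes are controlled by the
frequency. -/
theorem isDtN_of_flux_le {a : ℝ} (ha : 0 ≤ a) (ha2 : a ≤ 2) {K : Set Plane}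
    {A : Plane → Matrix (Fin 2) (Fin 2) ℝ} {c α : ℝ → ℝ} {w p dw : ℤ → ℝ → ℝ}
    (hc : IsCoefficient a 2 c α)
    (hD : (Metric.ball 0 2 \ K : Set Plane) =ᵐ[volume] annulus a 2)
    (hA : ∀ᵐ x : Plane, x ∈ annulus a 2 → A x = polarTensor c α x)
    (hK : a = 0 ∨ ∀ θ, polarPt a θ ∈ K)
    (hm : ∀ k : ℤ, IsRadialMode a 2 k c α (w k) (p k) (dw k)) (hw : ∀ k, w k 2 = 1)
    (hw0 : ∀ s, w 0 s = 1) {Q : ℝ} (hQ : ∀ k : ℤ, p k 2 ≤ Q * |(k : ℝ)|)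
    {Λ : HHalf →L[ℂ] HMinusHalf} (hΛ : IsMultiplier (fun k => p k 2) Λ) : IsDtN A K Λ := by
  obtain ⟨m, B, hm0, hB⟩ := hc.bounds
  -- The absolute value makes `N` nonnegative even when the interval is empty and `B` is arbitrary.
  set N := |B| / m + m⁻¹ ^ 2 with hN
  have hN0 : 0 ≤ N := by positivity
  have hE : ∀ k : ℤ, ∫ s in Ioo a 2, s * dw k s ^ 2 ≤ N * |Q| * |(k : ℝ)| ∧
      ∫ s in Ioo a 2, s * (k * w k s / s) ^ 2 ≤ N * |Q| * |(k : ℝ)| := by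
    intro k
    have h1 := (hm k).energy_le hc ha ha2 (K := |B|) hm0 fun s hs =>
      ⟨⟨(hB s hs).1.1, (hB s hs).1.2.trans (le_abs_self B)⟩, (hB s hs).2.1,
        (hB s hs).2.2.trans (le_abs_self B)⟩
    rw [hw, one_mul] at h1
    have h2 : (|B| / m + m⁻¹ ^ 2) * p k 2 ≤ N * |Q| * |(k : ℝ)| := by
      rw [← hN, mul_assoc]
      exact mul_le_mul_of_nonneg_left ((hQ k).trans
        (mul_le_mul_of_nonneg_right (le_abs_self Q) (abs_nonneg _))) hN0
    exact ⟨h1.1.trans h2, h1.2.trans h2⟩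
  have hle : ∀ k : ℤ, N * |Q| * |(k : ℝ)| ≤ (4 * (N * |Q|) + 2) * √(1 + (k : ℝ) ^ 2) := by
    intro k
    have h1 := abs_le_sqrt_one_add_sq (k : ℝ)
    have h2 : 0 ≤ N * |Q| := by positivity
    have h3 := mul_le_mul_of_nonneg_left h1 h2
    nlinarith [Real.sqrt_nonneg (1 + (k : ℝ) ^ 2)]
  refine isDtN_of_isRadialMode ha ha2 hc hD hA hK hm hw (M := 4 * (N * |Q|) + 2)
    (fun k => ⟨?_, (hE k).1.trans (hle k), (hE k).2.trans (hle k)⟩) hΛ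
  have h1 := abs_le_sqrt_one_add_sq (k : ℝ)
  have h1' := one_le_sqrt_one_add_sq (k : ℝ)
  have h2 : 0 ≤ N * |Q| := by positivity
  -- The gradient energy says nothing about the constant mode, which is integrated directly and
  -- accounts for the `+ 2`. For `k ≠ 0`, `s < 2` and `|k| ≥ 1` give `w² ≤ 4 (k w / s)²`, whence the
  -- factor `4`.
  rcases eq_or_ne k 0 with rfl | hk
  · simp only [hw0, one_pow, mul_one]
    refine (setIntegral_id_le ha2).trans ?_
    nlinarith
  · have hk1 : 1 ≤ (k : ℝ) ^ 2 := by
      have := Int.one_le_abs hk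
      have h3 : (1 : ℝ) ≤ |(k : ℝ)| := by exact_mod_cast this
      rw [← sq_abs]
      exact one_le_pow₀ h3
    obtain ⟨W, hW⟩ := (hm k).bound
    have hint : IntegrableOn (fun s => s * (k * w k s / s) ^ 2) (Ioo a 2) := by
      refine Measure.integrableOn_of_bounded (M := 2 * W ^ 2) (by simp)
        (measurable_id.mul ((((hm k).continuous_fun.measurable.const_mul _).div
          measurable_id).pow_const 2)).aestronglyMeasurable
        ((ae_restrict_iff' measurableSet_Ioo).2 (.of_forall fun s hs => ?_))
      have hs0 : 0 ≤ s := ha.trans hs.1.le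
      have h3 := (hW s hs).2
      rw [Real.norm_eq_abs, abs_mul, abs_pow, abs_of_nonneg hs0]
      exact mul_le_mul hs.2.le (pow_le_pow_left₀ (abs_nonneg _) h3 2) (by positivity) zero_le_two
    have h4 : ∫ s in Ioo a 2, s * w k s ^ 2 ≤ 4 * ∫ s in Ioo a 2, s * (k * w k s / s) ^ 2 := by
      rw [← integral_const_mul]
      refine integral_mono_of_nonneg ?_ (hint.const_mul 4) ?_ <;>
        refine (ae_restrict_iff' measurableSet_Ioo).2 (.of_forall fun s hs => ?_)
      · exact mul_nonneg (ha.trans hs.1.le) (sq_nonneg _)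
      · have hs0 : 0 < s := ha.trans_lt hs.1
        have hs4 : s ^ 2 ≤ 4 := by nlinarith [hs.2]
        have e : 4 * (s * (k * w k s / s) ^ 2) = s * w k s ^ 2 * (k ^ 2 * (4 / s ^ 2)) := by
          field_simp
        have h5 : 1 ≤ (k : ℝ) ^ 2 * (4 / s ^ 2) := by
          have : 1 ≤ 4 / s ^ 2 := (one_le_div (by positivity)).2 hs4
          nlinarith
        simp only
        rw [e]
        exact le_mul_of_one_le_right (by positivity) h5
    have h6 := mul_le_mul_of_nonneg_left h1 h2
    have h7 := (hE k).2
    nlinarith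

/-! ### The radial profile of the coated disk -/

/-- The conductivity of the coated disk as a function of the radius. -/
def layeredProfile (L : ℕ) (r σ : ℕ → ℝ) (s : ℝ) : ℝ := layered L r σ (polarPt s 0)

section Profile

variable {L : ℕ} {r σ : ℕ → ℝ}

theorem mem_region_iff_of_norm_eq {x y : Plane} (h : ‖x‖ = ‖y‖) (j : ℕ) :
    x ∈ region L r j ↔ y ∈ region L r j := by
  unfold region
  split_ifs <;> simp [h]

theorem layered_eq_profile (x : Plane) : layered L r σ x = layeredProfile L r σ ‖x‖ := by
  have h : ‖x‖ = ‖polarPt ‖x‖ 0‖ := (norm_polarPt (norm_nonneg x) 0).symm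
  refine Finset.sum_congr rfl fun j _ => ?_
  by_cases hj : x ∈ region L r j
  · rw [indicator_of_mem hj, indicator_of_mem ((mem_region_iff_of_norm_eq h j).1 hj)]
  · rw [indicator_of_notMem hj, indicator_of_notMem (mt (mem_region_iff_of_norm_eq h j).2 hj)]

theorem measurableSet_region (j : ℕ) : MeasurableSet (region L r j) := by
  unfold region
  split_ifs
  · exact measurableSet_lt measurable_const measurable_norm
  · exact measurableSet_le measurable_norm measurable_const
  · exact (measurableSet_lt measurable_const measurable_norm).inter
      (measurableSet_le measurable_norm measurable_const)

theorem measurable_layered : Measurable (layered L r σ) :=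
  Finset.measurable_sum _ fun j _ => measurable_const.indicator (measurableSet_region j)

theorem measurable_layeredProfile : Measurable (layeredProfile L r σ) :=
  measurable_layered.comp
    (continuous_polarPt.comp (by fun_prop : Continuous fun s : ℝ => (s, (0 : ℝ)))).measurable

theorem norm_le_of_mem_region {j : ℕ} (hj : j ≠ 0) {x : Plane} (hx : x ∈ region L r j) :
    ‖x‖ ≤ r j := by
  unfold region at hx
  rw [if_neg hj] at hx
  split_ifs at hx with h
  · rw [h]
    exact hx
  · exact hx.2

theorem lt_norm_of_mem_region {j : ℕ} (hj : j ≠ L + 1) {x : Plane} (hx : x ∈ region L r j) :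
    r (j + 1) < ‖x‖ := by
  unfold region at hx
  split_ifs at hx with h
  · rw [h]
    exact hx
  · exact hx.1

theorem IsCoatedDisk.radius_le (h : IsCoatedDisk L r σ) {i j : ℕ} (hi : 1 ≤ i) (hij : i ≤ j)
    (hj : j ≤ L + 1) : r j ≤ r i := by
  induction j, hij using Nat.le_induction with
  | base => exact le_rfl
  | succ j hij ih =>
    exact (h.decreasing j (hi.trans hij) (by omega)).le.trans (ih (by omega))

theorem IsCoatedDisk.region_disjoint (h : IsCoatedDisk L r σ) {i j : ℕ} (hij : i < j)
    (hj : j ≤ L + 1) {x : Plane} (hi : x ∈ region L r i) : x ∉ region L r j := by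
  intro hx
  have h1 := lt_norm_of_mem_region (by omega) hi
  have h2 := norm_le_of_mem_region (by omega) hx
  have h3 := h.radius_le (by omega : 1 ≤ i + 1) hij hj
  linarith

theorem IsCoatedDisk.layered_eq (h : IsCoatedDisk L r σ) {j : ℕ} (hj : j ≤ L + 1) {x : Plane}
    (hx : x ∈ region L r j) : layered L r σ x = σ j := by
  rw [layered, Finset.sum_eq_single_of_mem j (Finset.mem_range.2 (by omega)), indicator_of_mem hx]
  intro i hi hij
  have hi' : i ≤ L + 1 := by have := Finset.mem_range.1 hi; omega
  rw [indicator_of_notMem]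
  rcases lt_or_gt_of_ne hij with hlt | hlt
  · exact fun hi'' => h.region_disjoint hlt hj hi'' hx
  · exact h.region_disjoint hlt hi' hx

theorem IsCoatedDisk.profile_eq_one (h : IsCoatedDisk L r σ) {s : ℝ} (hs : 2 < s) :
    layeredProfile L r σ s = 1 := by
  rw [← h.background]
  refine h.layered_eq (Nat.zero_le _) ?_
  rw [region, if_pos rfl, mem_ofPred_eq, norm_polarPt (by linarith), h.outer]
  exact hs

theorem IsCoatedDisk.profile_eq (h : IsCoatedDisk L r σ) {j : ℕ} (hj : 1 ≤ j) (hjL : j ≤ L)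
    {s : ℝ} (hs : r (j + 1) < s) (hs' : s ≤ r j) : layeredProfile L r σ s = σ j := by
  refine h.layered_eq (by omega) ?_
  have h1 : 1 ≤ r (j + 1) := h.inner ▸ h.radius_le (by omega) (by omega) le_rfl
  rw [region, if_neg (by omega), if_neg (by omega), mem_ofPred_eq, norm_polarPt (by linarith)]
  exact ⟨hs, hs'⟩

/-- Outside the core only the positive values `σ 0, …, σ L` occur, which is what makes the equation
elliptic there. -/
theorem IsCoatedDisk.exists_profile_eq (h : IsCoatedDisk L r σ) {s : ℝ} (hs : 1 < s) :
    ∃ j ≤ L, layeredProfile L r σ s = σ j := by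
  by_cases h2 : 2 < s
  · exact ⟨0, Nat.zero_le _, by rw [h.profile_eq_one h2, h.background]⟩
  -- The layer containing `s` has the least `j` with `r (j + 1) < s`; minimality gives `s ≤ r j`.
  · have hex : ∃ j, r (j + 1) < s := ⟨L, by rwa [h.inner]⟩
    classical
    have hj := Nat.find_spec hex
    have hjL : Nat.find hex ≤ L := Nat.find_min' hex (by rwa [h.inner])
    have hj0 : Nat.find hex ≠ 0 := by
      intro h0
      rw [h0, zero_add, h.outer] at hj
      exact h2 hj
    obtain ⟨i, hi⟩ := Nat.exists_eq_succ_of_ne_zero hj0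
    have hmin : ¬ r (i + 1) < s := Nat.find_min hex (by omega)
    rw [hi] at hj hjL
    exact ⟨i + 1, hjL, h.profile_eq (by omega) hjL hj (not_lt.1 hmin)⟩

theorem IsCoatedDisk.conductivity_pos (h : IsCoatedDisk L r σ) {j : ℕ} (hj : j ≤ L) : 0 < σ j := by
  rcases Nat.eq_zero_or_pos j with rfl | hj0
  · rw [h.background]
    exact one_pos
  · exact h.coating j hj0 hj

theorem IsCoatedDisk.exists_bounds (h : IsCoatedDisk L r σ) :
    ∃ m S : ℝ, 0 < m ∧ ∀ j ≤ L, m ≤ σ j ∧ σ j ≤ S := by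
  have hne : (Finset.range (L + 1)).Nonempty := ⟨0, by simp⟩
  refine ⟨(Finset.range (L + 1)).inf' hne σ, (Finset.range (L + 1)).sup' hne σ, ?_, fun j hj => ?_⟩
  · rw [Finset.lt_inf'_iff]
    exact fun j hj => h.conductivity_pos (Nat.lt_succ_iff.1 (Finset.mem_range.1 hj))
  · have hj' := Finset.mem_range.2 (Nat.lt_succ_of_le hj)
    exact ⟨Finset.inf'_le σ hj', Finset.le_sup' σ hj'⟩

end Profile

/-! ### The radial equation in logarithmic coordinates -/

/-- `V' = P / C`, `P' = n² C V` on `(0, T)`, with no flux at `0`. -/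
structure IsLogMode (n : ℝ) (C : ℝ → ℝ) (T : ℝ) (V P : ℝ → ℝ) : Prop where
  continuous_fun : Continuous V
  continuous_flux : Continuous P
  flux_zero : P 0 = 0
  hasDerivAt : ∃ S : Set ℝ, S.Countable ∧ ∀ τ ∈ Ioo 0 T \ S,
    HasDerivAt V (P τ / C τ) τ ∧ HasDerivAt P (n ^ 2 * C τ * V τ) τ

/-- Solution of the system in a layer of conductivity `q` with data `v`, `p` at `T`. -/
def layerFun (n q v p T τ : ℝ) : ℝ :=
  v * Real.cosh (n * (τ - T)) + p / (n * q) * Real.sinh (n * (τ - T))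

/-- Flux of the solution in a layer of conductivity `q` with data `v`, `p` at `T`. -/
def layerFlux (n q v p T τ : ℝ) : ℝ :=
  p * Real.cosh (n * (τ - T)) + n * q * v * Real.sinh (n * (τ - T))

section Log

variable {n q v p T : ℝ}

theorem hasDerivAt_layer (hn : n ≠ 0) (hq : q ≠ 0) (τ : ℝ) :
    HasDerivAt (layerFun n q v p T) (layerFlux n q v p T τ / q) τ ∧
    HasDerivAt (layerFlux n q v p T) (n ^ 2 * q * layerFun n q v p T τ) τ := by
  have h0 : HasDerivAt (fun t : ℝ => n * (t - T)) n τ := by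
    simpa using ((hasDerivAt_id τ).sub_const T).const_mul n
  have hc := h0.cosh
  have hs := h0.sinh
  constructor
  · refine ((hc.const_mul v).add (hs.const_mul (p / (n * q)))).congr_deriv ?_
    rw [layerFlux]
    field_simp
    ring
  · refine ((hc.const_mul p).add (hs.const_mul (n * q * v))).congr_deriv ?_
    rw [layerFun]
    field_simp
    ring

theorem continuous_layerFun : Continuous (layerFun n q v p T) := by
  unfold layerFun
  fun_prop

theorem continuous_layerFlux : Continuous (layerFlux n q v p T) := by
  unfold layerFlux
  fun_prop

/-- The quotient `P / V` satisfies a Riccati equation that pulls it towards `n q`. Since `q ≤ S`, it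
cannot rise above `n S` once it is below. This bound is uniform in the frequency up to the factor
`n`, and it makes the final constant explicit. -/
theorem layer_bounds {S τ : ℝ} (hn : 0 < n) (hq : 0 < q) (hqS : q ≤ S) (hτ : T ≤ τ)
    (hv : 0 < v) (hp : 0 ≤ p) (hpv : p ≤ n * S * v) :
    0 < layerFun n q v p T τ ∧ 0 ≤ layerFlux n q v p T τ ∧
      layerFlux n q v p T τ ≤ n * S * layerFun n q v p T τ := by
  rw [layerFun, layerFlux]
  have hs : 0 ≤ Real.sinh (n * (τ - T)) :=
    Real.sinh_nonneg_iff.2 (mul_nonneg hn.le (sub_nonneg.2 hτ))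
  have hcs : Real.sinh (n * (τ - T)) ≤ Real.cosh (n * (τ - T)) := (Real.sinh_lt_cosh _).le
  have hc : 0 < Real.cosh (n * (τ - T)) := Real.cosh_pos _
  generalize Real.sinh (n * (τ - T)) = s at *
  generalize Real.cosh (n * (τ - T)) = c at *
  refine ⟨by positivity, by positivity, ?_⟩
  have h1 : (n * S * v - p) * s ≤ (n * S * v - p) * c :=
    mul_le_mul_of_nonneg_left hcs (sub_nonneg.2 hpv)
  have h2 : 0 ≤ (S - q) * (n * v + p / q) * s := by
    have := sub_nonneg.2 hqS
    positivity
  have e : n * S * (v * c + p / (n * q) * s) = n * S * v * c + S * (p / q) * s := by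
    field_simp
  have e2 : q * (p / q) = p := by field_simp
  rw [e]
  have e3 : (S - q) * (n * v + p / q) * s =
      (n * S * v + S * (p / q) - n * q * v - q * (p / q)) * s := by ring
  rw [e3, e2] at h2
  linarith

/-- Continuation of a solution into the next layer. -/
theorem IsLogMode.extend {C V P : ℝ → ℝ} {T' : ℝ} (h : IsLogMode n C T V P) (hn : n ≠ 0)
    (hq : q ≠ 0) (hT : 0 ≤ T) (hC : ∀ τ, T < τ → τ < T' → C τ = q) :
    IsLogMode n C T' (fun τ => if τ ≤ T then V τ else layerFun n q (V T) (P T) T τ)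
      (fun τ => if τ ≤ T then P τ else layerFlux n q (V T) (P T) T τ) := by
  obtain ⟨S, hS, hd⟩ := h.hasDerivAt
  -- The coefficient may jump at `T`, which joins the exceptional set; continuity of `V` and of `P`
  -- there expresses the two transmission conditions.
  refine ⟨h.continuous_fun.if_le continuous_layerFun continuous_id continuous_const ?_,
    h.continuous_flux.if_le continuous_layerFlux continuous_id continuous_const ?_,
    by simpa [hT] using h.flux_zero, insert T S, hS.insert T, ?_⟩
  · rintro τ rfl
    simp [layerFun]
  · rintro τ rfl
    simp [layerFlux]
  · rintro τ ⟨hτ, hτS⟩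
    rw [mem_insert_iff, not_or] at hτS
    rcases lt_or_gt_of_ne hτS.1 with hlt | hgt
    · obtain ⟨h1, h2⟩ := hd τ ⟨⟨hτ.1, hlt⟩, hτS.2⟩
      have hev : ∀ᶠ t in 𝓝 τ, t ≤ T := (eventually_lt_nhds hlt).mono fun _ => le_of_lt
      simp only [if_pos hlt.le]
      exact ⟨h1.congr_of_eventuallyEq (hev.mono fun t ht => if_pos ht),
        h2.congr_of_eventuallyEq (hev.mono fun t ht => if_pos ht)⟩
    · have h12 := hasDerivAt_layer (v := V T) (p := P T) (T := T) hn hq τ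
      have hev : ∀ᶠ t in 𝓝 τ, ¬ t ≤ T := (eventually_gt_nhds hgt).mono fun _ => not_le_of_gt
      simp only [if_neg (not_le_of_gt hgt), hC τ hgt hτ.2]
      exact ⟨h12.1.congr_of_eventuallyEq (hev.mono fun t ht => if_neg ht),
        h12.2.congr_of_eventuallyEq (hev.mono fun t ht => if_neg ht)⟩

end Log

/-! ### Propagation of solutions through the coatings. -/

section CoatedDisk

variable {L : ℕ} {r σ : ℕ → ℝ}

/-- Induction outwards from the core: `i` is the number of coatings already crossed, and `L + 1 - i`
is the index of the radius reached. -/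
theorem IsCoatedDisk.exists_logMode_layers (h : IsCoatedDisk L r σ) {S : ℝ}
    (hS : ∀ j ≤ L, σ j ≤ S) {n : ℝ} (hn : 0 < n) (i : ℕ) (hi : i ≤ L) :
    ∃ V P, IsLogMode n (fun τ => layeredProfile L r σ (Real.exp τ)) (Real.log (r (L + 1 - i))) V P ∧
      0 < V (Real.log (r (L + 1 - i))) ∧ 0 ≤ P (Real.log (r (L + 1 - i))) ∧
      P (Real.log (r (L + 1 - i))) ≤ n * S * V (Real.log (r (L + 1 - i))) := by
  have hS0 : 0 ≤ S := (h.conductivity_pos (Nat.zero_le L)).le.trans (hS 0 (Nat.zero_le L))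
  induction i with
  | zero =>
    -- The initial data `V = 1`, `P = 0` encode the insulated core. As `log (r (L + 1)) = 0`, the
    -- interval is empty and there is no equation to check yet.
    refine ⟨fun _ => 1, fun _ => 0, ⟨continuous_const, continuous_const, rfl, ∅, countable_empty,
      ?_⟩, one_pos, le_rfl, by positivity⟩
    rintro τ ⟨hτ, -⟩
    rw [Nat.sub_zero, h.inner, Real.log_one] at hτ
    exact absurd (hτ.1.trans hτ.2) (lt_irrefl _)
  | succ i ih =>
    obtain ⟨V, P, hVP, hV, hP, hPV⟩ := ih (by omega)
    have e : L + 1 - i = L + 1 - (i + 1) + 1 := by omega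
    set j := L + 1 - (i + 1) with hj
    rw [e] at hVP hV hP hPV
    have hj1 : 1 ≤ j := by omega
    have hjL : j ≤ L := by omega
    have hr1 : 1 ≤ r (j + 1) := h.inner ▸ h.radius_le (by omega) (by omega) le_rfl
    have hr : r (j + 1) < r j := h.decreasing j hj1 hjL
    have hlog : Real.log (r (j + 1)) < Real.log (r j) := Real.log_lt_log (by linarith) hr
    have hσ := h.conductivity_pos hjL
    refine ⟨_, _, hVP.extend (q := σ j) hn.ne' hσ.ne' (Real.log_nonneg hr1) ?_, ?_⟩
    · intro τ h1 h2
      refine h.profile_eq hj1 hjL ?_ ?_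
      · exact (Real.log_lt_iff_lt_exp (by linarith)).1 h1
      · exact ((Real.lt_log_iff_exp_lt (by linarith)).1 h2).le
    · simp only [if_neg (not_le_of_gt hlog)]
      exact layer_bounds hn hσ (hS j hjL) hlog.le hV hP hPV

/-- Separated solutions for the coated disk, in logarithmic coordinates. -/
theorem IsCoatedDisk.exists_logMode (h : IsCoatedDisk L r σ) {S : ℝ}
    (hS : ∀ j ≤ L, σ j ≤ S) {n : ℝ} (hn : 0 < n) :
    ∃ V P v p, (∀ T, IsLogMode n (fun τ => layeredProfile L r σ (Real.exp τ)) T V P) ∧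
      0 < v ∧ 0 ≤ p ∧ p ≤ n * S * v ∧ ∀ τ, Real.log 2 < τ →
        V τ = layerFun n 1 v p (Real.log 2) τ ∧ P τ = layerFlux n 1 v p (Real.log 2) τ := by
  obtain ⟨V, P, hVP, hV, hP, hPV⟩ := h.exists_logMode_layers hS hn L le_rfl
  have e : L + 1 - L = 1 := by omega
  rw [e, h.outer] at hVP hV hP hPV
  -- One more extension, into the background of conductivity `1`. The extended functions do not
  -- depend on `T`, so one pair serves all radii.
  refine ⟨_, _, V (Real.log 2), P (Real.log 2), fun T => hVP.extend (q := 1) hn.ne' one_ne_zero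
    (Real.log_nonneg one_le_two) fun τ h1 _ => ?_, hV, hP, hPV, fun τ hτ => ?_⟩
  · exact h.profile_eq_one ((Real.log_lt_iff_lt_exp two_pos).1 h1)
  · exact ⟨if_neg (not_le_of_gt hτ), if_neg (not_le_of_gt hτ)⟩

end CoatedDisk

/-! ### Separated solutions from the logarithmic system -/

/-- Chain rule for `w = V ∘ T` and `p = P ∘ T` with `T' = α / s`. A reparametrisation of the
logarithmic radius turns into the anisotropy `α`, so one logarithmic solution yields the modes of
the coated disk (`T = log`, `α = 1`) and of its push-forward. The factor `x` is left free for
normalisation. -/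
theorem IsLogMode.isRadialMode {a b n κ x : ℝ} {c α C T V P : ℝ → ℝ} (ha : 0 < a)
    (hab : a < b) (hc : IsCoefficient a b c α) (hV : IsLogMode n C (T b) V P) (hκ : κ ^ 2 = n ^ 2)
    (hT : Continuous T) (hTa : T a = 0) (hTm : StrictMonoOn T (Icc a b))
    {S : Set ℝ} (hS : S.Countable) (hd : ∀ s ∈ Ioo a b \ S, HasDerivAt T (α s / s) s)
    (hcC : ∀ s ∈ Ioo a b, c s = C (T s)) :
    IsRadialMode a b κ c α (fun s => V (T s) * x) (fun s => P (T s) * x)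
      (fun s => α s * (P (T s) * x) / (s * c s)) := by
  obtain ⟨m, K, hm, hK⟩ := hc.bounds
  obtain ⟨U, hU, hVd⟩ := hV.hasDerivAt
  have hmaps : ∀ s ∈ Ioo a b, T s ∈ Ioo 0 (T b) := fun s hs =>
    ⟨hTa ▸ hTm (left_mem_Icc.2 hab.le) (Ioo_subset_Icc_self hs) hs.1,
      hTm (Ioo_subset_Icc_self hs) (right_mem_Icc.2 hab.le) hs.2⟩
  have hcV : Continuous fun s => V (T s) * x := (hV.continuous_fun.comp hT).mul continuous_const
  have hcP : Continuous fun s => P (T s) * x := (hV.continuous_flux.comp hT).mul continuous_const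
  obtain ⟨W, hW⟩ := exists_bound_of_continuous hcV a b
  obtain ⟨Q, hQ⟩ := exists_bound_of_continuous hcP a b
  refine ⟨hcV, hcP, (hc.measurable_right.mul hcP.measurable).div
    (measurable_id.mul hc.measurable_left), ⟨max (K * Q * (a * m)⁻¹) (|κ| * W * a⁻¹),
    fun s hs => ⟨?_, ?_⟩⟩, ⟨S ∪ {s ∈ Ioo a b | T s ∈ U}, hS.union ?_, ?_⟩, ?_, ?_⟩
  · refine le_trans ?_ (le_max_left _ _)
    obtain ⟨⟨h1, h2⟩, h3, h4⟩ := hK s hs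
    have hs0 : 0 < s := ha.trans hs.1
    have hc0 := hm.trans_le h1
    have hα0 := hm.trans_le h3
    rw [abs_div, abs_mul, abs_of_pos hα0, abs_of_pos (mul_pos hs0 hc0), div_eq_mul_inv]
    refine mul_le_mul (mul_le_mul h4 (hQ s hs) (abs_nonneg _) (hα0.le.trans h4))
      (inv_anti₀ (mul_pos ha hm) (mul_le_mul hs.1.le h1 hm.le hs0.le))
      (inv_nonneg.2 (mul_pos hs0 hc0).le)
      (mul_nonneg (hα0.le.trans h4) ((abs_nonneg _).trans (hQ s hs)))
  · refine le_trans ?_ (le_max_right _ _)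
    have hs0 : 0 < s := ha.trans hs.1
    rw [abs_div, abs_mul, abs_of_pos hs0, div_eq_mul_inv]
    exact mul_le_mul (mul_le_mul_of_nonneg_left (hW s hs) (abs_nonneg κ))
      (inv_anti₀ ha hs.1.le) (inv_nonneg.2 hs0.le)
      (mul_nonneg (abs_nonneg κ) ((abs_nonneg _).trans (hW s hs)))
  -- Exceptional points of the logarithmic equation pull back to a countable set because `T` is
  -- injective.
  · exact MapsTo.countable_of_injOn (f := T) (fun s hs => hs.2)
      (hTm.injOn.mono fun s hs => Ioo_subset_Icc_self hs.1) hU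
  · rintro s ⟨hs, hsU⟩
    rw [mem_union, not_or] at hsU
    have hTs := hd s ⟨hs, hsU.1⟩
    have hTU : T s ∉ U := fun h => hsU.2 ⟨hs, h⟩
    obtain ⟨h1, h2⟩ := hVd (T s) ⟨hmaps s hs, hTU⟩
    have hc0 := hm.trans_le (hK s hs).1.1
    have hs0 : 0 < s := ha.trans hs.1
    rw [← hcC s hs] at h1 h2
    constructor
    · refine ((h1.comp s hTs).mul_const x).congr_deriv ?_
      field_simp
    · refine ((h2.comp s hTs).mul_const x).congr_deriv ?_
      rw [hκ]
      field_simp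
  · intro s hs
    have hs0 : 0 < s := ha.trans hs.1
    have hc0 := hm.trans_le (hK s hs).1.1
    have hα0 := hm.trans_le (hK s hs).2.1
    field_simp
  · simp only [hTa, hV.flux_zero, zero_mul]

/-- Separated harmonic functions in the disk. -/
theorem isRadialMode_disk (k : ℤ) :
    IsRadialMode 0 2 k (fun _ => 1) (fun _ => 1) (fun s => (s / 2) ^ k.natAbs)
      (fun s => k.natAbs * (s / 2) ^ k.natAbs)
      (fun s => k.natAbs * (s / 2) ^ (k.natAbs - 1) * (1 / 2)) := by
  have hk2 : (k : ℝ) ^ 2 = (k.natAbs : ℝ) ^ 2 := by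
    rw [Nat.cast_natAbs, Int.cast_abs, sq_abs]
  -- At `k = 0` the truncated exponent `k.natAbs - 1` is harmless, as the factor `k.natAbs` is zero.
  have hpow : ∀ s : ℝ, 0 < s → (k.natAbs : ℝ) * (s / 2) ^ k.natAbs =
      s * (k.natAbs * (s / 2) ^ (k.natAbs - 1) * (1 / 2)) := by
    intro s hs
    rcases Nat.eq_zero_or_pos k.natAbs with h | h
    · simp [h]
    · obtain ⟨n, hn⟩ := Nat.exists_eq_succ_of_ne_zero h.ne'
      rw [hn, Nat.succ_sub_one, pow_succ]
      ring
  have hb : ∀ s ∈ Ioo (0 : ℝ) 2, |(k.natAbs : ℝ) * (s / 2) ^ (k.natAbs - 1) * (1 / 2)| ≤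
      k.natAbs := by
    intro s hs
    have h0 : 0 ≤ s / 2 := by linarith [hs.1]
    have h1 : (s / 2) ^ (k.natAbs - 1) ≤ 1 := pow_le_one₀ h0 (by linarith [hs.2])
    have h2 : 0 ≤ (s / 2) ^ (k.natAbs - 1) := pow_nonneg h0 _
    have h3 : (0 : ℝ) ≤ k.natAbs := Nat.cast_nonneg _
    rw [abs_of_nonneg (by positivity)]
    nlinarith
  have hder : ∀ s : ℝ, HasDerivAt (fun s : ℝ => (s / 2) ^ k.natAbs)
      (k.natAbs * (s / 2) ^ (k.natAbs - 1) * (1 / 2)) s := fun s =>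
    ((hasDerivAt_id s).div_const 2).pow k.natAbs
  refine ⟨by fun_prop, by fun_prop, by fun_prop, ⟨k.natAbs, fun s hs => ⟨hb s hs, ?_⟩⟩,
    ⟨∅, countable_empty, fun s hs => ⟨hder s, ?_⟩⟩, ?_, ?_⟩
  · have habs : |(k : ℝ)| = k.natAbs := by rw [Nat.cast_natAbs, Int.cast_abs]
    have h0 : 0 ≤ (s / 2) ^ k.natAbs := pow_nonneg (by linarith [hs.1]) _
    rw [abs_div, abs_mul, habs, abs_of_pos hs.1, abs_of_nonneg h0, hpow s hs.1,
      mul_div_cancel_left₀ _ hs.1.ne']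
    exact (le_abs_self _).trans (hb s hs)
  · refine ((hder s).const_mul _).congr_deriv ?_
    have h1 := hpow s hs.1.1
    have hs0 : s ≠ 0 := hs.1.1.ne'
    have h2 : (s / 2) ^ k.natAbs / s * k.natAbs =
        k.natAbs * (s / 2) ^ (k.natAbs - 1) * (1 / 2) := by
      rw [div_mul_eq_mul_div, mul_comm, h1, mul_div_cancel_left₀ _ hs0]
    rw [hk2, one_mul, one_mul, ← h2]
    ring
  · intro s hs
    rw [inv_one, one_mul, one_mul]
    exact (hpow s hs.1).symm
  · rcases Nat.eq_zero_or_pos k.natAbs with h | h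
    · simp [h]
    · simp [h.ne']

/-- Comparison of the flux in the exterior layer with the one of the homogeneous disk. -/
theorem abs_layer_ratio_sub_le {n : ℕ} {v p S ρ : ℝ} (hv : 0 < v) (hp : 0 ≤ p)
    (hpv : p ≤ n * S * v) (hρ : 0 < ρ) (hρ1 : ρ < 1) :
    0 < layerFun n 1 v p (Real.log 2) (Real.log (2 / ρ)) ∧
    |layerFlux n 1 v p (Real.log 2) (Real.log (2 / ρ)) /
      layerFun n 1 v p (Real.log 2) (Real.log (2 / ρ)) - n| ≤ 2 * (|n * v - p| / v) * ρ ^ (2 * n) := by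
  have e : (n : ℝ) * (Real.log (2 / ρ) - Real.log 2) = -(n * Real.log ρ) := by
    rw [Real.log_div two_ne_zero hρ.ne']
    ring
  have hx : Real.exp (n * Real.log ρ) = ρ ^ n := by
    rw [Real.exp_nat_mul, Real.exp_log hρ]
  have hc : Real.cosh (n * (Real.log (2 / ρ) - Real.log 2)) = ((ρ ^ n)⁻¹ + ρ ^ n) / 2 := by
    rw [e, Real.cosh_neg, Real.cosh_eq, Real.exp_neg, hx, add_comm]
  have hs : Real.sinh (n * (Real.log (2 / ρ) - Real.log 2)) = ((ρ ^ n)⁻¹ - ρ ^ n) / 2 := by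
    rw [e, Real.sinh_neg, Real.sinh_eq, Real.exp_neg, hx]
    ring
  rw [layerFun, layerFlux, hc, hs, pow_mul', mul_one]
  have hy : 0 < ρ ^ n := pow_pos hρ n
  have hy1 : ρ ^ n ≤ 1 := pow_le_one₀ hρ.le hρ1.le
  -- For `n = 0` the quotient `p / n` is `0` by convention, and the hypotheses force `p = 0`, so the
  -- identity persists.
  have hp0 : (n : ℝ) * (p / n) = p := by
    rcases Nat.eq_zero_or_pos n with rfl | hn
    · have : p ≤ 0 := by simpa using hpv
      simp [le_antisymm this hp]
    · field_simp
  have hpn : 0 ≤ p / n := by positivity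
  generalize (n : ℝ) = N at *
  generalize p / N = t at *
  generalize ρ ^ n = y at *
  have hiy : 1 ≤ y⁻¹ := (one_le_inv₀ hy).2 hy1
  -- The growing exponential alone bounds `V` from below, because `p` is nonnegative.
  have hV : v * (y⁻¹ / 2) ≤ v * ((y⁻¹ + y) / 2) + t * ((y⁻¹ - y) / 2) := by
    nlinarith [mul_nonneg hpn (by linarith : 0 ≤ (y⁻¹ - y) / 2), mul_pos hv hy]
  have hV0 : 0 < v * ((y⁻¹ + y) / 2) + t * ((y⁻¹ - y) / 2) := lt_of_lt_of_le (by positivity) hV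
  refine ⟨hV0, ?_⟩
  rw [div_sub' hV0.ne', abs_div, abs_of_pos hV0, div_le_iff₀ hV0]
  -- In `P - n V` the growing exponentials cancel: it equals `(p - n v) (cosh - sinh)`, and `cosh -
  -- sinh = ρ ^ n`. Division by `V` supplies the second factor `ρ ^ n`.
  have e1 : p * ((y⁻¹ + y) / 2) + N * v * ((y⁻¹ - y) / 2) -
      (v * ((y⁻¹ + y) / 2) + t * ((y⁻¹ - y) / 2)) * N = -(N * v - p) * y := by
    linear_combination (-((y⁻¹ - y) / 2)) * hp0
  rw [e1, abs_mul, abs_neg, abs_of_pos hy]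
  have h2 := mul_le_mul_of_nonneg_left hV
    (by positivity : 0 ≤ 2 * (|N * v - p| / v) * y ^ 2)
  refine le_trans (le_of_eq ?_) h2
  field_simp

section CoatedDisk

variable {L : ℕ} {r σ : ℕ → ℝ}

/-- The frequency `0` is separate because the layer solution divides by `n`; its mode is the
constant `1` without flux, as `isDtN_of_flux_le` requires. -/
theorem IsCoatedDisk.exists_logMode_all (h : IsCoatedDisk L r σ) {S : ℝ}
    (hS : ∀ j ≤ L, σ j ≤ S) (n : ℕ) :
    ∃ V P v p, (∀ T, IsLogMode n (fun τ => layeredProfile L r σ (Real.exp τ)) T V P) ∧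
      0 < v ∧ 0 ≤ p ∧ p ≤ n * S * v ∧ (∀ τ, Real.log 2 < τ →
        V τ = layerFun n 1 v p (Real.log 2) τ ∧ P τ = layerFlux n 1 v p (Real.log 2) τ) ∧
      (n = 0 → ∀ τ, V τ = 1) := by
  rcases Nat.eq_zero_or_pos n with rfl | hn
  · refine ⟨fun _ => 1, fun _ => 0, 1, 0, fun T => ⟨continuous_const, continuous_const, rfl,
      ∅, countable_empty, fun τ _ => ⟨?_, ?_⟩⟩, one_pos, le_rfl, by simp, fun τ _ => ⟨?_, ?_⟩,
      fun _ _ => rfl⟩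
    · simpa using hasDerivAt_const τ (1 : ℝ)
    · simpa using hasDerivAt_const τ (0 : ℝ)
    · simp [layerFun]
    · simp [layerFlux]
  · obtain ⟨V, P, v, p, h1, h2, h3, h4, h5⟩ := h.exists_logMode hS (Nat.cast_pos.2 hn)
    exact ⟨V, P, v, p, h1, h2, h3, h4, h5, fun h0 => absurd h0 hn.ne'⟩

end CoatedDisk

/-! ### The push-forward by the blow-up map -/

/-- The radial part of the inverse of the blow-up map, on `[1, 2]`. -/
def blowDown (ρ s : ℝ) : ℝ := max ρ (min ((3 - 2 * ρ) * s - (3 - 3 * ρ)) s)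

/-- The derivative of `blowDown`. -/
def blowDownSlope (ρ s : ℝ) : ℝ := if s < 3 / 2 then 3 - 2 * ρ else 1

/-- The anisotropy of the push-forward. -/
def blowDownRatio (ρ s : ℝ) : ℝ := s * blowDownSlope ρ s / blowDown ρ s

section BlowUp

variable {ρ : ℝ}

theorem continuous_blowDown : Continuous (blowDown ρ) := by
  unfold blowDown
  fun_prop

/-- This is why `blowDown` is cut off at `ρ`: `log (blowDown ρ s / ρ)` becomes continuous on the
whole line, as the change of variables in `IsLogMode.isRadialMode` demands. -/
theorem blowDown_pos (hρ : 0 < ρ) (s : ℝ) : 0 < blowDown ρ s := hρ.trans_le (le_max_left _ _)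

theorem blowDown_of_le (hρ1 : ρ < 1) {s : ℝ} (h1 : 1 ≤ s) (h2 : s ≤ 3 / 2) :
    blowDown ρ s = (3 - 2 * ρ) * s - (3 - 3 * ρ) := by
  rw [blowDown, min_eq_left (by nlinarith), max_eq_right (by nlinarith)]

theorem blowDown_of_ge (hρ1 : ρ < 1) {s : ℝ} (h : 3 / 2 ≤ s) : blowDown ρ s = s := by
  rw [blowDown, min_eq_right (by nlinarith), max_eq_right (by linarith)]

theorem blowDown_one (hρ1 : ρ < 1) : blowDown ρ 1 = ρ := by
  rw [blowDown_of_le hρ1 le_rfl (by norm_num)]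
  ring

theorem strictMonoOn_blowDown (hρ1 : ρ < 1) : StrictMonoOn (blowDown ρ) (Icc 1 2) := by
  intro s hs t ht hst
  rcases le_or_gt t (3 / 2) with h | h
  · rw [blowDown_of_le hρ1 hs.1 (hst.le.trans h), blowDown_of_le hρ1 ht.1 h]
    nlinarith
  · rw [blowDown_of_ge hρ1 h.le]
    rcases le_or_gt s (3 / 2) with h' | h'
    · rw [blowDown_of_le hρ1 hs.1 h']
      nlinarith
    · rwa [blowDown_of_ge hρ1 h'.le]

theorem hasDerivAt_blowDown (hρ1 : ρ < 1) {s : ℝ} (h1 : 1 < s) (h : s ≠ 3 / 2) :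
    HasDerivAt (blowDown ρ) (blowDownSlope ρ s) s := by
  rcases lt_or_gt_of_ne h with hlt | hgt
  · rw [blowDownSlope, if_pos hlt]
    have h2 : HasDerivAt (fun s : ℝ => (3 - 2 * ρ) * s - (3 - 3 * ρ)) (3 - 2 * ρ) s := by
      simpa using ((hasDerivAt_id s).const_mul (3 - 2 * ρ)).sub_const (3 - 3 * ρ)
    refine h2.congr_of_eventuallyEq ?_
    filter_upwards [Ioo_mem_nhds h1 hlt] with t ht
    exact blowDown_of_le hρ1 ht.1.le ht.2.le
  · rw [blowDownSlope, if_neg (not_lt.2 hgt.le)]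
    refine (hasDerivAt_id s).congr_of_eventuallyEq ?_
    filter_upwards [Ioi_mem_nhds hgt] with t ht
    exact blowDown_of_ge hρ1 (le_of_lt ht)

theorem measurable_blowDownRatio : Measurable (blowDownRatio ρ) :=
  (measurable_id.mul (Measurable.ite measurableSet_Iio measurable_const measurable_const)).div
    continuous_blowDown.measurable

/-- Here `s < 2`, the slope lies in `[1, 3]` and `blowDown` in `[ρ, 2]`. The bound degenerates as `ρ
→ 0`, but it enters only the existence of solutions and not the final constant. -/
theorem blowDownRatio_bounds (hρ : 0 < ρ) (hρ1 : ρ < 1) {s : ℝ} (hs : s ∈ Ioo 1 2) :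
    1 / 2 ≤ blowDownRatio ρ s ∧ blowDownRatio ρ s ≤ 6 / ρ := by
  have h1 : 1 ≤ blowDownSlope ρ s ∧ blowDownSlope ρ s ≤ 3 := by
    unfold blowDownSlope
    split_ifs <;> constructor <;> linarith
  have h2 : ρ ≤ blowDown ρ s := le_max_left _ _
  have h3 : blowDown ρ s ≤ 2 := max_le (by linarith) ((min_le_right _ _).trans hs.2.le)
  have h4 := blowDown_pos hρ s
  have hs1 := hs.1
  have hs2 := hs.2
  unfold blowDownRatio
  constructor
  · rw [div_le_div_iff₀ two_pos h4]
    nlinarith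
  · rw [div_le_div_iff₀ h4 hρ]
    have : s * blowDownSlope ρ s ≤ 6 := by nlinarith
    nlinarith

/-- The conductivity matrix in terms of the singular values of a symmetric Jacobian matrix. -/
theorem pushForward_matrix {q₀ q₁ e d s : ℝ} (hq : q₀ ^ 2 + q₁ ^ 2 = 1) (he : 0 < e) (hd : 0 < d)
    {J : Matrix (Fin 2) (Fin 2) ℝ}
    (hJ : J = !![e - (e - d) * q₀ ^ 2, -(e - d) * (q₀ * q₁);
      -(e - d) * (q₀ * q₁), e - (e - d) * q₁ ^ 2]) :
    |J.det|⁻¹ • (J * (s • (1 : Matrix (Fin 2) (Fin 2) ℝ)) * Jᵀ) =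
      !![s * ((e / d)⁻¹ * (q₀ * q₀) + e / d * (q₁ * q₁)),
        s * ((e / d)⁻¹ * (q₀ * q₁) + e / d * (-q₁ * q₀));
        s * ((e / d)⁻¹ * (q₁ * q₀) + e / d * (q₀ * -q₁)),
        s * ((e / d)⁻¹ * (q₁ * q₁) + e / d * (q₀ * q₀))] := by
  have hdet : J.det = e * d := by
    rw [hJ, Matrix.det_fin_two_of]
    linear_combination (e * d - e ^ 2) * hq
  rw [hdet, abs_of_pos (mul_pos he hd)]
  have hq' : q₁ ^ 2 = 1 - q₀ ^ 2 := by linarith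
  have hq4 : q₁ ^ 4 = (1 - q₀ ^ 2) ^ 2 := by rw [← hq']; ring
  have hq3 : q₁ ^ 3 = q₁ * (1 - q₀ ^ 2) := by rw [← hq']; ring
  have hJT : Jᵀ = J := by
    rw [hJ]
    ext i j
    fin_cases i <;> fin_cases j <;> rfl
  rw [hJT, mul_smul_comm, mul_one, smul_mul_assoc, hJ, Matrix.mul_fin_two]
  ext i j
  fin_cases i <;> fin_cases j <;> simp <;> field_simp <;> ring_nf <;>
    simp only [hq', hq3, hq4] <;> ring

end BlowUp

/-! ### Jacobians of radial maps and preimages under the blow-up. -/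

section PushForward

variable {ρ : ℝ}

theorem radField_smul {t : ℝ} (ht : 0 < t) (i : Fin 2) (x : Plane) :
    radField i (t • x) = radField i x := by
  rw [radField, radField, norm_smul, Real.norm_of_nonneg ht.le, PiLp.smul_apply, smul_eq_mul,
    mul_div_mul_left _ _ ht.ne']

theorem hasFDerivAt_norm {x : Plane} (hx : x ≠ 0) :
    HasFDerivAt (fun z : Plane => ‖z‖) (‖x‖⁻¹ • innerSL ℝ x) x := by
  have hn : ‖x‖ ^ 2 ≠ 0 := pow_ne_zero 2 (norm_ne_zero_iff.2 hx)
  have h := ((hasStrictFDerivAt_norm_sq x).hasFDerivAt).sqrt hn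
  simp only [Real.sqrt_sq (norm_nonneg _)] at h
  refine h.congr_fderiv ?_
  ext v
  simp only [_root_.smul_apply, smul_eq_mul, nsmul_eq_mul, Nat.cast_ofNat]
  have : ‖x‖ ≠ 0 := norm_ne_zero_iff.2 hx
  field_simp

/-- The Jacobian matrix of a radial map `x ↦ (c + d|x|) x / |x|`. -/
theorem jacobian_radial {F : Plane → Plane} {c d : ℝ} {x : Plane} (hx : x ≠ 0)
    (hF : F =ᶠ[𝓝 x] fun z => ((c + d * ‖z‖) * ‖z‖⁻¹) • z) :
    jacobian F x =
      !![(c + d * ‖x‖) / ‖x‖ - ((c + d * ‖x‖) / ‖x‖ - d) * radField 0 x ^ 2,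
        -((c + d * ‖x‖) / ‖x‖ - d) * (radField 0 x * radField 1 x);
        -((c + d * ‖x‖) / ‖x‖ - d) * (radField 0 x * radField 1 x),
        (c + d * ‖x‖) / ‖x‖ - ((c + d * ‖x‖) / ‖x‖ - d) * radField 1 x ^ 2] := by
  have hn : ‖x‖ ≠ 0 := norm_ne_zero_iff.2 hx
  have h1 := hasFDerivAt_norm hx
  have h2 : HasFDerivAt (fun z : Plane => (c + d * ‖z‖) * ‖z‖⁻¹)
      ((-c / ‖x‖ ^ 2) • (‖x‖⁻¹ • innerSL ℝ x)) x := by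
    have h3 : HasDerivAt (fun t : ℝ => (c + d * t) * t⁻¹) (-c / ‖x‖ ^ 2) ‖x‖ := by
      refine ((((hasDerivAt_id ‖x‖).const_mul d).const_add c).mul
        (hasDerivAt_inv hn)).congr_deriv ?_
      simp only [id]
      field_simp
      ring
    exact h3.comp_hasFDerivAt x h1
  have h4 := (h2.smul (hasFDerivAt_id x)).congr_of_eventuallyEq hF
  ext i j
  rw [jacobian, Matrix.of_apply, h4.fderiv]
  fin_cases i <;> fin_cases j <;>
    simp [radField, EuclideanSpace.inner_single_right] <;> field_simp <;> ring

/-- The points that the blow-up map sends to the shell `1 < |y| < 2`. -/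
theorem blowUp_preimage (hρ : 0 < ρ) (hρ1 : ρ < 1) {x y : Plane} (hxy : blowUp ρ x = y)
    (hy : y ∈ annulus 1 2) (hy3 : ‖y‖ ≠ 3 / 2) :
    blowDown ρ ‖y‖ = ‖x‖ ∧ (∀ i, radField i x = radField i y) ∧ x ≠ 0 ∧
    ∃ c : ℝ, ‖y‖ = c + (blowDownSlope ρ ‖y‖)⁻¹ * ‖x‖ ∧
      blowUp ρ =ᶠ[𝓝 x] fun z => ((c + (blowDownSlope ρ ‖y‖)⁻¹ * ‖z‖) * ‖z‖⁻¹) • z := by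
  have h32 : 0 < 3 - 2 * ρ := by linarith
  rcases le_or_gt ‖x‖ ρ with h1 | h1
  -- This branch maps into the closed unit disk, so it cannot reach `y`.
  · rw [blowUp, if_pos h1] at hxy
    have h2 : ‖y‖ ≤ 1 := by
      rw [← hxy, norm_smul, Real.norm_of_nonneg (inv_nonneg.2 hρ.le), inv_mul_le_iff₀ hρ]
      linarith
    exact absurd hy.1 (not_lt.2 h2)
  have hx0 : 0 < ‖x‖ := hρ.trans h1
  have hx : x ≠ 0 := norm_pos_iff.1 hx0
  rcases le_or_gt ‖x‖ (3 / 2) with h2 | h2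
  · have hpos : 0 < (3 - 3 * ρ) / (3 - 2 * ρ) + 1 / (3 - 2 * ρ) * ‖x‖ := by
      have : 0 < 3 - 3 * ρ := by linarith
      positivity
    have hxy' := hxy
    rw [blowUp, if_neg (not_le_of_gt h1), if_pos h2] at hxy'
    have hny : ‖y‖ = (3 - 3 * ρ) / (3 - 2 * ρ) + 1 / (3 - 2 * ρ) * ‖x‖ := by
      rw [← hxy', norm_smul, Real.norm_of_nonneg (by positivity), mul_assoc,
        inv_mul_cancel₀ hx0.ne', mul_one]
    have hnx : ‖x‖ = (3 - 2 * ρ) * ‖y‖ - (3 - 3 * ρ) := by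
      rw [hny]
      field_simp
      ring
    have hylt : ‖y‖ < 3 / 2 := lt_of_le_of_ne (by nlinarith) hy3
    have hxlt : ‖x‖ < 3 / 2 := by nlinarith
    have hslope : blowDownSlope ρ ‖y‖ = 3 - 2 * ρ := if_pos hylt
    refine ⟨by rw [blowDown_of_le hρ1 hy.1.le hylt.le, hnx], fun i => ?_, hx,
      (3 - 3 * ρ) / (3 - 2 * ρ), ?_, ?_⟩
    · rw [← hxy', radField_smul (by positivity)]
    · rw [hslope, hny, one_div]
    · filter_upwards [continuous_norm.continuousAt.eventually (Ioo_mem_nhds h1 hxlt)] with z hz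
      rw [blowUp, if_neg (not_le_of_gt hz.1), if_pos hz.2.le, hslope, one_div]
  · have hxy' : x = y := by
      rwa [blowUp, if_neg (not_le_of_gt h1), if_neg (not_le_of_gt h2)] at hxy
    have hslope : blowDownSlope ρ ‖y‖ = 1 := if_neg (not_lt.2 (hxy' ▸ h2.le))
    refine ⟨by rw [← hxy', blowDown_of_ge hρ1 h2.le], fun i => by rw [hxy'], hx, 0, ?_, ?_⟩
    · rw [hslope, hxy']
      ring
    · filter_upwards [continuous_norm.continuousAt.eventually (Ioi_mem_nhds h2)] with z hz
      have hz' : 3 / 2 < ‖z‖ := hz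
      have hz0 : ‖z‖ ≠ 0 := by linarith
      rw [blowUp, if_neg (by linarith), if_neg (not_le_of_gt hz'), hslope, inv_one, one_mul,
        zero_add, mul_inv_cancel₀ hz0, one_smul]

/-- `Function.invFun` returns a preimage only at points of the range. Existence is enough here,
without injectivity, because `blowUp_preimage` describes every preimage. -/
theorem exists_blowUp_eq (hρ : 0 < ρ) (hρ1 : ρ < 1) {y : Plane} (hy : 1 < ‖y‖) :
    ∃ x, blowUp ρ x = y := by
  have hy0 : 0 < ‖y‖ := one_pos.trans hy
  rcases le_or_gt ‖y‖ (3 / 2) with h | h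
  · have h32 : 0 < 3 - 2 * ρ := by linarith
    have ht : ρ < (3 - 2 * ρ) * ‖y‖ - (3 - 3 * ρ) := by nlinarith
    refine ⟨(((3 - 2 * ρ) * ‖y‖ - (3 - 3 * ρ)) / ‖y‖) • y, ?_⟩
    have hn : ‖(((3 - 2 * ρ) * ‖y‖ - (3 - 3 * ρ)) / ‖y‖) • y‖ =
        (3 - 2 * ρ) * ‖y‖ - (3 - 3 * ρ) := by
      rw [norm_smul, Real.norm_of_nonneg (div_nonneg (hρ.trans ht).le hy0.le),
        div_mul_cancel₀ _ hy0.ne']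
    have ht0 := (hρ.trans ht).ne'
    rw [blowUp, hn, if_neg (not_le_of_gt ht), if_pos (by nlinarith), smul_smul]
    have e : (3 - 3 * ρ) / (3 - 2 * ρ) + 1 / (3 - 2 * ρ) * ((3 - 2 * ρ) * ‖y‖ - (3 - 3 * ρ)) =
        ‖y‖ := by
      rw [one_div_mul_eq_div, ← add_div, div_eq_iff h32.ne']
      ring
    rw [e, mul_assoc, ← mul_div_assoc, inv_mul_cancel₀ ht0, mul_one_div_cancel hy0.ne', one_smul]
  · exact ⟨y, by rw [blowUp, if_neg (by linarith), if_neg (not_le_of_gt h)]⟩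

/-- The push-forward of a radial conductivity by the blow-up map. -/
theorem pushForward_blowUp (hρ : 0 < ρ) (hρ1 : ρ < 1) {s : Plane → ℝ} {f : ℝ → ℝ}
    (hs : ∀ x, s x = f ‖x‖) {y : Plane} (hy : y ∈ annulus 1 2) (hy3 : ‖y‖ ≠ 3 / 2) :
    pushForward (blowUp ρ) s y =
      polarTensor (fun t => f (blowDown ρ t)) (blowDownRatio ρ) y := by
  have hxy : blowUp ρ (Function.invFun (blowUp ρ) y) = y :=
    Function.invFun_eq (exists_blowUp_eq hρ hρ1 hy.1)
  rw [pushForward]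
  generalize Function.invFun (blowUp ρ) y = x at hxy ⊢
  obtain ⟨hbd, hrad, hx, c, hc, hF⟩ := blowUp_preimage hρ hρ1 hxy hy hy3
  have hx0 : 0 < ‖x‖ := norm_pos_iff.2 hx
  have hy0 : 0 < ‖y‖ := one_pos.trans hy.1
  have hsl : 0 < blowDownSlope ρ ‖y‖ := by
    unfold blowDownSlope
    split_ifs <;> linarith
  have hJ := jacobian_radial hx hF
  rw [← hc] at hJ
  -- The tangential stretch is `|y| / |x|` and the radial one is the inverse slope of `blowDown`;
  -- their quotient is `blowDownRatio`.
  have key := pushForward_matrix (radField_sq_add x hx) (div_pos hy0 hx0) (inv_pos.2 hsl)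
    (s := s x) hJ
  simp only [isotropic]
  rw [key, hs x, ← hbd]
  simp only [hrad]
  have hα : ‖y‖ / blowDown ρ ‖y‖ / (blowDownSlope ρ ‖y‖)⁻¹ = blowDownRatio ρ ‖y‖ := by
    rw [blowDownRatio, div_inv_eq_mul, div_mul_eq_mul_div]
  rw [hα]
  ext i j
  fin_cases i <;> fin_cases j <;> simp [polarTensor, tanField_zero, tanField_one]

end PushForward

/-! ### Vanishing generalized polarization tensors -/

theorem isotropic_eq_polarTensor {s : Plane → ℝ} {c : ℝ → ℝ} (hs : ∀ x, s x = c ‖x‖) {x : Plane}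
    (hx : x ≠ 0) : isotropic s x = polarTensor c (fun _ => 1) x := by
  have h := radField_sq_add x hx
  ext i j
  fin_cases i <;> fin_cases j <;>
    simp [isotropic, polarTensor, tanField_zero, tanField_one, hs]
  · linear_combination (-c ‖x‖) * h
  · right; ring
  · right; ring
  · linear_combination (-c ‖x‖) * h

/-- All terms on the left are of order `x ^ (n + 1)` at `x = 2^{-j}`, so dividing by `x ^ n` leaves
`|B| ≤ const * x → 0`. Points of a single sequence suffice, which suits an expansion known only
almost everywhere. -/
theorem eq_zero_of_forall_hasSum {a : ℕ → ℝ} {B : ℝ} {n : ℕ}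
    (h : ∀ j : ℕ, HasSum (fun k => a k * ((1 / 2 : ℝ) ^ j) ^ (k + 1)) (B * ((1 / 2 : ℝ) ^ j) ^ n))
    (ha : ∀ k, k + 1 ≤ n → a k = 0) : B = 0 := by
  have hs : Summable fun k => |a k| := by
    have := (h 0).summable.abs
    simpa using this
  have hle : ∀ j : ℕ, |B| ≤ (∑' k, |a k|) * (1 / 2 : ℝ) ^ j := by
    intro j
    set x : ℝ := (1 / 2 : ℝ) ^ j with hx
    have hx0 : 0 < x := by positivity
    have hx1 : x ≤ 1 := pow_le_one₀ (by norm_num) (by norm_num)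
    have hb : ∀ k, ‖a k * x ^ (k + 1)‖ ≤ x ^ (n + 1) * |a k| := by
      intro k
      rw [norm_mul, Real.norm_eq_abs, Real.norm_of_nonneg (by positivity), mul_comm]
      rcases le_or_gt (k + 1) n with hk | hk
      · simp [ha k hk]
      · exact mul_le_mul_of_nonneg_right (pow_le_pow_of_le_one hx0.le hx1 hk) (abs_nonneg _)
    have h1 := tsum_of_norm_bounded (hs.hasSum.mul_left (x ^ (n + 1))) hb
    rw [(h j).tsum_eq, norm_mul, Real.norm_eq_abs, Real.norm_of_nonneg (by positivity)] at h1
    have h2 : 0 < x ^ n := by positivity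
    refine le_of_mul_le_mul_right (h1.trans_eq ?_) h2
    ring
  have hlim : Tendsto (fun j : ℕ => (∑' k, |a k|) * (1 / 2 : ℝ) ^ j) atTop (𝓝 0) := by
    simpa using (tendsto_pow_atTop_nhds_zero_of_lt_one (by norm_num : (0 : ℝ) ≤ 1 / 2)
      (by norm_num)).const_mul (∑' k, |a k|)
  have := ge_of_tendsto' hlim hle
  exact abs_nonpos_iff.1 this

theorem angle_smul {t : ℝ} (ht : 0 < t) (x : Plane) : angle (t • x) = angle x := by
  rw [angle, angle]
  refine Eq.trans ?_ (Complex.arg_real_mul _ ht)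
  congr 1
  apply Complex.ext <;> simp

theorem ae_smul {Q : Plane → Prop} (h : ∀ᵐ x : Plane, Q x) {t : ℝ} (ht : t ≠ 0) :
    ∀ᵐ x : Plane, Q (t • x) := by
  rw [ae_iff] at h ⊢
  have := Measure.addHaar_preimage_smul (volume : Measure Plane) ht {x | ¬ Q x}
  rw [h, mul_zero] at this
  exact this

/-- A multipole expansion without terms of order up to `n` cannot represent a multipole of
order `n`. -/
theorem multipole_eq_zero {n : ℕ} {B : ℝ} {w : Plane → ℝ} {c d : ℕ → ℝ}
    (hw : ∀ x : Plane, 2 < ‖x‖ → w x = B * (‖x‖ ^ n)⁻¹ * Real.cos (n * angle x))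
    (h : HasMultipoleExpansion w c d) (hcd : ∀ m, 1 ≤ m → m ≤ n → c m = 0 ∧ d m = 0) : B = 0 := by
  -- Countably many dilations preserve "almost everywhere", so for almost every `x` the expansion is
  -- available at all the points `2 ^ j • x` with norm above `2`.
  have hae : ∀ᵐ x : Plane, ∀ j : ℕ, 2 < ‖(2 : ℝ) ^ j • x‖ → HasSum (fun k : ℕ =>
      -(Real.cos ((k + 1 : ℕ) * angle ((2 : ℝ) ^ j • x)) /
        (2 * π * (k + 1 : ℕ) * ‖(2 : ℝ) ^ j • x‖ ^ (k + 1)) * c (k + 1))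
      - (Real.sin ((k + 1 : ℕ) * angle ((2 : ℝ) ^ j • x)) /
        (2 * π * (k + 1 : ℕ) * ‖(2 : ℝ) ^ j • x‖ ^ (k + 1)) * d (k + 1))) (w ((2 : ℝ) ^ j • x)) :=
    ae_all_iff.2 fun j => ae_smul h (by positivity)
  have hopen : ∀ᶠ x in 𝓝 (polarPt 3 0), 2 < ‖x‖ ∧ Real.cos (n * angle x) ≠ 0 := by
    have h1 : ContinuousAt angle (polarPt 3 0) := by
      have h2 : Continuous fun x : Plane => (⟨x 0, x 1⟩ : ℂ) := by
        have : (fun x : Plane => (⟨x 0, x 1⟩ : ℂ)) = fun x => (x 0 : ℂ) + (x 1 : ℂ) * Complex.I := by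
          ext x; exact Complex.mk_eq_add_mul_I _ _
        rw [this]
        fun_prop
      refine ContinuousAt.comp (f := fun x : Plane => (⟨x 0, x 1⟩ : ℂ))
        (Complex.continuousAt_arg ?_) h2.continuousAt
      simp [Complex.mem_slitPlane_iff, polarPt]
    have h2 : ContinuousAt (fun x => Real.cos (n * angle x)) (polarPt 3 0) :=
      Real.continuous_cos.continuousAt.comp (continuousAt_const.mul h1)
    refine (continuous_norm.continuousAt.eventually (lt_mem_nhds ?_)).and (h2.eventually_ne ?_)
    · exact (by norm_num : (2 : ℝ) < 3).trans_eq (norm_polarPt (by norm_num) 0).symm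
    · rw [angle_polarPt (by norm_num) ⟨by linarith [Real.pi_pos], Real.pi_pos.le⟩]
      simp
  -- A set of full measure is dense, so it meets the neighbourhood of the ray `θ = 0` on which `cos
  -- nθ` does not vanish.
  obtain ⟨x, hx, hx2, hcos⟩ := (Measure.dense_of_ae hae).inter_nhds_nonempty hopen
  have hx0 : 0 < ‖x‖ := by linarith
  have key := eq_zero_of_forall_hasSum (n := n) (B := B * (‖x‖ ^ n)⁻¹ * Real.cos (n * angle x))
    (a := fun k : ℕ => -(Real.cos ((k + 1 : ℕ) * angle x) /
        (2 * π * (k + 1 : ℕ) * ‖x‖ ^ (k + 1)) * c (k + 1))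
      - (Real.sin ((k + 1 : ℕ) * angle x) /
        (2 * π * (k + 1 : ℕ) * ‖x‖ ^ (k + 1)) * d (k + 1))) (fun j => ?_) (fun k hk => ?_)
  · have h2 : (‖x‖ ^ n)⁻¹ ≠ 0 := by positivity
    simpa [h2, hcos] using key
  · have hj : (0 : ℝ) < 2 ^ j := by positivity
    have hj1 : (1 : ℝ) ≤ 2 ^ j := one_le_pow₀ one_le_two
    have hn : ‖(2 : ℝ) ^ j • x‖ = 2 ^ j * ‖x‖ := by
      rw [norm_smul, Real.norm_of_nonneg hj.le]
    have hlt : 2 < ‖(2 : ℝ) ^ j • x‖ := by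
      rw [hn]
      nlinarith
    have h3 := hx j hlt
    rw [hw _ hlt] at h3
    simp only [angle_smul hj, hn] at h3
    have e : ((1 : ℝ) / 2) ^ j = (2 ^ j)⁻¹ := by rw [one_div, inv_pow]
    rw [e]
    have e2 : B * (‖x‖ ^ n)⁻¹ * Real.cos (n * angle x) * ((2 ^ j)⁻¹) ^ n =
        B * ((2 ^ j * ‖x‖) ^ n)⁻¹ * Real.cos (n * angle x) := by
      rw [mul_pow, mul_inv, inv_pow]
      ring
    rw [e2]
    refine h3.congr_fun fun k => ?_
    rw [mul_pow, inv_pow]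
    field_simp
  · obtain ⟨h1, h2⟩ := hcd (k + 1) (by omega) hk
    simp only [h1, h2]
    ring

theorem re_integral_mul {U : Set Plane} {B : Plane → ℝ} {F : Plane → ℂ}
    (h : IntegrableOn (fun x => (B x : ℂ) * F x) U) :
    ∫ x in U, B x * (F x).re = (∫ x in U, (B x : ℂ) * F x).re := by
  have := Complex.reCLM.integral_comp_comm h
  simpa using this

theorem re_modeFun_sub_harmCos {n : ℕ} {w : ℝ → ℝ} {B : ℝ} {x : Plane}
    (hw : w ‖x‖ = ‖x‖ ^ n + B * (‖x‖ ^ n)⁻¹) :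
    (modeFun n w x).re - harmCos n x = B * (‖x‖ ^ n)⁻¹ * Real.cos (n * angle x) := by
  have hre : (modeFun n w x).re = w ‖x‖ * Real.cos (n * angle x) := by
    rw [modeFun, Complex.re_ofReal_mul, expAngle]
    have := Complex.exp_ofReal_mul_I_re (n * angle x)
    push_cast at this ⊢
    rw [this]
  rw [hre, hw, harmCos]
  ring

/-! ### The transmission problem for a single mode. -/

section Transmission

variable {L : ℕ} {r σ : ℕ → ℝ}

/-- The radial coordinate `log s`, extended by `0` to `s ≤ 1`. -/
def logRadius (s : ℝ) : ℝ := Real.log (max s 1)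

theorem logRadius_of_one_le {s : ℝ} (hs : 1 ≤ s) : logRadius s = Real.log s := by
  rw [logRadius, max_eq_left hs]

theorem IsCoatedDisk.isCoefficient_profile (h : IsCoatedDisk L r σ) (b : ℝ) :
    IsCoefficient 1 b (layeredProfile L r σ) (fun _ => 1) := by
  obtain ⟨m, S, hm, hS⟩ := h.exists_bounds
  refine ⟨measurable_layeredProfile, measurable_const, min m 1, max S 1, lt_min hm one_pos,
    fun s hs => ⟨?_, min_le_right _ _, le_max_right _ _⟩⟩
  obtain ⟨j, hj, e⟩ := h.exists_profile_eq hs.1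
  rw [e]
  exact ⟨(min_le_left _ _).trans (hS j hj).1, (hS j hj).2.trans (le_max_left _ _)⟩

theorem IsCoatedDisk.isRadialMode_exterior (h : IsCoatedDisk L r σ) {n b x : ℝ} {V P : ℝ → ℝ}
    (hb : 1 < b)
    (hV : ∀ T, IsLogMode n (fun τ => layeredProfile L r σ (Real.exp τ)) T V P) :
    IsRadialMode 1 b n (layeredProfile L r σ) (fun _ => 1) (fun s => V (logRadius s) * x)
      (fun s => P (logRadius s) * x)
      (fun s => 1 * (P (logRadius s) * x) / (s * layeredProfile L r σ s)) := by
  refine (hV (logRadius b)).isRadialMode (T := logRadius) one_pos hb (h.isCoefficient_profile b)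
    rfl ?_ (by simp [logRadius]) ?_ countable_empty ?_ ?_
  · exact (continuous_id.max continuous_const).log fun s => (by positivity : 0 < max s 1).ne'
  · intro s hs t ht hst
    rw [logRadius_of_one_le hs.1, logRadius_of_one_le ht.1]
    exact Real.log_lt_log (one_pos.trans_le hs.1) hst
  · intro s hs
    rw [one_div]
    refine (Real.hasDerivAt_log (one_pos.trans hs.1.1).ne').congr_of_eventuallyEq ?_
    filter_upwards [Ioi_mem_nhds hs.1.1] with t ht
    exact logRadius_of_one_le (le_of_lt ht)
  · intro s hs
    rw [logRadius_of_one_le hs.1.le, Real.exp_log (one_pos.trans hs.1)]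

theorem exists_radius_of_isTest {φ : Plane → ℝ} (hφ : IsTest φ) :
    ∃ b, 1 < b ∧ tsupport φ ⊆ Metric.ball 0 b := by
  obtain ⟨b, hb⟩ := hφ.compact.isBounded.subset_ball 0
  exact ⟨max b 2, by simp, hb.trans (Metric.ball_subset_ball (le_max_left _ _))⟩

theorem pd_eq_zero {φ : Plane → ℝ} {U : Set Plane} (h : tsupport φ ⊆ U) {x : Plane} (hx : x ∉ U)
    (i : Fin 2) : pd i φ x = 0 := by
  have : fderiv ℝ φ x = 0 :=
    image_eq_zero_of_notMem_tsupport fun hx' => hx (h (tsupport_fderiv_subset ℝ hx'))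
  rw [pd, this]
  rfl

theorem setIntegral_exterior {b : ℝ} {F : Plane → ℝ}
    (hF : ∀ x, x ∉ Metric.ball (0 : Plane) b → F x = 0) :
    ∫ x in exterior, F x = ∫ x in annulus 1 b, F x := by
  refine setIntegral_eq_of_subset_of_forall_sdiff_eq_zero ?_ (fun x hx => hx.1) ?_
  · exact measurableSet_lt measurable_const measurable_norm
  · rintro x ⟨hx, hx'⟩
    refine hF x fun hxb => hx' ⟨hx, ?_⟩
    simpa using hxb

/-- A separated solution of the transmission problem. -/
theorem IsCoatedDisk.isTransmissionSolution (h : IsCoatedDisk L r σ) {n : ℕ} (hn : 1 ≤ n)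
    {V P : ℝ → ℝ} (hV : ∀ T, IsLogMode n (fun τ => layeredProfile L r σ (Real.exp τ)) T V P)
    {x₀ B : ℝ} (hVB : ∀ s, 2 < s → V (Real.log s) * x₀ = s ^ n + B * (s ^ n)⁻¹) :
    IsTransmissionSolution (layered L r σ) (harmCos n)
      (fun x => (modeFun n (fun s => V (logRadius s) * x₀) x).re) := by
  set w : ℝ → ℝ := fun s => V (logRadius s) * x₀ with hw
  set dw : ℝ → ℝ := fun s => 1 * (P (logRadius s) * x₀) / (s * layeredProfile L r σ s) with hdw
  have hm : ∀ b, 1 < b → IsRadialMode 1 b (n : ℤ) (layeredProfile L r σ) (fun _ => 1) w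
      (fun s => P (logRadius s) * x₀) dw := fun b hb => by
    have := h.isRadialMode_exterior (x := x₀) hb hV
    exact_mod_cast this
  have hu : ∀ b, MemLp (modeFun n w) 2 (volume.restrict (annulus 1 b)) := by
    intro b
    obtain ⟨C, hC⟩ := exists_bound_of_continuous (hm 2 one_lt_two).continuous_fun 1 b
    exact memLp_modeFun n (hm 2 one_lt_two).continuous_fun.measurable hC 2
  have hRT : ∀ b, MemLp (modeFun n dw) 2 (volume.restrict (annulus 1 b)) ∧
      MemLp (modeTan n w) 2 (volume.restrict (annulus 1 b)) := by
    intro b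
    -- The maximum covers the radii `b ≤ 1`, for which the annulus is empty but `hm` is not
    -- available.
    obtain ⟨C, hC⟩ := (hm (max b 2) (by simp)).bound
    have hlt : ∀ s ∈ Ioo 1 b, s ∈ Ioo 1 (max b 2) := fun s hs =>
      ⟨hs.1, hs.2.trans_le (le_max_left _ _)⟩
    refine ⟨memLp_modeFun n (hm 2 one_lt_two).measurable_deriv
      (fun s hs => (hC s (hlt s hs)).1) 2, ?_⟩
    exact (memLp_modeFun n (((hm 2 one_lt_two).continuous_fun.measurable.const_mul _).div
      measurable_id) (fun s hs => (hC s (hlt s hs)).2) 2).const_mul Complex.I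
  have hG := fun b => MemLp.polarVector (hRT b).1 (hRT b).2
  refine ⟨⟨fun x i => (polarVector (modeFun n dw) (modeTan n w) x i).re, fun b => ?_, ?_, ?_⟩, ?_⟩
  · have e : exterior ∩ Metric.ball 0 b = annulus 1 b := by
      ext x
      simp [exterior, annulus]
    rw [e]
    exact ⟨(hu b).re, memLp_pi_iff.2 fun i => (memLp_pi_iff.1 (hG b) i).re⟩
  · intro φ hφ hsupp i
    obtain ⟨b, hb, hbs⟩ := exists_radius_of_isTest hφ
    -- The compact support of `φ` turns integrals over the exterior into integrals over an annulus,
    -- where the identities for modes apply.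
    rw [setIntegral_exterior (b := b) fun x hx => by simp [pd_eq_zero hbs hx],
      setIntegral_exterior (b := b) fun x hx => by simp [IsTest.apply_eq_zero hbs hx]]
    have hb1 := memLp_top_annulus_of_continuous (a := 1) (b := b) (hφ.continuous_pd i)
    have hb0 := memLp_top_annulus_of_continuous (a := 1) (b := b) hφ.differentiable.continuous
    have i1 := ((hu b).mul' (r := 2) hb1).integrable one_le_two
    have i2 := ((memLp_pi_iff.1 (hG b) i).mul' (r := 2) hb0).integrable one_le_two
    have hg := (hm b hb).integral_green zero_le_one hb.le hφ i
    have z1 : ∀ θ, φ (polarPt 1 θ) = 0 := fun θ =>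
      IsTest.apply_eq_zero hsupp (by simp [exterior, norm_polarPt zero_le_one])
    have z2 : ∀ θ, φ (polarPt b θ) = 0 := fun θ =>
      IsTest.apply_eq_zero hbs (by simp [norm_polarPt (zero_le_one.trans hb.le)])
    simp only [z1, z2, Complex.ofReal_zero, mul_zero, sub_zero, zero_mul, integral_zero] at hg
    rw [integral_add i1 i2] at hg
    simp only [smul_eq_mul]
    rw [re_integral_mul i1, re_integral_mul i2, eq_neg_of_add_eq_zero_left hg, Complex.neg_re]
  · intro φ hφ
    obtain ⟨b, hb, hbs⟩ := exists_radius_of_isTest hφ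
    have hf := (hm b hb).integral_flux (h.isCoefficient_profile b) zero_le_one hb.le hφ
    have z2 : ∀ θ, φ (polarPt b θ) = 0 := fun θ =>
      IsTest.apply_eq_zero hbs (by simp [norm_polarPt (zero_le_one.trans hb.le)])
    simp only [z2, Complex.ofReal_zero, mul_zero, zero_mul, integral_zero] at hf
    rw [fluxForm, setIntegral_exterior (b := b) fun x hx => by simp [pd_eq_zero hbs hx]]
    obtain ⟨hb2, hb3⟩ := (h.isCoefficient_profile b).memLp_top hφ
    have i0 : IntegrableOn (fun x => ∑ i, ∑ j,
        (polarTensor (layeredProfile L r σ) (fun _ => 1) x i j * pd i φ x : ℂ) *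
          polarVector (modeFun n dw) (modeTan n w) x j) (annulus 1 b) := by
      have i2 := ((hRT b).1.mul' (r := 2) hb2).integrable one_le_two
      have i3 := ((hRT b).2.mul' (r := 2) hb3).integrable one_le_two
      refine (i2.add i3).congr ?_
      refine (ae_restrict_iff' (measurableSet_annulus 1 b)).2 (.of_forall fun x hx => ?_)
      exact (sum_polarTensor_mul (layeredProfile L r σ) (fun _ => 1) (modeFun n dw) (modeTan n w)
        (fun i => pd i φ x) (norm_pos_iff.1 (one_pos.trans hx.1))).symm
    -- The conductivity and the test function are real, so the real part of the complex flux
    -- identity is the equation for the real part of the mode.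
    have h1 := Complex.reCLM.integral_comp_comm i0
    rw [hf, map_zero] at h1
    rw [← h1]
    refine setIntegral_congr_fun (measurableSet_annulus 1 b) fun x hx => ?_
    have hx0 : x ≠ 0 := norm_pos_iff.1 (one_pos.trans hx.1)
    simp only [isotropic_eq_polarTensor layered_eq_profile hx0, map_sum, Complex.reCLM_apply,
      smul_eq_mul, ← Complex.ofReal_mul, Complex.re_ofReal_mul]
  · refine ⟨|B|, 2, .of_forall fun x hx => ?_⟩
    have hx1 : 1 ≤ ‖x‖ := by linarith
    have hwx : w ‖x‖ = ‖x‖ ^ n + B * (‖x‖ ^ n)⁻¹ := by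
      rw [← hVB _ hx, ← logRadius_of_one_le hx1]
    simp only
    rw [re_modeFun_sub_harmCos hwx, abs_mul, abs_mul, abs_inv, abs_pow, abs_norm]
    have h1 : (‖x‖ ^ n)⁻¹ ≤ ‖x‖⁻¹ :=
      inv_anti₀ (by linarith) (le_self_pow₀ hx1 (by omega))
    have h2 := Real.abs_cos_le_one (n * angle x)
    have h3 : 0 ≤ (‖x‖ ^ n)⁻¹ := by positivity
    calc |B| * (‖x‖ ^ n)⁻¹ * |Real.cos (n * angle x)| ≤ |B| * (‖x‖ ^ n)⁻¹ * 1 :=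
          mul_le_mul_of_nonneg_left h2 (by positivity)
      _ ≤ |B| * ‖x‖⁻¹ := by
          rw [mul_one]
          exact mul_le_mul_of_nonneg_left h1 (abs_nonneg B)

/-- The exterior layer of a GPT-vanishing structure is transparent to low frequencies. -/
theorem IsCoatedDisk.flux_eq_of_isGPTVanishing (h : IsCoatedDisk L r σ) {N : ℕ}
    (hN : IsGPTVanishing N (layered L r σ)) {n : ℕ} (hn : 1 ≤ n) (hnN : n ≤ N) {V P : ℝ → ℝ}
    {v p : ℝ} (hV : ∀ T, IsLogMode n (fun τ => layeredProfile L r σ (Real.exp τ)) T V P)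
    (hv : 0 < v) (hp : 0 ≤ p)
    (hVp : ∀ τ, Real.log 2 < τ → V τ = layerFun n 1 v p (Real.log 2) τ) : p = n * v := by
  obtain ⟨Mcc, Mcs, Msc, Mss, hM, hM0⟩ := hN
  have hn0 : (0 : ℝ) < n := Nat.cast_pos.2 hn
  have ht : 0 ≤ p / n := by positivity
  have hvt : 0 < v + p / n := by linarith
  -- Beyond radius `2` the mode is `½(v + p/n)(s/2)^n + ½(v - p/n)(s/2)^{-n}`; the factor `2 * 2 ^ n
  -- / (v + p / n)` normalises the coefficient of `s ^ n` to `1`.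
  have hform : ∀ s, 2 < s → V (Real.log s) * (2 * 2 ^ n / (v + p / n)) =
      s ^ n + (v - p / n) / (v + p / n) * (2 ^ n) ^ 2 * (s ^ n)⁻¹ := by
    intro s hs
    have hs0 : 0 < s := two_pos.trans hs
    have e : Real.exp (n * (Real.log s - Real.log 2)) = s ^ n / 2 ^ n := by
      rw [← Real.log_div hs0.ne' two_ne_zero, Real.exp_nat_mul,
        Real.exp_log (div_pos hs0 two_pos), div_pow]
    rw [hVp _ (Real.log_lt_log two_pos hs), layerFun, Real.cosh_eq, Real.sinh_eq, Real.exp_neg, e,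
      mul_one]
    have h1 : 0 < s ^ n := by positivity
    have h2 : (0 : ℝ) < 2 ^ n := by positivity
    generalize p / (n : ℝ) = t at *
    generalize s ^ n = y at *
    generalize (2 : ℝ) ^ n = z at *
    have h3 := hvt.ne'
    field_simp
    ring
  have hsol := h.isTransmissionSolution hn hV hform
  -- By rotation invariance the cosine expansion alone already determines `p / v`.
  have hexp := hM.cos_expansion n hn _ hsol
  have hB := multipole_eq_zero (n := n) (B := (v - p / n) / (v + p / n) * (2 ^ n) ^ 2)
    (fun x hx => re_modeFun_sub_harmCos ?_) hexp fun m hm hmn => ?_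
  · have h2 : ((2 : ℝ) ^ n) ^ 2 ≠ 0 := by positivity
    have h3 : v - p / n = 0 := by simpa [hvt.ne', h2] using hB
    field_simp at h3
    linarith
  · rw [← hform _ hx, logRadius_of_one_le (by linarith)]
  · obtain ⟨h1, -, h3, -⟩ := hM0 m n hm (hmn.trans hnN) hn hnN
    exact ⟨h1, h3⟩

end Transmission

/-! ### The near-cloaking estimate -/

theorem natAbs_le_sqrt (k : ℤ) : (k.natAbs : ℝ) ≤ √(1 + (k : ℝ) ^ 2) := by
  have := abs_le_sqrt_one_add_sq (k : ℝ)
  rwa [← Int.cast_abs, ← Nat.cast_natAbs] at this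

/-- The Dirichlet-to-Neumann map of the homogeneous disk. -/
theorem isDtN_homogeneous {Λ : HHalf →L[ℂ] HMinusHalf}
    (hΛ : IsMultiplier (fun k => k.natAbs) Λ) : IsDtN (isotropic fun _ => 1) ∅ Λ := by
  refine isDtN_of_flux_le (a := 0) (c := fun _ => 1) (α := fun _ => 1)
    (w := fun k s => (s / 2) ^ k.natAbs) (p := fun k s => k.natAbs * (s / 2) ^ k.natAbs)
    (dw := fun k s => k.natAbs * (s / 2) ^ (k.natAbs - 1) * (1 / 2)) (Q := 1)
    le_rfl zero_le_two ⟨measurable_const, measurable_const, 1, 1, one_pos, fun _ _ => by simp⟩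
    ?_ ?_ (Or.inl rfl) isRadialMode_disk (fun k => by simp) (fun s => by simp) (fun k => ?_) ?_
  -- The disk and the annulus `0 < |x| < 2` differ only by the origin.
  · have h0 : ∀ᵐ x : Plane, x ≠ 0 := by simp [ae_iff]
    rw [sdiff_empty, eventuallyEq_set]
    filter_upwards [h0] with x hx
    simp [annulus, hx]
  · refine .of_forall fun x hx => ?_
    exact isotropic_eq_polarTensor (c := fun _ => 1) (fun _ => rfl) (norm_pos_iff.1 hx.1)
  · rw [one_mul, ← Int.cast_abs, ← Nat.cast_natAbs]
    simp
  · simpa using hΛ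

section CoatedDisk

variable {L : ℕ} {r σ : ℕ → ℝ} {ρ : ℝ}

/-- The layered profile is thus evaluated outside the core only, where it is positive. -/
theorem one_lt_blowDown_div (hρ : 0 < ρ) (hρ1 : ρ < 1) {s : ℝ} (hs : s ∈ Ioc 1 2) :
    1 < blowDown ρ s / ρ := by
  rw [one_lt_div hρ]
  have := strictMonoOn_blowDown hρ1 (left_mem_Icc.2 one_le_two) ⟨hs.1.le, hs.2⟩ hs.1
  rwa [blowDown_one hρ1] at this

theorem IsCoatedDisk.isCoefficient_blowDown (h : IsCoatedDisk L r σ) (hρ : 0 < ρ) (hρ1 : ρ < 1) :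
    IsCoefficient 1 2 (fun s => layeredProfile L r σ (blowDown ρ s / ρ)) (blowDownRatio ρ) := by
  obtain ⟨m, S, hm, hS⟩ := h.exists_bounds
  refine ⟨measurable_layeredProfile.comp (continuous_blowDown.measurable.div_const ρ),
    measurable_blowDownRatio, min m (1 / 2), max S (6 / ρ), lt_min hm (by norm_num),
    fun s hs => ⟨?_, ?_⟩⟩
  · obtain ⟨j, hj, e⟩ := h.exists_profile_eq
      (one_lt_blowDown_div hρ hρ1 (Ioo_subset_Ioc_self hs))
    rw [e]
    exact ⟨(min_le_left _ _).trans (hS j hj).1, (hS j hj).2.trans (le_max_left _ _)⟩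
  · obtain ⟨h1, h2⟩ := blowDownRatio_bounds hρ hρ1 hs
    exact ⟨(min_le_right _ _).trans h1, h2.trans (le_max_right _ _)⟩

/-- The Dirichlet-to-Neumann map of the near-cloak. -/
theorem IsCoatedDisk.isDtN_cloak (h : IsCoatedDisk L r σ) (hρ : 0 < ρ) (hρ1 : ρ < 1)
    {V P : ℕ → ℝ → ℝ}
    (hV : ∀ (n : ℕ) (T : ℝ), IsLogMode n (fun τ => layeredProfile L r σ (Real.exp τ)) T (V n) (P n))
    (hV0 : ∀ τ, V 0 τ = 1) (hpos : ∀ n, 0 < V n (Real.log (2 / ρ))) {Q : ℝ}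
    (hQ : ∀ n, P n (Real.log (2 / ρ)) / V n (Real.log (2 / ρ)) ≤ Q * n)
    {Λ : HHalf →L[ℂ] HMinusHalf}
    (hΛ : IsMultiplier (fun k => P k.natAbs (Real.log (2 / ρ)) / V k.natAbs (Real.log (2 / ρ))) Λ) :
    IsDtN (pushForward (blowUp ρ) (layered L r σ ∘ dilation (1 / ρ))) (Metric.closedBall 0 1) Λ := by
  -- The logarithmic radius of the preimage in the blown-up coated disk; `T' = blowDownSlope /
  -- blowDown = blowDownRatio / s` is the relation required by `IsLogMode.isRadialMode`.
  set T : ℝ → ℝ := fun s => Real.log (blowDown ρ s / ρ) with hT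
  have hdiv : ∀ s, 0 < blowDown ρ s / ρ := fun s => div_pos (blowDown_pos hρ s) hρ
  have hT2 : T 2 = Real.log (2 / ρ) := by
    simp only [hT]
    rw [blowDown_of_ge hρ1 (by norm_num)]
  have hc := h.isCoefficient_blowDown hρ hρ1
  have habs : ∀ k : ℤ, |(k : ℝ)| = k.natAbs := fun k => by rw [Nat.cast_natAbs, Int.cast_abs]
  -- The modes are divided by `V (T 2)`, so that they equal `1` on the outer circle and their flux
  -- there is the symbol.
  have hmode : ∀ k : ℤ, IsRadialMode 1 2 k (fun s => layeredProfile L r σ (blowDown ρ s / ρ))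
      (blowDownRatio ρ) (fun s => V k.natAbs (T s) * (V k.natAbs (T 2))⁻¹)
      (fun s => P k.natAbs (T s) * (V k.natAbs (T 2))⁻¹)
      (fun s => blowDownRatio ρ s * (P k.natAbs (T s) * (V k.natAbs (T 2))⁻¹) /
        (s * layeredProfile L r σ (blowDown ρ s / ρ))) := by
    intro k
    refine (hV k.natAbs (T 2)).isRadialMode (T := T) (S := {3 / 2}) one_pos one_lt_two hc
      (by rw [← habs, sq_abs]) ?_ ?_ ?_ (countable_singleton _) ?_ ?_
    · exact (continuous_blowDown.div_const ρ).log fun s => (hdiv s).ne'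
    · simp [hT, blowDown_one hρ1, hρ.ne']
    · intro s hs t ht hst
      exact Real.log_lt_log (hdiv s)
        (div_lt_div_of_pos_right (strictMonoOn_blowDown hρ1 hs ht hst) hρ)
    · intro s hs
      refine (((hasDerivAt_blowDown hρ1 hs.1.1 hs.2).div_const ρ).log (hdiv s).ne').congr_deriv ?_
      have h1 := (blowDown_pos hρ s).ne'
      have h2 : s ≠ 0 := (one_pos.trans hs.1.1).ne'
      rw [blowDownRatio]
      field_simp
    · intro s hs
      simp only [hT]
      rw [Real.exp_log (hdiv s)]
  refine isDtN_of_flux_le (a := 1) (Q := Q) zero_le_one one_le_two hc ?_ ?_ (Or.inr fun θ => ?_)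
    hmode (fun k => ?_) (fun s => ?_) (fun k => ?_) ?_
  · have e : Metric.ball 0 2 \ Metric.closedBall 0 1 = annulus 1 2 := by
      ext x
      simp [annulus, and_comm]
    exact EventuallyEq.of_eq e
  -- The push-forward formula fails only on the circle of radius `3/2`, where the blow-up has a
  -- corner; it is a null set.
  · have h0 : ∀ᵐ x : Plane, x ∉ Metric.sphere (0 : Plane) (3 / 2) :=
      measure_eq_zero_iff_ae_notMem.1 (Measure.addHaar_sphere _ _ _)
    filter_upwards [h0] with y hy3 hy
    refine pushForward_blowUp (f := fun t => layeredProfile L r σ (t / ρ)) hρ hρ1 (fun x => ?_) hy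
      (by simpa using hy3)
    rw [Function.comp_apply, dilation, layered_eq_profile, norm_smul, Real.norm_of_nonneg
      (by positivity), one_div_mul_eq_div]
  · simp [norm_polarPt zero_le_one]
  · rw [hT2]
    exact mul_inv_cancel₀ (hpos _).ne'
  · simp [hV0]
  · rw [hT2, habs, ← div_eq_mul_inv]
    exact hQ _
  · simpa only [hT2, ← div_eq_mul_inv] using hΛ

end CoatedDisk

end

end NearCloaking

/-! ### Proof of the estimate by comparison of the symbols. -/

theorem mainTheorem3 (L N : ℕ) (r σ : ℕ → ℝ)
    (hσ : NearCloaking.IsCoatedDisk L r σ)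
    (hGPT : NearCloaking.IsGPTVanishing N (NearCloaking.layered L r σ)) :
    ∃ C : ℝ, ∀ ρ : ℝ, 0 < ρ → ρ < 1 →
      ∃ Λρ Λ₁ : NearCloaking.HHalf →L[ℂ] NearCloaking.HMinusHalf,
        NearCloaking.IsDtN
          (NearCloaking.pushForward (NearCloaking.blowUp ρ)
            (NearCloaking.layered L r σ ∘ NearCloaking.dilation (1 / ρ)))
          (Metric.closedBall 0 1) Λρ ∧
        NearCloaking.IsDtN (NearCloaking.isotropic fun _ => 1) ∅ Λ₁ ∧
        ‖Λρ - Λ₁‖ ≤ C * ρ ^ (2 * N + 2) := by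
  obtain ⟨m, S, -, hS⟩ := hσ.exists_bounds
  have hS0 : 0 < S := (hσ.conductivity_pos (Nat.zero_le L)).trans_le (hS 0 (Nat.zero_le L)).2
  choose V P v p hV hv hp hpv hVP hV0 using hσ.exists_logMode_all fun j hj => (hS j hj).2
  have hdev : ∀ n : ℕ, |n * v n - p n| / v n ≤ n * (1 + S) := by
    intro n
    have h1 : 0 ≤ (n : ℝ) * v n := mul_nonneg (Nat.cast_nonneg n) (hv n).le
    rw [div_le_iff₀ (hv n), abs_le]
    constructor <;> nlinarith [hp n, hpv n, mul_nonneg h1 hS0.le]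
  -- The frequency `0` needs no tensor: `p ≤ nSv` already gives `p = 0`.
  have hlow : ∀ n : ℕ, n ≤ N → |n * v n - p n| / v n = 0 := by
    intro n hn
    have : p n = n * v n := by
      rcases Nat.eq_zero_or_pos n with rfl | hn0
      · have := hpv 0
        simp only [Nat.cast_zero, zero_mul] at this ⊢
        exact le_antisymm this (hp 0)
      · exact hσ.flux_eq_of_isGPTVanishing hGPT hn0 hn (hV n) (hv n) (hp n)
          fun τ hτ => (hVP n τ hτ).1
    rw [this, sub_self, abs_zero, zero_div]
  obtain ⟨Λ₁, hΛ₁⟩ := NearCloaking.exists_isMultiplier (l := fun k => (k.natAbs : ℝ)) (M := 1)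
    fun k => by simpa using NearCloaking.natAbs_le_sqrt k
  -- The factor `2π` comes from the multiplier norm, the inner `2` from the lower bound `V ≥ v
  -- ρ^{-n} / 2`, and `1 + S` from `hdev`.
  refine ⟨2 * Real.pi * (2 * (1 + S)), fun ρ hρ hρ1 => ?_⟩
  have hlog : Real.log 2 < Real.log (2 / ρ) :=
    Real.log_lt_log two_pos ((lt_div_iff₀ hρ).2 (by linarith))
  have hpos : ∀ n, 0 < V n (Real.log (2 / ρ)) := by
    intro n
    rw [(hVP n _ hlog).1]
    exact (NearCloaking.abs_layer_ratio_sub_le (hv n) (hp n) (hpv n) hρ hρ1).1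
  have hratio : ∀ n : ℕ, |P n (Real.log (2 / ρ)) / V n (Real.log (2 / ρ)) - n| ≤
      2 * (1 + S) * ρ ^ (2 * N + 2) * n := by
    intro n
    have h1 := (NearCloaking.abs_layer_ratio_sub_le (hv n) (hp n) (hpv n) hρ hρ1).2
    rw [← (hVP n _ hlog).1, ← (hVP n _ hlog).2] at h1
    refine h1.trans ?_
    rcases le_or_gt n N with hn | hn
    · rw [hlow n hn, mul_zero, zero_mul]
      positivity
    -- The first frequency not annihilated is `N + 1`, which gives the exponent `2N + 2`.
    · have h2 : ρ ^ (2 * n) ≤ ρ ^ (2 * N + 2) := pow_le_pow_of_le_one hρ.le hρ1.le (by omega)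
      calc 2 * (|n * v n - p n| / v n) * ρ ^ (2 * n)
          ≤ 2 * (n * (1 + S)) * ρ ^ (2 * N + 2) := by
            refine mul_le_mul (mul_le_mul_of_nonneg_left (hdev n) zero_le_two) h2 (by positivity)
              (by positivity)
        _ = _ := by ring
  have hρN : ρ ^ (2 * N + 2) ≤ 1 := pow_le_one₀ hρ.le hρ1.le
  have hratio_le : ∀ n : ℕ, |P n (Real.log (2 / ρ)) / V n (Real.log (2 / ρ)) - n| ≤
      2 * (1 + S) * n := fun n => (hratio n).trans (mul_le_mul_of_nonneg_right
    (mul_le_of_le_one_right (by positivity) hρN) (Nat.cast_nonneg n))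
  obtain ⟨Λρ, hΛρ⟩ := NearCloaking.exists_isMultiplier
    (l := fun k => P k.natAbs (Real.log (2 / ρ)) / V k.natAbs (Real.log (2 / ρ)))
    (M := 2 * (1 + S) + 1) fun k => by
      have h1 := abs_le.1 (hratio_le k.natAbs)
      have h2 : (0 : ℝ) ≤ k.natAbs := Nat.cast_nonneg _
      have h3 := mul_le_mul_of_nonneg_left (NearCloaking.natAbs_le_sqrt k)
        (by positivity : 0 ≤ 2 * (1 + S) + 1)
      refine le_trans (abs_le.2 ⟨?_, ?_⟩) h3 <;> nlinarith [h1.1, h1.2]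
  refine ⟨Λρ, Λ₁, ?_, NearCloaking.isDtN_homogeneous hΛ₁, ?_⟩
  · refine hσ.isDtN_cloak hρ hρ1 hV (hV0 0 rfl) hpos (Q := 2 * (1 + S) + 1) (fun n => ?_) hΛρ
    have h1 := (abs_le.1 (hratio_le n)).2
    linarith
  · refine (NearCloaking.norm_sub_le_of_isMultiplier hΛρ hΛ₁
      (M := 2 * (1 + S) * ρ ^ (2 * N + 2)) (by positivity) fun k => ?_).trans_eq (by ring)
    exact (hratio k.natAbs).trans (mul_le_mul_of_nonneg_left (NearCloaking.natAbs_le_sqrt k)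
      (by positivity))
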